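/- **Setting.** Let $d\ge 1$ and let $\{\varphi_{j,m}\}$, $\{\psi_{j,m}\}$ ($j\ge J_0$, $0\le m<2^j$) be a boundary-corrected (Cohen–Daubechies–Vial type) orthonormal wavelet system of $L^2([0,1])$ of regularity $S$, with continuous, compactly supported generators, reproducing polynomials of degree less than $S$. Let $\Phi_{j,m}(x)=\prod_i\varphi_{j,m_i}(x_i)$ and $\Psi^{\iota}_{l,m}$ ($\iota\in\{0,1\}^d\setminus\{0\}$) be the tensor-product scaling functions and wavelets on $[0,1]^d$. For a resolution $k=2^{jd}$, $j\ge J_0$, let $K_k(x,y)=\sum_m\Phi_{j,m}(x)\Phi_{j,m}(y)$. For $0<\alpha<S$, $M>0$, the Hölder ball $H(\alpha,M)$ is the set of uniformly continuous $h$ on $[0,1]^d$ with $$2^{J_0(\alpha+d/2)}\max_m|\langle h,\Phi_{J_0,m}\rangle|+\sup_{l\ge J_0,\,m,\,\iota\neq0}2^{l(\alpha+d/2)}|\langle h,\Psi^{\iota}_{l,m}\rangle|\le M .$$ Let $0<\alpha,\beta<S$, $M>0$ and $C_1,C_2\in\mathbb R$. The model $\mathcal P_{(\alpha,\beta)}$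 consists of all laws $\mathbb P$ of $(X,A,Y)$ such that $X$ is uniform on $[0,1]^d$, $A,Y\in[C_1,C_2]$ almost surely, $p(X)=E[A\mid X]$ with $p\in H(\alpha,M)$, and $b(X)=E[Y\mid X]$ with $b\in H(\beta,M)$. Assume that the model is nondegenerate: some constant function $c\in(C_1,C_2)$ belongs to $H(\alpha,M')\cap H(\beta,M')$ for some $M'<M$ (automatic if $C_1\le 0\le C_2$ and $C_1<C_2$). The target is $\psi(\mathbb P)=E_{\mathbb P}[\mathrm{Cov}_{\mathbb P}(A,Y\mid X)]$. From $n$ i.i.d. observations $(X_i,A_i,Y_i)$, all of which are used for all parts of the estimators (no sample splitting), put $\hat p_{k_1}(x)=\frac1n\sum_i A_iK_{k_1}(X_i,x)$, $\hat b_{k_2}(x)=\frac1n\sum_i Y_iK_{k_2}(X_i,x)$ and $$\hat\psi^{\mathrm{INT}}_{k_1,k_2}=\frac1n\sum_i A_iY_i-\int_{[0,1]^d}\hat p_{k_1}\hat b_{k_2}\,dx,\qquad \hat\psi^{\mathrm{MC}}_{k_1,k_2}=\frac1n\sum_i A_iY_i-\frac1n\sum_i\hat p_{k_1}(X_i)\hat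 b_{k_2}(X_i),$$ $$\hat\psi^{\mathrm{IF}}_{k_1,k_2}=\frac1n\sum_i\big(A_i-\hat p_{k_1}(X_i)\big)\big(Y_i-\hat b_{k_2}(X_i)\big).$$ The risk of an estimator is its worst-case mean squared error $\sup_{\mathbb P\in\mathcal P_{(\alpha,\beta)}}E_{\mathbb P}[(\hat\psi-\psi(\mathbb P))^2]$. The resolutions $k_1=k_1(n)$, $k_2=k_2(n)$ may depend on $n$; $k_{\min}=\min(k_1,k_2)$, $k_{\max}=\max(k_1,k_2)$. For sequences, $a_n\lesssim b_n$ means $a_n\le Cb_n$ for some $C$ not depending on $n$ and all large $n$, and $a_n\asymp b_n$ means $a_n\lesssim b_n\lesssim a_n$. An estimator is *minimax rate optimal* if its risk is $\lesssim$ the minimax risk, i.e. the infimum of the risk over all measurable functions of the sample. A rate $r_n$ is the *best rate* of one of the three estimators if every choice of resolutions has risk $\gtrsim r_n$ and some choice has risk $\asymp r_n$. **Corollary.** (a) Suppose $\frac{\alpha+\beta}2\ge\frac d2$. 1. $\hat\psi^{\mathrm{INT}}_{k_1,k_2}$ is minimax rate optimal, with risk $\asymp n^{-1}$, whenever $n^{\frac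 d{2\alpha+2\beta}}\lesssim k_{\min}\lesssim\sqrt n$. 2. $\hat\psi^{\mathrm{MC}}_{k_1,k_2}$ is minimax rate optimal, with risk $\asymp n^{-1}$, whenever $n^{\frac d{2\alpha+2\beta}}\lesssim k_{\min}$ and $k_{\max}\lesssim\sqrt n$. 3. $\hat\psi^{\mathrm{IF}}_{k_1,k_2}$ is minimax rate optimal, with risk $\asymp n^{-1}$, whenever $n^{\frac d{2\alpha+2\beta}}\lesssim k_{\max}\lesssim\sqrt n$. (b) Suppose $\frac{\alpha+\beta}2<\frac d2$. Then none of the three estimators is minimax rate optimal for any choice of $k_1,k_2$, and the best rate of each of them is $n^{-\frac{2\alpha+2\beta}{\alpha+\beta+d}}$. Moreover this rate is attained 1. by $\hat\psi^{\mathrm{INT}}_{k_1,k_2}$ whenever $k_{\min}\asymp n^{\frac d{\alpha+\beta+d}}$; 2. by $\hat\psi^{\mathrm{MC}}_{k_1,k_2}$ whenever $k_{\min}\asymp k_{\max}\asymp n^{\frac d{\alpha+\beta+d}}$; 3. by $\hat\psi^{\mathrm{IF}}_{k_1,k_2}$ whenever $k_{\max}\asymp n^{\frac d{\alpha+\beta+d}}$.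 -/

import Mathlib

open MeasureTheory Filter Set
open scoped ENNReal NNReal

noncomputable section

/-! ## Boundary-corrected (Cohen-Daubechies-Vial type) wavelets on the unit interval -/

/-- The generating functions of a boundary-corrected wavelet system on `[0,1]`:
the scaling function `φ` and the wavelet `ψ` used in the interior, the edge functions
`φL k, ψL k` (left end point) and `φR k, ψR k` (right end point, as functions of the rescaled
distance to `1`), `k < N`, and the coarsest level `J₀`. -/
structure CDVData where
  N : ℕ
  J₀ : ℕ
  φ : ℝ → ℝ
  ψ : ℝ → ℝ
  φL : ℕ → ℝ → ℝ
  φR : ℕ → ℝ → ℝ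
  ψL : ℕ → ℝ → ℝ
  ψR : ℕ → ℝ → ℝ

/-- The level-`j` system generated by an interior function `g`, left edge functions `gL` and right
edge functions `gR`. For `2 * N ≤ 2 ^ j` the indices `m < 2 ^ j` split into `N` left edge functions,
`2 ^ j - 2 * N` translates of `g` and `N` right edge functions. -/
def edgeSystem (N : ℕ) (g : ℝ → ℝ) (gL gR : ℕ → ℝ → ℝ) (j m : ℕ) (x : ℝ) : ℝ :=
  (2 : ℝ) ^ ((j : ℝ) / 2) *
    (if m < N then gL m (2 ^ j * x)
     else if m < 2 ^ j - N then g (2 ^ j * x - m)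
     else gR (2 ^ j - 1 - m) (2 ^ j * (1 - x)))

namespace CDVData

/-- The one-dimensional scaling functions `φ_{j,m}`, `m < 2 ^ j`. -/
def phi (W : CDVData) (j m : ℕ) (x : ℝ) : ℝ := edgeSystem W.N W.φ W.φL W.φR j m x

/-- The one-dimensional wavelets `ψ_{j,m}`, `m < 2 ^ j`. -/
def psi (W : CDVData) (j m : ℕ) (x : ℝ) : ℝ := edgeSystem W.N W.ψ W.ψL W.ψR j m x

/-- `W` generates a Cohen-Daubechies-Vial type orthonormal wavelet basis of `L²([0,1])`, of
regularity `S`: continuous compactly supported generators (edge functions are only used on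
`[0, ∞)`), nested spaces `V_j = span {φ_{j,m}}` with dense union in `L²([0,1])` which contain all
polynomials of degree less than `S`, and wavelets at level `j` that form an orthonormal basis of
the orthogonal complement of `V_j` in `V_{j+1}` (which has dimension `2 ^ (j+1) - 2 ^ j`). -/
structure IsCDV (W : CDVData) (S : ℕ) : Prop where
  S_le : S ≤ W.N
  level : 2 * W.N ≤ 2 ^ W.J₀
  continuous_φ : Continuous W.φ
  continuous_ψ : Continuous W.ψ
  support_φ : ∀ x, x ∉ Icc (1 - (W.N : ℝ)) W.N → W.φ x = 0
  support_ψ : ∀ x, x ∉ Icc (1 - (W.N : ℝ)) W.N → W.ψ x = 0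
  continuous_edge : ∀ g ∈ ({W.φL, W.φR, W.ψL, W.ψR} : Set (ℕ → ℝ → ℝ)), ∀ k < W.N,
    ContinuousOn (g k) (Ici 0)
  support_edge : ∀ g ∈ ({W.φL, W.φR, W.ψL, W.ψR} : Set (ℕ → ℝ → ℝ)), ∀ k < W.N,
    ∀ x, 2 * (W.N : ℝ) - 1 < x → g k x = 0
  orthonormal_phi : ∀ j, W.J₀ ≤ j → ∀ m < 2 ^ j, ∀ m' < 2 ^ j,
    ∫ x in Icc (0 : ℝ) 1, W.phi j m x * W.phi j m' x = if m = m' then 1 else 0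
  orthonormal_psi : ∀ j, W.J₀ ≤ j → ∀ m < 2 ^ j, ∀ m' < 2 ^ j,
    ∫ x in Icc (0 : ℝ) 1, W.psi j m x * W.psi j m' x = if m = m' then 1 else 0
  orthogonal : ∀ j, W.J₀ ≤ j → ∀ m < 2 ^ j, ∀ m' < 2 ^ j,
    ∫ x in Icc (0 : ℝ) 1, W.phi j m x * W.psi j m' x = 0
  nested_phi : ∀ j, W.J₀ ≤ j → ∀ m < 2 ^ j, ∃ a : ℕ → ℝ, ∀ x ∈ Icc (0 : ℝ) 1,
    W.phi j m x = ∑ m' ∈ Finset.range (2 ^ (j + 1)), a m' * W.phi (j + 1) m' x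
  nested_psi : ∀ j, W.J₀ ≤ j → ∀ m < 2 ^ j, ∃ a : ℕ → ℝ, ∀ x ∈ Icc (0 : ℝ) 1,
    W.psi j m x = ∑ m' ∈ Finset.range (2 ^ (j + 1)), a m' * W.phi (j + 1) m' x
  polynomials : ∀ j, W.J₀ ≤ j → ∀ r < S, ∃ a : ℕ → ℝ, ∀ x ∈ Icc (0 : ℝ) 1,
    x ^ r = ∑ m ∈ Finset.range (2 ^ j), a m * W.phi j m x
  complete : ∀ f : ℝ → ℝ, MemLp f 2 (volume.restrict (Icc (0 : ℝ) 1)) →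
    (∀ j, W.J₀ ≤ j → ∀ m < 2 ^ j, ∫ x in Icc (0 : ℝ) 1, W.phi j m x * f x = 0) →
    f =ᵐ[volume.restrict (Icc (0 : ℝ) 1)] 0

/-! ## The tensor product basis of `L²([0,1]^d)` and Hölder balls -/

variable {d : ℕ}

/-- The scaling functions `Φ_{j,m}` on `[0,1]^d`. -/
def Phi (W : CDVData) (j : ℕ) (m : Fin d → Fin (2 ^ j)) (x : Fin d → ℝ) : ℝ :=
  ∏ i, W.phi j (m i) (x i)

/-- The wavelets `Ψ^ι_{l,m}` on `[0,1]^d`, for `ι ≠ 0`. -/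
def Psi (W : CDVData) (ι : Fin d → Bool) (l : ℕ) (m : Fin d → Fin (2 ^ l)) (x : Fin d → ℝ) : ℝ :=
  ∏ i, if ι i then W.psi l (m i) (x i) else W.phi l (m i) (x i)

/-- The kernel of the orthogonal projection of `L²([0,1]^d)` onto the span of the `Φ_{j,m}`. -/
def kernel (W : CDVData) (j : ℕ) (x y : Fin d → ℝ) : ℝ :=
  ∑ m : Fin d → Fin (2 ^ j), W.Phi j m x * W.Phi j m y

/-- `h` belongs to the Hölder ball `H(α, M)`: it is uniformly continuous on `[0,1]^d` and
`2^{J₀(α+d/2)} sup_m |⟨h, Φ_{J₀,m}⟩| + sup_{l ≥ J₀, m, ι} 2^{l(α+d/2)} |⟨h, Ψ^ι_{l,m}⟩| ≤ M`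
(for `d > 0`, both suprema are over nonempty sets, so that the bound can be written for pairs
of indices). -/
def HolderBall (W : CDVData) (α M : ℝ) (h : (Fin d → ℝ) → ℝ) : Prop :=
  UniformContinuousOn h (Icc 0 1) ∧
  ∀ (m₀ : Fin d → Fin (2 ^ W.J₀)) (l : ℕ) (m : Fin d → Fin (2 ^ l)) (ι : Fin d → Bool),
    W.J₀ ≤ l → (∃ i, ι i = true) →
    (2 : ℝ) ^ ((W.J₀ : ℝ) * (α + d / 2)) * |∫ x in Icc (0 : Fin d → ℝ) 1, h x * W.Phi W.J₀ m₀ x| +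
      (2 : ℝ) ^ ((l : ℝ) * (α + d / 2)) * |∫ x in Icc (0 : Fin d → ℝ) 1, h x * W.Psi ι l m x| ≤ M

end CDVData

/-! ## Observations, the functional and the model -/

/-- An observation `(X, A, Y)`. -/
abbrev Obs (d : ℕ) := (Fin d → ℝ) × ℝ × ℝ

/-- The covariate `X`. -/
def covX {d : ℕ} (o : Obs d) : Fin d → ℝ := o.1

/-- The variable `A`. -/
def varA {d : ℕ} (o : Obs d) : ℝ := o.2.1

/-- The variable `Y`. -/
def varY {d : ℕ} (o : Obs d) : ℝ := o.2.2

/-- The σ-algebra generated by `X`. -/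
abbrev sigmaX (d : ℕ) : MeasurableSpace (Obs d) :=
  MeasurableSpace.comap (covX (d := d)) inferInstance

/-- The conditional covariance `Cov_P(A, Y | X)`. -/
def condCov {d : ℕ} (P : Measure (Obs d)) : Obs d → ℝ :=
  condExp (sigmaX d) P fun o =>
    (varA o - condExp (sigmaX d) P varA o) * (varY o - condExp (sigmaX d) P varY o)

/-- The functional `ψ(P) = E_P[Cov_P(A, Y | X)]`. -/
def expCondCov {d : ℕ} (P : Measure (Obs d)) : ℝ := ∫ o, condCov P o ∂P

/-- The constants that define a model. -/
structure ModelParams where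
  α : ℝ
  β : ℝ
  C₁ : ℝ
  C₂ : ℝ
  M : ℝ

/-- The laws `P` of `(X, A, Y)` with `X` uniform on `[0,1]^d`, `A, Y ∈ [C₁, C₂]` almost surely,
`E[A | X] = p(X)` with `p ∈ H(α, M)` and `E[Y | X] = b(X)` with `b ∈ H(β, M)`. -/
structure InModel {d : ℕ} (W : CDVData) (θ : ModelParams) (P : Measure (Obs d)) : Prop where
  prob : IsProbabilityMeasure P
  uniform : P.map covX = volume.restrict (Icc 0 1)
  bound_A : ∀ᵐ o ∂P, varA o ∈ Icc θ.C₁ θ.C₂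
  bound_Y : ∀ᵐ o ∂P, varY o ∈ Icc θ.C₁ θ.C₂
  regular_A : ∃ p : (Fin d → ℝ) → ℝ, W.HolderBall θ.α θ.M p ∧
    condExp (sigmaX d) P varA =ᵐ[P] fun o => p (covX o)
  regular_Y : ∃ b : (Fin d → ℝ) → ℝ, W.HolderBall θ.β θ.M b ∧
    condExp (sigmaX d) P varY =ᵐ[P] fun o => b (covX o)

/-! ## The estimators without sample splitting -/

section Estimators

variable {d : ℕ} (W : CDVData)

/-- Approximate wavelet projection estimator of `p`, with resolution `2 ^ (j * d)`. -/
def pHat (j n : ℕ) (o : Fin n → Obs d) (x : Fin d → ℝ) : ℝ :=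
  (1 / (n : ℝ)) * ∑ i, varA (o i) * W.kernel j (covX (o i)) x

/-- Approximate wavelet projection estimator of `b`, with resolution `2 ^ (j * d)`. -/
def bHat (j n : ℕ) (o : Fin n → Obs d) (x : Fin d → ℝ) : ℝ :=
  (1 / (n : ℝ)) * ∑ i, varY (o i) * W.kernel j (covX (o i)) x

/-- A family of estimators: for levels `j₁, j₂` (of the estimators of `p` and `b`) and sample size
`n`, a function of the sample. -/
abbrev EstimatorFamily (d : ℕ) := (j₁ j₂ n : ℕ) → (Fin n → Obs d) → ℝ

/-- The integral-based plug-in estimator. -/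
def psiINT : EstimatorFamily d := fun j₁ j₂ n o =>
  (1 / (n : ℝ)) * ∑ i, varA (o i) * varY (o i) -
    ∫ x in Icc (0 : Fin d → ℝ) 1, pHat W j₁ n o x * bHat W j₂ n o x

/-- The Monte Carlo-based plug-in estimator. -/
def psiMC : EstimatorFamily d := fun j₁ j₂ n o =>
  (1 / (n : ℝ)) * ∑ i, varA (o i) * varY (o i) -
    (1 / (n : ℝ)) * ∑ i, pHat W j₁ n o (covX (o i)) * bHat W j₂ n o (covX (o i))

/-- The first-order bias-corrected (influence function based) estimator. -/
def psiIF : EstimatorFamily d := fun j₁ j₂ n o =>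
  (1 / (n : ℝ)) * ∑ i, (varA (o i) - pHat W j₁ n o (covX (o i))) *
    (varY (o i) - bHat W j₂ n o (covX (o i)))

end Estimators

/-! ## Risks and rates -/

section Risk

variable {d : ℕ} (W : CDVData) (θ : ModelParams)

/-- Worst-case mean squared error over the model of an estimator that is applied to `n`
independent observations. -/
def worstRisk {n : ℕ} (T : (Fin n → Obs d) → ℝ) : ℝ≥0∞ :=
  ⨆ (P : Measure (Obs d)) (_ : InModel W θ P),
    ∫⁻ o, ENNReal.ofReal ((T o - expCondCov P) ^ 2) ∂(Measure.pi fun _ : Fin n => P)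

/-- The minimax risk: the infimum of the worst-case risk over all estimators. -/
def minimaxRisk (d n : ℕ) : ℝ≥0∞ :=
  ⨅ (T : (Fin n → Obs d) → ℝ) (_ : Measurable T), worstRisk W θ T

/-- `a_n ≲ b_n`. -/
def RateLE (a b : ℕ → ℝ≥0∞) : Prop :=
  ∃ C : ℝ≥0, 0 < C ∧ ∀ᶠ n in atTop, a n ≤ C * b n

/-- `a_n ≍ b_n`. -/
def RateEq (a b : ℕ → ℝ≥0∞) : Prop := RateLE a b ∧ RateLE b a

/-- The sequence `n ^ r`. -/
def powRate (r : ℝ) : ℕ → ℝ≥0∞ := fun n => ENNReal.ofReal ((n : ℝ) ^ r)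

/-- The resolutions `k_n = 2 ^ (j_n * d)` of a sequence of levels. -/
def resolution (d : ℕ) (j : ℕ → ℕ) : ℕ → ℝ≥0∞ := fun n => 2 ^ (j n * d)

/-- The smaller of the two resolutions. -/
def kMin (d : ℕ) (j₁ j₂ : ℕ → ℕ) : ℕ → ℝ≥0∞ := fun n => resolution d j₁ n ⊓ resolution d j₂ n

/-- The larger of the two resolutions. -/
def kMax (d : ℕ) (j₁ j₂ : ℕ → ℕ) : ℕ → ℝ≥0∞ := fun n => resolution d j₁ n ⊔ resolution d j₂ n

/-- Admissible choices of the two resolutions: all levels are at least the coarsest level `J₀`. -/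
def Admissible (j₁ j₂ : ℕ → ℕ) : Prop := ∀ n, W.J₀ ≤ j₁ n ∧ W.J₀ ≤ j₂ n

/-- The worst-case risk, as a sequence in `n`, of a family of estimators with chosen levels. -/
def tunedRisk (E : EstimatorFamily d) (j₁ j₂ : ℕ → ℕ) : ℕ → ℝ≥0∞ :=
  fun n => worstRisk W θ (E (j₁ n) (j₂ n) n)

/-- With the chosen levels, the worst-case risk is at most of the order of the minimax risk. -/
def MinimaxRateOptimal (E : EstimatorFamily d) (j₁ j₂ : ℕ → ℕ) : Prop :=
  RateLE (tunedRisk W θ E j₁ j₂) (minimaxRisk W θ d)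

/-- `r` is the best rate of the family: no choice of the resolutions gives a faster one, and some
choice attains it. -/
def IsBestRate (E : EstimatorFamily d) (r : ℕ → ℝ≥0∞) : Prop :=
  (∀ j₁ j₂, Admissible W j₁ j₂ → RateLE r (tunedRisk W θ E j₁ j₂)) ∧
  ∃ j₁ j₂, Admissible W j₁ j₂ ∧ RateEq (tunedRisk W θ E j₁ j₂) r

end Risk

end

/-!
The three estimators are the average of `A Y` minus averages that contain one or two kernel
estimators, where the kernels are those of the projections onto the wavelet spaces of a
multiresolution analysis of the cube. Write `s = α + β` and `k = 2 ^ (j * d)`.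

*Upper bounds.* In expectation and up to the diagonal terms (those in which an observation is paired
with itself) the estimators replace `∫ p b` by `∫ p Π b` for a projection `Π`. The projections are
nested, so that a product of two of them is the coarser one. Hence `Π` belongs to the lower of the
two levels for the integral-based and the Monte Carlo estimator. For the influence function based
estimator the linear terms cancel the coarser projection, and `Π` belongs to the higher level. The
error of this replacement telescopes over the levels above `j` into products of wavelet coefficients
and is `O(2 ^ (-s * j))` (`CDVData.IsCDV.exists_bias_le`). The remaining error consists of an
average of independent bounded variables, of order `n ^ (-1/2)`; of the interactions of bounded
weights with the stochastic errors of the kernel estimators, which are double sums with diagonal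
terms of order `k / n`; and, for the latter two estimators, of the product of the two stochastic
errors, which is controlled by their fourth moments. The squared errors add up to
`1 / n + (k / n) ^ 2 + (2 ^ (-s * j)) ^ 2`. For the integral-based estimator `k` is the smaller
resolution, as its integral contains only the kernel of the lower level; for the other two `k` is
the larger one (`exists_worstRisk_INT_le`, `exists_worstRisk_MC_le`, `exists_worstRisk_IF_le`).

*Lower bounds for the estimators.* Under a `tiltedLaw` the variables `A` and `Y` take two values
each, the regression functions are a constant plus multiples of the product over the coordinates of
the sum of all wavelets of a level, and `E[A Y | X]` is a constant. The projections up to this level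
do not see the perturbation, the Hölder balls allow it to contribute a constant times `2 ^ (-s * j)`
to `∫ p b`, and the expectation of the estimators can be computed exactly. The signs of the two
perturbations and of the shift of `E[A Y | X]` can be chosen such that the approximation error and
the diagonal terms, a multiple of `k / n`, have the same sign. So the risk is at least a multiple of
`(2 ^ (-s * j) + k / n) ^ 2`, where `j` is the lower level for the integral-based estimator and the
higher level for the other two. For every level this is at least a multiple of
`n ^ (-2 * s / (s + d))` (`rpow_le_add_resolution`), and the two terms balance at
`k = n ^ (d / (s + d))`.

*The minimax risk.* It is at least a multiple of `1 / n`, by the comparison of two laws for which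
`E[A Y | X]` differs by a multiple of `n ^ (-1/2)` (`two_point_bound`). This settles the case `d ≤
s`, where a squared error `1 / n` is attained. In the case `s < d` the U-statistic without diagonal
terms (`uStat`) has variance `O(1 / n + k / n ^ 2)`. At a resolution of higher order than the one
above its risk is of smaller order than `n ^ (-2 * s / (s + d))`, and none of the three estimators
is rate optimal (`exists_rateLE_minimaxRisk`).

The covariates and variables are moved to the nearest points of the cube and of `[C₁, C₂]` in the
kernels and estimators. Under the laws in the model this is an almost sure identity, and it makes
all functions of the sample bounded and measurable.
-/
noncomputable section

/-! ### Edge systems on the unit interval -/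

section

/-- The nearest point of `[0,1]`. -/
def unitClamp (t : ℝ) : ℝ := max 0 (min 1 t)

lemma unitClamp_mem (t : ℝ) : unitClamp t ∈ Icc (0 : ℝ) 1 := by
  unfold unitClamp
  exact ⟨le_max_left _ _, max_le zero_le_one (min_le_left _ _)⟩

lemma unitClamp_of_mem {t : ℝ} (ht : t ∈ Icc (0 : ℝ) 1) : unitClamp t = t := by
  unfold unitClamp
  rw [min_eq_right ht.2, max_eq_right ht.1]

lemma continuous_unitClamp : Continuous unitClamp := by
  unfold unitClamp; fun_prop

/-- Lebesgue measure on the unit interval. -/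
def unitMeasure : Measure ℝ := volume.restrict (Icc 0 1)

instance : IsProbabilityMeasure unitMeasure := ⟨by simp [unitMeasure]⟩

lemma ae_mem_unit : ∀ᵐ t ∂unitMeasure, t ∈ Icc (0 : ℝ) 1 := ae_restrict_mem measurableSet_Icc

lemma Continuous.integrable_unit {f : ℝ → ℝ} (hf : Continuous f) : Integrable f unitMeasure :=
  hf.integrableOn_Icc

lemma integral_unit_congr {f g : ℝ → ℝ} (h : ∀ t ∈ Icc (0 : ℝ) 1, f t = g t) :
    ∫ t, f t ∂unitMeasure = ∫ t, g t ∂unitMeasure := by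
  refine integral_congr_ae ?_
  filter_upwards [ae_mem_unit] with t ht using h t ht

namespace CDVData

variable {W : CDVData} {S : ℕ}

/-- The function `φ_{j,m}` on `[0,1]`, extended to a continuous function on the line that is
constant on both sides. -/
def phiC (W : CDVData) (j m : ℕ) (t : ℝ) : ℝ := W.phi j m (unitClamp t)

/-- The function `ψ_{j,m}` on `[0,1]`, extended to a continuous function on the line that is
constant on both sides. -/
def psiC (W : CDVData) (j m : ℕ) (t : ℝ) : ℝ := W.psi j m (unitClamp t)

end CDVData

/-- Generators of an edge system that are continuous with the supports of a
Cohen-Daubechies-Vial system. -/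
structure IsEdgeGen (N : ℕ) (g : ℝ → ℝ) (gL gR : ℕ → ℝ → ℝ) : Prop where
  cont : Continuous g
  supp : ∀ x, x ∉ Icc (1 - (N : ℝ)) N → g x = 0
  contL : ∀ k < N, ContinuousOn (gL k) (Ici 0)
  contR : ∀ k < N, ContinuousOn (gR k) (Ici 0)
  suppL : ∀ k < N, ∀ x, 2 * (N : ℝ) - 1 < x → gL k x = 0
  suppR : ∀ k < N, ∀ x, 2 * (N : ℝ) - 1 < x → gR k x = 0

lemma CDVData.IsCDV.edgeGen_phi {W : CDVData} {S : ℕ} (hW : W.IsCDV S) :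
    IsEdgeGen W.N W.φ W.φL W.φR :=
  ⟨hW.continuous_φ, hW.support_φ, hW.continuous_edge _ (by simp), hW.continuous_edge _ (by simp),
    hW.support_edge _ (by simp), hW.support_edge _ (by simp)⟩

lemma CDVData.IsCDV.edgeGen_psi {W : CDVData} {S : ℕ} (hW : W.IsCDV S) :
    IsEdgeGen W.N W.ψ W.ψL W.ψR :=
  ⟨hW.continuous_ψ, hW.support_ψ, hW.continuous_edge _ (by simp), hW.continuous_edge _ (by simp),
    hW.support_edge _ (by simp), hW.support_edge _ (by simp)⟩

section Edge

variable {N : ℕ} {g : ℝ → ℝ} {gL gR : ℕ → ℝ → ℝ}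

/-- A right edge index, counted from the right end point, is smaller than the number of edge
functions. -/
lemma right_index_lt {j m : ℕ} (hm : m < 2 ^ j) (h : ¬ m < 2 ^ j - N) : 2 ^ j - 1 - m < N := by
  omega

lemma IsEdgeGen.continuous (hg : IsEdgeGen N g gL gR) {j m : ℕ} (hm : m < 2 ^ j) :
    Continuous fun t => edgeSystem N g gL gR j m (unitClamp t) := by
  unfold edgeSystem
  refine continuous_const.mul ?_
  split_ifs with h1 h2
  · refine (hg.contL m h1).comp_continuous (continuous_const.mul continuous_unitClamp) fun t => ?_
    exact mul_nonneg (by positivity) (unitClamp_mem t).1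
  · exact hg.cont.comp ((continuous_const.mul continuous_unitClamp).sub continuous_const)
  · refine (hg.contR _ (right_index_lt hm h2)).comp_continuous
      (continuous_const.mul (continuous_const.sub continuous_unitClamp)) fun t => ?_
    exact mul_nonneg (by positivity) (sub_nonneg.2 (unitClamp_mem t).2)

lemma exists_bound_of_continuousOn_of_support {f : ℝ → ℝ} {s : Set ℝ} {a b : ℝ}
    (hf : ContinuousOn f s) (hs : Icc a b ⊆ s) (h0 : ∀ x ∈ s, x ∉ Icc a b → f x = 0) :
    ∃ C, 0 ≤ C ∧ ∀ x ∈ s, |f x| ≤ C := by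
  obtain ⟨C, hC⟩ := isCompact_Icc.exists_bound_of_continuousOn (hf.mono hs)
  refine ⟨max C 0, le_max_right _ _, fun x hx => ?_⟩
  by_cases h : x ∈ Icc a b
  · exact (hC x h).trans (le_max_left _ _)
  · rw [h0 x hx h]; simp

/-- The generators are bounded, so that the level-`j` functions are bounded by a multiple of
`2 ^ (j / 2)`. -/
lemma IsEdgeGen.exists_bound (hg : IsEdgeGen N g gL gR) :
    ∃ C, 0 ≤ C ∧ ∀ j m, m < 2 ^ j → ∀ t,
      |edgeSystem N g gL gR j m (unitClamp t)| ≤ C * 2 ^ ((j : ℝ) / 2) := by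
  obtain ⟨C, hC0, hC⟩ := exists_bound_of_continuousOn_of_support (s := univ)
    hg.cont.continuousOn (subset_univ _) fun x _ hx => hg.supp x hx
  have key : ∀ f : ℕ → ℝ → ℝ, (∀ k < N, ContinuousOn (f k) (Ici 0)) →
      (∀ k < N, ∀ x, 2 * (N : ℝ) - 1 < x → f k x = 0) →
      ∃ D, 0 ≤ D ∧ ∀ k < N, ∀ x ∈ Ici (0 : ℝ), |f k x| ≤ D := by
    intro f hf h0
    have : ∀ k, ∃ D, 0 ≤ D ∧ (k < N → ∀ x ∈ Ici (0 : ℝ), |f k x| ≤ D) := by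
      intro k
      by_cases hk : k < N
      · obtain ⟨D, hD0, hD⟩ := exists_bound_of_continuousOn_of_support (a := 0)
          (b := 2 * (N : ℝ) - 1) (hf k hk) (fun x hx => hx.1) fun x hx hx' => by
            refine h0 k hk x ?_
            by_contra hcon
            exact hx' ⟨hx, not_lt.1 hcon⟩
        exact ⟨D, hD0, fun _ => hD⟩
      · exact ⟨0, le_rfl, fun h => absurd h hk⟩
    choose D hD0 hD using this
    refine ⟨∑ k ∈ Finset.range N, D k, Finset.sum_nonneg fun k _ => hD0 k, fun k hk x hx => ?_⟩
    exact (hD k hk x hx).trans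
      (Finset.single_le_sum (f := D) (fun i _ => hD0 i) (Finset.mem_range.2 hk))
  obtain ⟨D, hD0, hD⟩ := key gL hg.contL hg.suppL
  obtain ⟨E, hE0, hE⟩ := key gR hg.contR hg.suppR
  refine ⟨C + D + E, by positivity, fun j m hm t => ?_⟩
  unfold edgeSystem
  rw [abs_mul, abs_of_nonneg (by positivity : (0 : ℝ) ≤ 2 ^ ((j : ℝ) / 2)), mul_comm]
  refine mul_le_mul_of_nonneg_right ?_ (by positivity)
  split_ifs with h1 h2
  · have := hD m h1 (2 ^ j * unitClamp t) (mul_nonneg (by positivity) (unitClamp_mem t).1)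
    linarith
  · have := hC (2 ^ j * unitClamp t - m) (mem_univ _)
    linarith
  · have := hE _ (right_index_lt hm h2) (2 ^ j * (1 - unitClamp t))
      (mul_nonneg (by positivity) (sub_nonneg.2 (unitClamp_mem t).2))
    linarith

/-- The support of a level-`j` function has length at most `2 * N / 2 ^ j`. -/
lemma IsEdgeGen.local (hg : IsEdgeGen N g gL gR) {j m : ℕ} (hm : m < 2 ^ j) {s t : ℝ}
    (hs : edgeSystem N g gL gR j m (unitClamp s) ≠ 0)
    (ht : edgeSystem N g gL gR j m (unitClamp t) ≠ 0) :
    |unitClamp s - unitClamp t| ≤ 2 * N / 2 ^ j := by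
  have h2j : (0 : ℝ) < 2 ^ j := by positivity
  have hs1 := unitClamp_mem s
  have ht1 := unitClamp_mem t
  have habs : ∀ y : ℝ, |y| * 2 ^ j = |y * 2 ^ j| := fun y => by rw [abs_mul, abs_of_pos h2j]
  rw [le_div_iff₀ h2j, habs]
  unfold edgeSystem at hs ht
  have hs := right_ne_zero_of_mul hs
  have ht := right_ne_zero_of_mul ht
  generalize unitClamp s = x at *
  generalize unitClamp t = y at *
  split_ifs at hs ht with h1 h2
  · have hx : 2 ^ j * x ≤ 2 * N - 1 := by
      by_contra h; exact hs (hg.suppL m h1 _ (not_le.1 h))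
    have hy : 2 ^ j * y ≤ 2 * N - 1 := by
      by_contra h; exact ht (hg.suppL m h1 _ (not_le.1 h))
    have := mul_nonneg h2j.le hs1.1
    have := mul_nonneg h2j.le ht1.1
    rw [abs_le]; constructor <;> linarith
  · have hx : 2 ^ j * x - m ∈ Icc (1 - (N : ℝ)) N := by
      by_contra h; exact hs (hg.supp _ h)
    have hy : 2 ^ j * y - m ∈ Icc (1 - (N : ℝ)) N := by
      by_contra h; exact ht (hg.supp _ h)
    have := hx.1; have := hx.2; have := hy.1; have := hy.2
    rw [abs_le]; constructor <;> linarith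
  · have hx : 2 ^ j * (1 - x) ≤ 2 * N - 1 := by
      by_contra h; exact hs (hg.suppR _ (right_index_lt hm h2) _ (not_le.1 h))
    have hy : 2 ^ j * (1 - y) ≤ 2 * N - 1 := by
      by_contra h; exact ht (hg.suppR _ (right_index_lt hm h2) _ (not_le.1 h))
    have := mul_nonneg h2j.le (sub_nonneg.2 hs1.2)
    have := mul_nonneg h2j.le (sub_nonneg.2 ht1.2)
    rw [abs_le]; constructor <;> linarith

/-- At every point at most `4 * N + 1` functions of a level do not vanish. -/
lemma IsEdgeGen.card_ne_zero_le (hg : IsEdgeGen N g gL gR) (j : ℕ) (t : ℝ) :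
    (Finset.univ.filter fun m : Fin (2 ^ j) =>
      edgeSystem N g gL gR j m (unitClamp t) ≠ 0).card ≤ 4 * N + 1 := by
  classical
  set x := unitClamp t
  set z : ℤ := ⌊2 ^ j * x⌋
  -- The `2 * N` edge indices, and the interior indices within `N` of `2 ^ j * x`.
  let A : Finset ℤ := (Finset.Ico (0 : ℤ) N ∪ Finset.Ico ((2 : ℤ) ^ j - N) (2 ^ j)) ∪
    Finset.Icc (z - N) (z + N)
  have hA : A.card ≤ 4 * N + 1 := by
    refine (Finset.card_union_le _ _).trans ?_
    refine (Nat.add_le_add_right (Finset.card_union_le _ _) _).trans ?_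
    simp only [Int.card_Ico, Int.card_Icc]
    omega
  refine le_trans ?_ hA
  refine Finset.card_le_card_of_injOn (fun m => ((m : ℕ) : ℤ)) ?_ ?_
  · intro m hm
    simp only [Finset.coe_filter, Finset.mem_univ, true_and, mem_ofPred_eq] at hm
    have hm2 := m.2
    have hm2' : ((m : ℕ) : ℤ) < 2 ^ j := by exact_mod_cast hm2
    unfold edgeSystem at hm
    have hm := right_ne_zero_of_mul hm
    simp only [A, Finset.coe_union, Finset.coe_Ico, Finset.coe_Icc, mem_union, mem_Ico, mem_Icc]
    split_ifs at hm with h1 h2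
    · left; left; omega
    · right
      have hx : 2 ^ j * x - (m : ℕ) ∈ Icc (1 - (N : ℝ)) N := by
        by_contra h; exact hm (hg.supp _ h)
      have hz1 : (z : ℝ) ≤ 2 ^ j * x := Int.floor_le _
      have hz2 : 2 ^ j * x < z + 1 := Int.lt_floor_add_one _
      have h3 : ((z : ℤ) : ℝ) - N ≤ ((m : ℕ) : ℝ) := by linarith [hx.2]
      have h4 : ((m : ℕ) : ℝ) < z + N := by linarith [hx.1]
      constructor
      · exact_mod_cast h3
      · exact_mod_cast h4.le
    · left; right
      have h3 : 2 ^ j ≤ (m : ℕ) + N := by omega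
      have h4 : (2 : ℤ) ^ j ≤ (m : ℕ) + N := by exact_mod_cast h3
      constructor
      · linarith
      · exact hm2'
  · intro a _ b _ hab
    exact Fin.ext (Int.ofNat_inj.1 hab)

/-- A sum over a level of terms that vanish together with the functions of the level is bounded by a
multiple of the largest term. -/
lemma IsEdgeGen.abs_sum_le (hg : IsEdgeGen N g gL gR) {j : ℕ} {t B : ℝ} (a : Fin (2 ^ j) → ℝ)
    (h0 : ∀ m : Fin (2 ^ j), edgeSystem N g gL gR j m (unitClamp t) = 0 → a m = 0)
    (hB : ∀ m, |a m| ≤ B) :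
    |∑ m, a m| ≤ (4 * N + 1) * B := by
  classical
  have hB0 : 0 ≤ B := (abs_nonneg _).trans (hB ⟨0, by positivity⟩)
  rw [← Finset.sum_filter_of_ne (p := fun m : Fin (2 ^ j) =>
      edgeSystem N g gL gR j m (unitClamp t) ≠ 0) (fun m _ hm h => hm (h0 m h))]
  refine (Finset.abs_sum_le_sum_abs _ _).trans ?_
  refine (Finset.sum_le_card_nsmul _ _ B fun m _ => hB m).trans ?_
  rw [nsmul_eq_mul]
  refine mul_le_mul_of_nonneg_right ?_ hB0
  exact_mod_cast hg.card_ne_zero_le j t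

end Edge
end

/-! ### Projection kernels on the unit interval -/

section

namespace CDVData

variable {W : CDVData} {S : ℕ}

lemma IsCDV.continuous_phiC (hW : W.IsCDV S) {j m : ℕ} (hm : m < 2 ^ j) :
    Continuous (W.phiC j m) := hW.edgeGen_phi.continuous hm

lemma IsCDV.continuous_psiC (hW : W.IsCDV S) {j m : ℕ} (hm : m < 2 ^ j) :
    Continuous (W.psiC j m) := hW.edgeGen_psi.continuous hm

lemma integral_unit_clamp (f : ℝ → ℝ) :
    ∫ t, f (unitClamp t) ∂unitMeasure = ∫ t in Icc (0 : ℝ) 1, f t :=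
  integral_unit_congr fun t ht => by rw [unitClamp_of_mem ht]

lemma IsCDV.integral_phiC_phiC (hW : W.IsCDV S) {j : ℕ} (hj : W.J₀ ≤ j) (m m' : Fin (2 ^ j)) :
    ∫ t, W.phiC j m t * W.phiC j m' t ∂unitMeasure = if m = m' then 1 else 0 := by
  have := integral_unit_clamp fun t => W.phi j m t * W.phi j m' t
  simp only [phiC]
  rw [this, hW.orthonormal_phi j hj m m.2 m' m'.2]
  simp [Fin.ext_iff]

lemma IsCDV.integral_psiC_psiC (hW : W.IsCDV S) {j : ℕ} (hj : W.J₀ ≤ j) (m m' : Fin (2 ^ j)) :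
    ∫ t, W.psiC j m t * W.psiC j m' t ∂unitMeasure = if m = m' then 1 else 0 := by
  have := integral_unit_clamp fun t => W.psi j m t * W.psi j m' t
  simp only [psiC]
  rw [this, hW.orthonormal_psi j hj m m.2 m' m'.2]
  simp [Fin.ext_iff]

lemma IsCDV.integral_phiC_psiC (hW : W.IsCDV S) {j : ℕ} (hj : W.J₀ ≤ j) (m m' : Fin (2 ^ j)) :
    ∫ t, W.phiC j m t * W.psiC j m' t ∂unitMeasure = 0 := by
  have := integral_unit_clamp fun t => W.phi j m t * W.psi j m' t
  simp only [phiC, psiC]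
  rw [this, hW.orthogonal j hj m m.2 m' m'.2]

/-- The function `f` belongs to the span `V_j` of the scaling functions of level `j`, extended to
the line. -/
def InV (W : CDVData) (j : ℕ) (f : ℝ → ℝ) : Prop :=
  ∃ a : Fin (2 ^ j) → ℝ, ∀ t, f t = ∑ m, a m * W.phiC j m t

lemma inV_of_unit {j : ℕ} {f : ℝ → ℝ}
    (h : ∃ a : ℕ → ℝ, ∀ x ∈ Icc (0 : ℝ) 1, f x = ∑ m ∈ Finset.range (2 ^ j), a m * W.phi j m x) :
    W.InV j (fun t => f (unitClamp t)) := by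
  obtain ⟨a, ha⟩ := h
  refine ⟨fun m => a m, fun t => ?_⟩
  change f (unitClamp t) = _
  rw [ha _ (unitClamp_mem t), Finset.sum_range]
  rfl

lemma InV.sum {j : ℕ} {ι : Type*} (s : Finset ι) {f : ι → ℝ → ℝ} (c : ι → ℝ)
    (hf : ∀ i ∈ s, W.InV j (f i)) : W.InV j (fun t => ∑ i ∈ s, c i * f i t) := by
  have : ∀ i, ∃ a : Fin (2 ^ j) → ℝ, i ∈ s → ∀ t, f i t = ∑ m, a m * W.phiC j m t := by
    intro i
    by_cases hi : i ∈ s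
    · obtain ⟨a, ha⟩ := hf i hi
      exact ⟨a, fun _ => ha⟩
    · exact ⟨0, fun h => absurd h hi⟩
  choose a ha using this
  refine ⟨fun m => ∑ i ∈ s, c i * a i m, fun t => ?_⟩
  simp_rw [Finset.sum_mul]
  rw [Finset.sum_comm]
  refine Finset.sum_congr rfl fun i hi => ?_
  rw [ha i hi t, Finset.mul_sum]
  simp_rw [mul_assoc]

lemma inV_phiC (j : ℕ) (m : Fin (2 ^ j)) : W.InV j (W.phiC j m) :=
  ⟨fun m' => if m' = m then 1 else 0, fun t => by simp⟩

lemma IsCDV.inV_succ (hW : W.IsCDV S) {j : ℕ} (hj : W.J₀ ≤ j) {f : ℝ → ℝ} (hf : W.InV j f) :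
    W.InV (j + 1) f := by
  obtain ⟨a, ha⟩ := hf
  have : f = fun t => ∑ m : Fin (2 ^ j), a m * W.phiC j m t := funext ha
  rw [this]
  exact InV.sum _ _ fun m _ => inV_of_unit (hW.nested_phi j hj m m.2)

lemma IsCDV.inV_mono (hW : W.IsCDV S) {j l : ℕ} (hj : W.J₀ ≤ j) (hjl : j ≤ l) {f : ℝ → ℝ}
    (hf : W.InV j f) : W.InV l f := by
  induction l, hjl using Nat.le_induction with
  | base => exact hf
  | succ l hl ih => exact hW.inV_succ (hj.trans hl) ih

lemma IsCDV.inV_psiC (hW : W.IsCDV S) {j : ℕ} (hj : W.J₀ ≤ j) (m : Fin (2 ^ j)) :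
    W.InV (j + 1) (W.psiC j m) := inV_of_unit (hW.nested_psi j hj m m.2)

lemma IsCDV.inV_one (hW : W.IsCDV S) (hS : 0 < S) {j : ℕ} (hj : W.J₀ ≤ j) :
    W.InV j (fun _ => 1) := by
  have := inV_of_unit (hW.polynomials j hj 0 hS)
  simpa using this

lemma IsCDV.continuous_inV (hW : W.IsCDV S) {j : ℕ} {f : ℝ → ℝ} (hf : W.InV j f) :
    Continuous f := by
  obtain ⟨a, ha⟩ := hf
  rw [funext ha]
  exact continuous_finsetSum _ fun m _ => continuous_const.mul (hW.continuous_phiC m.2)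

/-- Functions of `V_l` are orthogonal to the wavelets of level `l`. -/
lemma IsCDV.integral_inV_psiC (hW : W.IsCDV S) {l : ℕ} (hl : W.J₀ ≤ l) {f : ℝ → ℝ}
    (hf : W.InV l f) (m : Fin (2 ^ l)) : ∫ t, f t * W.psiC l m t ∂unitMeasure = 0 := by
  obtain ⟨a, ha⟩ := hf
  simp_rw [ha, Finset.sum_mul, mul_assoc]
  rw [integral_finsetSum]
  · simp_rw [integral_const_mul, hW.integral_phiC_psiC hl]
    simp
  · intro i _
    exact (((hW.continuous_phiC i.2).mul (hW.continuous_psiC m.2)).integrable_unit).const_mul _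

/-- Wavelets of different levels are orthogonal. -/
lemma IsCDV.integral_psiC_psiC_of_ne (hW : W.IsCDV S) {l l' : ℕ} (hl : W.J₀ ≤ l)
    (hl' : W.J₀ ≤ l') (hne : l ≠ l') (m : Fin (2 ^ l)) (m' : Fin (2 ^ l')) :
    ∫ t, W.psiC l m t * W.psiC l' m' t ∂unitMeasure = 0 := by
  rcases Nat.lt_or_gt_of_ne hne with h | h
  · exact hW.integral_inV_psiC hl' (hW.inV_mono (by omega) h (hW.inV_psiC hl m)) m'
  · simp_rw [mul_comm (W.psiC l m _)]
    exact hW.integral_inV_psiC hl (hW.inV_mono (by omega) h (hW.inV_psiC hl' m')) m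

/-- The reproducing kernel of `V_j`. -/
def kphi (W : CDVData) (j : ℕ) (s t : ℝ) : ℝ := ∑ m : Fin (2 ^ j), W.phiC j m s * W.phiC j m t

/-- The kernel of the projection onto the span of the wavelets of level `j`. -/
def kpsi (W : CDVData) (j : ℕ) (s t : ℝ) : ℝ := ∑ m : Fin (2 ^ j), W.psiC j m s * W.psiC j m t

lemma kphi_comm (j : ℕ) (s t : ℝ) : W.kphi j s t = W.kphi j t s := by
  unfold kphi; simp_rw [mul_comm]

lemma kphi_self_nonneg (j : ℕ) (s : ℝ) : 0 ≤ W.kphi j s s :=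
  Finset.sum_nonneg fun _ _ => mul_self_nonneg _

lemma IsCDV.continuous_kphi (hW : W.IsCDV S) (j : ℕ) :
    Continuous fun q : ℝ × ℝ => W.kphi j q.1 q.2 :=
  continuous_finsetSum _ fun m _ => ((hW.continuous_phiC m.2).comp continuous_fst).mul
    ((hW.continuous_phiC m.2).comp continuous_snd)

lemma inV_kphi (j : ℕ) (s : ℝ) : W.InV j (W.kphi j s) := ⟨fun m => W.phiC j m s, fun _ => rfl⟩

lemma IsCDV.integral_kphi_mul (hW : W.IsCDV S) {j : ℕ} (hj : W.J₀ ≤ j) {f : ℝ → ℝ}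
    (hf : W.InV j f) (s : ℝ) : ∫ t, W.kphi j s t * f t ∂unitMeasure = f s := by
  obtain ⟨a, ha⟩ := hf
  unfold kphi
  simp_rw [ha, Finset.sum_mul_sum]
  rw [integral_finsetSum]
  · refine Finset.sum_congr rfl fun m _ => ?_
    rw [integral_finsetSum]
    · have : ∀ i : Fin (2 ^ j), ∫ t, W.phiC j m s * W.phiC j m t * (a i * W.phiC j i t) ∂unitMeasure
          = W.phiC j m s * a i * if m = i then 1 else 0 := by
        intro i
        rw [← hW.integral_phiC_phiC hj, ← integral_const_mul]
        congr 1; ext t; ring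
      simp_rw [this]
      simp [mul_comm]
    · intro i _
      exact (((continuous_const.mul (hW.continuous_phiC m.2)).mul
        (continuous_const.mul (hW.continuous_phiC i.2))).integrable_unit)
  · intro m _
    exact (continuous_finsetSum _ fun i _ => ((continuous_const.mul (hW.continuous_phiC m.2)).mul
        (continuous_const.mul (hW.continuous_phiC i.2)))).integrable_unit

/-- The projections onto nested spaces commute: composing them gives the coarser one. -/
lemma IsCDV.integral_kphi_kphi (hW : W.IsCDV S) {j l : ℕ} (hj : W.J₀ ≤ j) (hl : W.J₀ ≤ l)
    (s u : ℝ) : ∫ t, W.kphi j s t * W.kphi l t u ∂unitMeasure = W.kphi (min j l) s u := by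
  rcases le_total j l with h | h
  · rw [min_eq_left h]
    simp_rw [mul_comm (W.kphi j s _), kphi_comm (W := W) l _ u]
    rw [hW.integral_kphi_mul hl (hW.inV_mono hj h (inV_kphi j s))]
  · rw [min_eq_right h]
    simp_rw [kphi_comm (W := W) l _ u]
    rw [hW.integral_kphi_mul hj (hW.inV_mono hl h (inV_kphi l u)), kphi_comm]

lemma IsCDV.integral_kphi (hW : W.IsCDV S) (hS : 0 < S) {j : ℕ} (hj : W.J₀ ≤ j) (s : ℝ) :
    ∫ t, W.kphi j s t ∂unitMeasure = 1 := by
  simpa using hW.integral_kphi_mul hj (hW.inV_one hS hj) s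

lemma IsCDV.integral_kphi_self (hW : W.IsCDV S) {j : ℕ} (hj : W.J₀ ≤ j) :
    ∫ t, W.kphi j t t ∂unitMeasure = 2 ^ j := by
  unfold kphi
  rw [integral_finsetSum]
  · simp_rw [hW.integral_phiC_phiC hj]
    simp
  · exact fun m _ => ((hW.continuous_phiC m.2).mul (hW.continuous_phiC m.2)).integrable_unit

/-- The kernel of `V_{j+1}` is the sum of the kernels of `V_j` and of its wavelet complement. The
coefficients of the two orthonormal systems in the basis of `V_{j+1}` form a square matrix with
orthonormal rows, hence an orthogonal matrix. -/
lemma IsCDV.kphi_succ (hW : W.IsCDV S) {j : ℕ} (hj : W.J₀ ≤ j) (s t : ℝ) :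
    W.kphi (j + 1) s t = W.kphi j s t + W.kpsi j s t := by
  let f : Fin (2 ^ j) ⊕ Fin (2 ^ j) → ℝ → ℝ := Sum.elim (fun m => W.phiC j m) fun m => W.psiC j m
  have hf : ∀ x, W.InV (j + 1) (f x) := by
    rintro (m | m)
    · exact hW.inV_succ hj (inV_phiC j m)
    · exact hW.inV_psiC hj m
  have horth : ∀ x y, ∫ u, f x u * f y u ∂unitMeasure = if x = y then 1 else 0 := by
    rintro (m | m) (m' | m')
    · simpa [f] using hW.integral_phiC_phiC hj m m'
    · simpa [f] using hW.integral_phiC_psiC hj m m'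
    · simpa [f, mul_comm] using hW.integral_phiC_psiC hj m' m
    · simpa [f] using hW.integral_psiC_psiC hj m m'
  choose a ha using hf
  have hj1 : W.J₀ ≤ j + 1 := by omega
  have hint : ∀ x y, ∫ u, f x u * f y u ∂unitMeasure = ∑ m, a x m * a y m := by
    intro x y
    simp_rw [ha x, Finset.sum_mul]
    rw [integral_finsetSum]
    · refine Finset.sum_congr rfl fun m _ => ?_
      have h1 : ∀ u, a x m * W.phiC (j + 1) m u * f y u =
          ∑ m', a x m * a y m' * (W.phiC (j + 1) m u * W.phiC (j + 1) m' u) := by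
        intro u
        rw [ha y, Finset.mul_sum]
        refine Finset.sum_congr rfl fun m' _ => by ring
      simp_rw [h1]
      rw [integral_finsetSum]
      · simp_rw [integral_const_mul, hW.integral_phiC_phiC hj1]
        simp
      · exact fun m' _ => ((hW.continuous_phiC m.2).mul
          (hW.continuous_phiC m'.2)).integrable_unit.const_mul _
    · intro m _
      exact ((continuous_const.mul (hW.continuous_phiC m.2)).mul
        (hW.continuous_inV ⟨a y, ha y⟩)).integrable_unit
  -- The coefficient matrix is square because `2 ^ j + 2 ^ j = 2 ^ (j + 1)`.
  let A : Matrix (Fin (2 ^ j) ⊕ Fin (2 ^ j)) (Fin (2 ^ (j + 1))) ℝ := Matrix.of a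
  have hA : A * A.transpose = 1 := by
    ext x y
    rw [Matrix.mul_apply, Matrix.one_apply, ← horth x y, hint]
    rfl
  have hA' : A.transpose * A = 1 :=
    (Matrix.mul_eq_one_comm_of_card_eq _ _ _ (by
      simp only [Fintype.card_sum, Fintype.card_fin]; ring)).1 hA
  have hsum : W.kphi j s t + W.kpsi j s t = ∑ x, f x s * f x t := by
    simp [kphi, kpsi, f, Fintype.sum_sum_type]
  rw [hsum]
  have h2 : ∀ m m', ∑ x, a x m * a x m' = if m = m' then 1 else 0 := by
    intro m m'
    have := congrFun (congrFun hA' m) m'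
    rw [Matrix.mul_apply, Matrix.one_apply] at this
    exact this
  have h3 : ∀ x, f x s * f x t = ∑ m, ∑ m', (a x m * a x m') *
      (W.phiC (j + 1) m s * W.phiC (j + 1) m' t) := by
    intro x
    rw [ha x s, ha x t, Finset.sum_mul_sum]
    refine Finset.sum_congr rfl fun m _ => Finset.sum_congr rfl fun m' _ => by ring
  simp_rw [h3]
  rw [Finset.sum_comm]
  simp_rw [Finset.sum_comm (s := (Finset.univ : Finset (Fin (2 ^ j) ⊕ Fin (2 ^ j)))),
    ← Finset.sum_mul, h2]
  simp [kphi]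

/-- The kernel of `V_j` vanishes off a strip of width proportional to `2 ^ (-j)` around the
diagonal. -/
lemma IsCDV.kphi_local (hW : W.IsCDV S) {j : ℕ} {s t : ℝ} (h : W.kphi j s t ≠ 0) :
    |unitClamp s - unitClamp t| ≤ 2 * W.N / 2 ^ j := by
  obtain ⟨m, -, hm⟩ := Finset.exists_ne_zero_of_sum_ne_zero h
  exact hW.edgeGen_phi.local m.2 (left_ne_zero_of_mul hm) (right_ne_zero_of_mul hm)

/-- Boundedly many scaling functions, each of size `2 ^ (j / 2)`, contribute at each point. -/
lemma IsCDV.exists_kphi_le (hW : W.IsCDV S) :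
    ∃ C, 0 ≤ C ∧ ∀ j s t, |W.kphi j s t| ≤ C * 2 ^ j := by
  obtain ⟨C, hC0, hC⟩ := hW.edgeGen_phi.exists_bound
  refine ⟨(4 * W.N + 1) * (C * C), by positivity, fun j s t => ?_⟩
  have h2 : (2 : ℝ) ^ ((j : ℝ) / 2) * 2 ^ ((j : ℝ) / 2) = 2 ^ j := by
    rw [← Real.rpow_add two_pos, add_halves, Real.rpow_natCast]
  have := hW.edgeGen_phi.abs_sum_le (t := s) (B := C * C * 2 ^ j)
    (fun m : Fin (2 ^ j) => W.phiC j m s * W.phiC j m t) (fun m hm => by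
      have : W.phiC j m s = 0 := hm
      simp [this]) fun m => by
      rw [abs_mul]
      refine (mul_le_mul (hC j m m.2 s) (hC j m m.2 t) (abs_nonneg _) (by positivity)).trans_eq ?_
      rw [← h2]; ring
  unfold kphi
  linarith

/-- The projections onto the spaces `V_j` are uniformly bounded on bounded functions. -/
lemma IsCDV.exists_integral_abs_kphi_le (hW : W.IsCDV S) :
    ∃ C, 0 ≤ C ∧ ∀ j s, ∫ t, |W.kphi j s t| ∂unitMeasure ≤ C := by
  obtain ⟨C, hC0, hC⟩ := hW.exists_kphi_le
  refine ⟨C * (4 * W.N), by positivity, fun j s => ?_⟩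
  set r : ℝ := 2 * W.N / 2 ^ j
  have hr : 0 ≤ r := by positivity
  set x := unitClamp s
  have hI : Integrable (fun t => (Icc (x - r) (x + r)).indicator (fun _ => C * 2 ^ j) t)
      (volume : Measure ℝ) := by
    rw [integrable_indicator_iff measurableSet_Icc]
    exact integrableOn_const (by simp)
  calc ∫ t, |W.kphi j s t| ∂unitMeasure
      ≤ ∫ t, (Icc (x - r) (x + r)).indicator (fun _ => C * 2 ^ j) t ∂unitMeasure := by
        refine integral_mono_ae ?_ hI.restrict ?_
        · exact (((hW.continuous_kphi j).comp
            (Continuous.prodMk_right s)).abs).integrable_unit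
        · filter_upwards [ae_mem_unit] with t ht
          by_cases h0 : W.kphi j s t = 0
          · rw [h0, abs_zero]
            exact indicator_nonneg (fun _ _ => by positivity) _
          · have := hW.kphi_local h0
            rw [unitClamp_of_mem ht, abs_le] at this
            rw [indicator_of_mem (by constructor <;> linarith)]
            exact hC j s t
    _ ≤ ∫ t, (Icc (x - r) (x + r)).indicator (fun _ => C * 2 ^ j) t := by
        refine setIntegral_le_integral hI (ae_of_all _ fun t => ?_)
        exact indicator_nonneg (fun _ _ => by positivity) _
    _ = C * (4 * W.N) := by
        rw [integral_indicator measurableSet_Icc, setIntegral_const, Real.volume_real_Icc_of_le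
          (by linarith)]
        simp only [r, smul_eq_mul]
        field_simp
        ring

/-- The sum of the wavelets of a level. -/
def psiSum (W : CDVData) (l : ℕ) (t : ℝ) : ℝ := ∑ m : Fin (2 ^ l), W.psiC l m t

lemma IsCDV.continuous_psiSum (hW : W.IsCDV S) (l : ℕ) : Continuous (W.psiSum l) :=
  continuous_finsetSum _ fun m _ => hW.continuous_psiC m.2

lemma IsCDV.exists_psiSum_le (hW : W.IsCDV S) :
    ∃ C, 0 ≤ C ∧ ∀ l t, |W.psiSum l t| ≤ C * 2 ^ ((l : ℝ) / 2) := by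
  obtain ⟨C, hC0, hC⟩ := hW.edgeGen_psi.exists_bound
  refine ⟨(4 * W.N + 1) * C, by positivity, fun l t => ?_⟩
  rw [mul_assoc]
  exact hW.edgeGen_psi.abs_sum_le _ (fun _ h => h) fun m => hC l m m.2 t

lemma IsCDV.integral_inV_psiSum (hW : W.IsCDV S) {l : ℕ} (hl : W.J₀ ≤ l) {f : ℝ → ℝ}
    (hf : W.InV l f) : ∫ t, f t * W.psiSum l t ∂unitMeasure = 0 := by
  unfold psiSum
  simp_rw [Finset.mul_sum]
  rw [integral_finsetSum]
  · simp [hW.integral_inV_psiC hl hf]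
  · exact fun m _ => ((hW.continuous_inV hf).mul (hW.continuous_psiC m.2)).integrable_unit

lemma IsCDV.integral_psiSum_psiC (hW : W.IsCDV S) {l l' : ℕ} (hl : W.J₀ ≤ l) (hl' : W.J₀ ≤ l')
    (m' : Fin (2 ^ l')) :
    ∫ t, W.psiSum l t * W.psiC l' m' t ∂unitMeasure = if l = l' then 1 else 0 := by
  unfold psiSum
  simp_rw [Finset.sum_mul]
  rw [integral_finsetSum]
  · split_ifs with h
    · subst h
      simp [hW.integral_psiC_psiC hl]
    · simp [hW.integral_psiC_psiC_of_ne hl hl' h]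
  · exact fun m _ => ((hW.continuous_psiC m.2).mul (hW.continuous_psiC m'.2)).integrable_unit

lemma IsCDV.integral_psiSum_sq (hW : W.IsCDV S) {l : ℕ} (hl : W.J₀ ≤ l) :
    ∫ t, W.psiSum l t * W.psiSum l t ∂unitMeasure = 2 ^ l := by
  conv_lhs => enter [2, t]; rw [show W.psiSum l t * W.psiSum l t =
    ∑ m : Fin (2 ^ l), W.psiSum l t * W.psiC l m t from Finset.mul_sum _ _ _]
  rw [integral_finsetSum]
  · simp [hW.integral_psiSum_psiC hl hl]
  · exact fun m _ => ((hW.continuous_psiSum l).mul (hW.continuous_psiC m.2)).integrable_unit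

end CDVData
end

/-! ### Projection kernels on the unit cube -/

section

variable {d : ℕ}

/-- The nearest point of the unit cube. -/
def cubeClamp (x : Fin d → ℝ) : Fin d → ℝ := fun i => unitClamp (x i)

lemma cubeClamp_mem (x : Fin d → ℝ) : cubeClamp x ∈ Icc (0 : Fin d → ℝ) 1 :=
  ⟨fun i => (unitClamp_mem (x i)).1, fun i => (unitClamp_mem (x i)).2⟩

lemma cubeClamp_of_mem {x : Fin d → ℝ} (hx : x ∈ Icc (0 : Fin d → ℝ) 1) : cubeClamp x = x :=
  funext fun i => unitClamp_of_mem ⟨hx.1 i, hx.2 i⟩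

lemma continuous_cubeClamp : Continuous (cubeClamp (d := d)) :=
  continuous_pi fun i => continuous_unitClamp.comp (continuous_apply i)

/-- Lebesgue measure on the unit cube. -/
def cubeMeasure (d : ℕ) : Measure (Fin d → ℝ) := volume.restrict (Icc 0 1)

lemma cubeMeasure_eq_pi : cubeMeasure d = Measure.pi fun _ => unitMeasure := by
  unfold cubeMeasure unitMeasure
  rw [← Measure.restrict_pi_pi, pi_univ_Icc]
  rfl

instance : IsProbabilityMeasure (cubeMeasure d) := by
  rw [cubeMeasure_eq_pi]; infer_instance

lemma ae_mem_cube : ∀ᵐ x ∂cubeMeasure d, x ∈ Icc (0 : Fin d → ℝ) 1 :=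
  ae_restrict_mem measurableSet_Icc

lemma Continuous.integrable_cube {f : (Fin d → ℝ) → ℝ} (hf : Continuous f) :
    Integrable f (cubeMeasure d) := hf.continuousOn.integrableOn_compact isCompact_Icc

lemma integral_cube_congr {f g : (Fin d → ℝ) → ℝ} (h : ∀ x ∈ Icc (0 : Fin d → ℝ) 1, f x = g x) :
    ∫ x, f x ∂cubeMeasure d = ∫ x, g x ∂cubeMeasure d := by
  refine integral_congr_ae ?_
  filter_upwards [ae_mem_cube] with t ht using h t ht

lemma integral_cube_prod (f : Fin d → ℝ → ℝ) :
    ∫ x, ∏ i, f i (x i) ∂cubeMeasure d = ∏ i, ∫ t, f i t ∂unitMeasure := by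
  rw [cubeMeasure_eq_pi]
  exact integral_fintype_prod_eq_prod _

namespace CDVData

variable {W : CDVData} {S : ℕ}

/-- The projection kernel, evaluated at the nearest points of the cube. -/
def kernelC (W : CDVData) (j : ℕ) (x y : Fin d → ℝ) : ℝ := W.kernel j (cubeClamp x) (cubeClamp y)

lemma kernelC_of_mem (j : ℕ) {x y : Fin d → ℝ} (hx : x ∈ Icc (0 : Fin d → ℝ) 1)
    (hy : y ∈ Icc (0 : Fin d → ℝ) 1) : W.kernelC j x y = W.kernel j x y := by
  rw [kernelC, cubeClamp_of_mem hx, cubeClamp_of_mem hy]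

lemma kernelC_eq_prod (j : ℕ) (x y : Fin d → ℝ) :
    W.kernelC j x y = ∏ i, W.kphi j (x i) (y i) := by
  unfold kernelC kernel kphi Phi
  rw [Finset.prod_univ_sum, Fintype.piFinset_univ]
  refine Finset.sum_congr rfl fun m _ => ?_
  rw [← Finset.prod_mul_distrib]
  rfl

lemma kernelC_comm (j : ℕ) (x y : Fin d → ℝ) : W.kernelC j x y = W.kernelC j y x := by
  simp_rw [kernelC_eq_prod, kphi_comm (W := W) j (x _)]

lemma kernelC_self_nonneg (j : ℕ) (x : Fin d → ℝ) : 0 ≤ W.kernelC j x x := by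
  rw [kernelC_eq_prod]
  exact Finset.prod_nonneg fun i _ => kphi_self_nonneg j _

lemma IsCDV.continuous_kernelC (hW : W.IsCDV S) (j : ℕ) :
    Continuous fun q : (Fin d → ℝ) × (Fin d → ℝ) => W.kernelC j q.1 q.2 := by
  have h : ∀ i : Fin d, Continuous fun q : (Fin d → ℝ) × (Fin d → ℝ) =>
      W.kphi j (q.1 i) (q.2 i) := fun i =>
    (hW.continuous_kphi j).comp (g := fun q : ℝ × ℝ => W.kphi j q.1 q.2)
      (f := fun q : (Fin d → ℝ) × (Fin d → ℝ) => (q.1 i, q.2 i)) (by fun_prop)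
  have h2 : (fun q : (Fin d → ℝ) × (Fin d → ℝ) => W.kernelC j q.1 q.2) =
      fun q => ∏ i, W.kphi j (q.1 i) (q.2 i) := funext fun q => kernelC_eq_prod j q.1 q.2
  rw [h2]
  exact continuous_finsetProd _ fun i _ => h i

lemma IsCDV.continuous_kernelC_right (hW : W.IsCDV S) (j : ℕ) (x : Fin d → ℝ) :
    Continuous (W.kernelC j x) := 
  (hW.continuous_kernelC j).comp (g := fun q : (Fin d → ℝ) × (Fin d → ℝ) => W.kernelC j q.1 q.2)
    (f := fun y => (x, y)) (by fun_prop)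

/-- The kernel of level `j` is bounded by a multiple of the resolution `2 ^ (j * d)`. -/
lemma IsCDV.exists_kernelC_le (hW : W.IsCDV S) (d : ℕ) :
    ∃ C, 0 ≤ C ∧ ∀ j (x y : Fin d → ℝ), |W.kernelC j x y| ≤ C * 2 ^ (j * d) := by
  obtain ⟨C, hC0, hC⟩ := hW.exists_kphi_le
  refine ⟨C ^ d, by positivity, fun j x y => ?_⟩
  rw [kernelC_eq_prod, Finset.abs_prod]
  refine (Finset.prod_le_prod (fun _ _ => abs_nonneg _) fun i _ => hC j (x i) (y i)).trans_eq ?_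
  simp [mul_pow, pow_mul]

lemma IsCDV.exists_integral_abs_kernelC_le (hW : W.IsCDV S) (d : ℕ) :
    ∃ C, 0 ≤ C ∧ ∀ j (x : Fin d → ℝ), ∫ y, |W.kernelC j x y| ∂cubeMeasure d ≤ C := by
  obtain ⟨C, hC0, hC⟩ := hW.exists_integral_abs_kphi_le
  refine ⟨C ^ d, by positivity, fun j x => ?_⟩
  simp_rw [kernelC_eq_prod, Finset.abs_prod]
  rw [integral_cube_prod (fun i t => |W.kphi j (x i) t|)]
  refine (Finset.prod_le_prod (fun _ _ => integral_nonneg fun _ => abs_nonneg _)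
    fun i _ => hC j (x i)).trans_eq ?_
  simp

lemma IsCDV.integral_kernelC_kernelC (hW : W.IsCDV S) {j l : ℕ} (hj : W.J₀ ≤ j) (hl : W.J₀ ≤ l)
    (x z : Fin d → ℝ) :
    ∫ y, W.kernelC j x y * W.kernelC l y z ∂cubeMeasure d = W.kernelC (min j l) x z := by
  simp_rw [kernelC_eq_prod, ← Finset.prod_mul_distrib]
  rw [integral_cube_prod (fun i t => W.kphi j (x i) t * W.kphi l t (z i))]
  simp_rw [hW.integral_kphi_kphi hj hl]

lemma IsCDV.integral_kernelC (hW : W.IsCDV S) (hS : 0 < S) {j : ℕ} (hj : W.J₀ ≤ j)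
    (x : Fin d → ℝ) : ∫ y, W.kernelC j x y ∂cubeMeasure d = 1 := by
  simp_rw [kernelC_eq_prod]
  rw [integral_cube_prod (fun i t => W.kphi j (x i) t)]
  simp [hW.integral_kphi hS hj]

lemma IsCDV.integral_kernelC_self (hW : W.IsCDV S) {j : ℕ} (hj : W.J₀ ≤ j) :
    ∫ x, W.kernelC j x x ∂cubeMeasure d = 2 ^ (j * d) := by
  simp_rw [kernelC_eq_prod]
  rw [integral_cube_prod (fun i t => W.kphi j t t)]
  simp [hW.integral_kphi_self hj, pow_mul]

lemma IsCDV.kernelC_local (hW : W.IsCDV S) {j : ℕ} {x y : Fin d → ℝ} (h : W.kernelC j x y ≠ 0) :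
    dist (cubeClamp x) (cubeClamp y) ≤ 2 * W.N / 2 ^ j := by
  rw [kernelC_eq_prod, Finset.prod_ne_zero_iff] at h
  exact (dist_pi_le_iff (by positivity)).2 fun i => hW.kphi_local (h i (Finset.mem_univ i))

/-- The kernels of consecutive levels differ by the kernel of the tensor product wavelets. -/
lemma IsCDV.kernelC_succ (hW : W.IsCDV S) {j : ℕ} (hj : W.J₀ ≤ j) (x y : Fin d → ℝ) :
    W.kernelC (j + 1) x y = W.kernelC j x y +
      ∑ ι ∈ Finset.univ.filter (fun ι : Fin d → Bool => ∃ i, ι i = true),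
        ∑ m : Fin d → Fin (2 ^ j),
          W.Psi ι j m (cubeClamp x) * W.Psi ι j m (cubeClamp y) := by
  have h1 : W.kernelC (j + 1) x y = ∑ ι : Fin d → Bool, ∑ m : Fin d → Fin (2 ^ j),
      W.Psi ι j m (cubeClamp x) * W.Psi ι j m (cubeClamp y) := by
    rw [kernelC_eq_prod]
    have : ∀ i, W.kphi (j + 1) (x i) (y i) = ∑ b : Bool,
        if b then W.kpsi j (x i) (y i) else W.kphi j (x i) (y i) := by
      intro i
      rw [hW.kphi_succ hj]
      simp [add_comm]
    simp_rw [this]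
    rw [Finset.prod_univ_sum, Fintype.piFinset_univ]
    refine Finset.sum_congr rfl fun ι _ => ?_
    have h2 : ∀ i, (if ι i then W.kpsi j (x i) (y i) else W.kphi j (x i) (y i)) =
        ∑ m : Fin (2 ^ j), (if ι i then W.psiC j m (x i) else W.phiC j m (x i)) *
          (if ι i then W.psiC j m (y i) else W.phiC j m (y i)) := by
      intro i
      split_ifs <;> rfl
    simp_rw [h2]
    rw [Finset.prod_univ_sum, Fintype.piFinset_univ]
    refine Finset.sum_congr rfl fun m _ => ?_
    rw [Finset.prod_mul_distrib]
    rfl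
  rw [h1, ← Finset.sum_filter_add_sum_filter_not Finset.univ
    (fun ι : Fin d → Bool => ∃ i, ι i = true), add_comm]
  congr 1
  have h3 : (Finset.univ.filter fun ι : Fin d → Bool => ¬ ∃ i, ι i = true) = {fun _ => false} := by
    ext ι
    simp [funext_iff]
  rw [h3, Finset.sum_singleton]
  simp [kernelC, kernel, Psi, Phi]

/-- The projection onto level `j`. -/
def proj (W : CDVData) (j : ℕ) (f : (Fin d → ℝ) → ℝ) (x : Fin d → ℝ) : ℝ :=
  ∫ y, W.kernelC j x y * f y ∂cubeMeasure d

lemma IsCDV.continuous_proj (hW : W.IsCDV S) (j : ℕ) {f : (Fin d → ℝ) → ℝ} (hf : Continuous f) :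
    Continuous (W.proj j f) := by
  unfold proj cubeMeasure
  exact continuous_parametric_integral_of_continuous
    ((hW.continuous_kernelC j).mul (hf.comp continuous_snd)) isCompact_Icc

/-- The projections of a continuous function converge to it uniformly: their kernels are bounded in
`L¹`, integrate to one and concentrate near the diagonal. -/
lemma IsCDV.eventually_proj_sub_le (hW : W.IsCDV S) (hS : 0 < S) {f : (Fin d → ℝ) → ℝ}
    (hf : UniformContinuousOn f (Icc 0 1)) {ε : ℝ} (hε : 0 < ε) :
    ∀ᶠ j in atTop, ∀ x, |W.proj j (f ∘ cubeClamp) x - f (cubeClamp x)| ≤ ε := by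
  obtain ⟨C, hC0, hC⟩ := hW.exists_integral_abs_kernelC_le d
  have hfc : Continuous fun y => f (cubeClamp y) :=
    hf.continuousOn.comp_continuous continuous_cubeClamp cubeClamp_mem
  rw [Metric.uniformContinuousOn_iff] at hf
  obtain ⟨δ, hδ, hfδ⟩ := hf (ε / (C + 1)) (by positivity)
  have hlim : Tendsto (fun j : ℕ => 2 * (W.N : ℝ) / 2 ^ j) atTop (nhds 0) :=
    tendsto_const_nhds.div_atTop (tendsto_pow_atTop_atTop_of_one_lt one_lt_two)
  filter_upwards [hlim.eventually (gt_mem_nhds hδ), eventually_ge_atTop W.J₀] with j hj hjJ x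
  have hK := hW.continuous_kernelC_right j x
  have h1 : W.proj j (f ∘ cubeClamp) x - f (cubeClamp x) =
      ∫ y, W.kernelC j x y * (f (cubeClamp y) - f (cubeClamp x)) ∂cubeMeasure d := by
    have e : ∀ y, W.kernelC j x y * (f (cubeClamp y) - f (cubeClamp x)) =
        W.kernelC j x y * f (cubeClamp y) - W.kernelC j x y * f (cubeClamp x) := fun y => by ring
    simp_rw [e]
    rw [integral_sub (f := fun y => W.kernelC j x y * f (cubeClamp y))
      (g := fun y => W.kernelC j x y * f (cubeClamp x)) (hK.mul hfc).integrable_cube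
      (hK.mul continuous_const).integrable_cube,
      integral_mul_const, hW.integral_kernelC hS hjJ, one_mul]
    rfl
  rw [h1]
  calc |∫ y, W.kernelC j x y * (f (cubeClamp y) - f (cubeClamp x)) ∂cubeMeasure d|
      ≤ ∫ y, |W.kernelC j x y * (f (cubeClamp y) - f (cubeClamp x))| ∂cubeMeasure d :=
        abs_integral_le_integral_abs
    _ ≤ ∫ y, |W.kernelC j x y| * (ε / (C + 1)) ∂cubeMeasure d := by
        refine integral_mono ((hK.mul (hfc.sub continuous_const)).abs).integrable_cube
          (hK.abs.mul continuous_const).integrable_cube fun y => ?_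
        rw [abs_mul]
        by_cases h0 : W.kernelC j x y = 0
        · simp [h0]
        · refine mul_le_mul_of_nonneg_left ?_ (abs_nonneg _)
          refine (hfδ _ (cubeClamp_mem y) _ (cubeClamp_mem x) ?_).le
          rw [dist_comm]
          exact (hW.kernelC_local h0).trans_lt hj
    _ ≤ C * (ε / (C + 1)) := by
        rw [integral_mul_const]
        exact mul_le_mul_of_nonneg_right (hC j x) (by positivity)
    _ ≤ ε := by
        rw [mul_div_assoc', div_le_iff₀ (by positivity)]
        nlinarith

end CDVData
end

/-! ### Approximation error and perturbations in Hölder balls -/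

section

variable {d : ℕ}

namespace CDVData

variable {W : CDVData} {S : ℕ}

lemma HolderBall.continuous_comp {α M : ℝ} {h : (Fin d → ℝ) → ℝ} (hh : W.HolderBall α M h) :
    Continuous fun x => h (cubeClamp x) :=
  hh.1.continuousOn.comp_continuous continuous_cubeClamp cubeClamp_mem

lemma Psi_clamp (ι : Fin d → Bool) (l : ℕ) (m : Fin d → Fin (2 ^ l)) (x : Fin d → ℝ) :
    W.Psi ι l m (cubeClamp x) = ∏ i, if ι i then W.psiC l (m i) (x i) else W.phiC l (m i) (x i) :=
  rfl

lemma Phi_clamp (l : ℕ) (m : Fin d → Fin (2 ^ l)) (x : Fin d → ℝ) :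
    W.Phi l m (cubeClamp x) = ∏ i, W.phiC l (m i) (x i) := rfl

lemma IsCDV.continuous_Psi_clamp (hW : W.IsCDV S) (ι : Fin d → Bool) (l : ℕ)
    (m : Fin d → Fin (2 ^ l)) : Continuous fun x => W.Psi ι l m (cubeClamp x) := by
  simp_rw [Psi_clamp]
  refine continuous_finsetProd _ fun i _ => ?_
  split_ifs
  · exact (hW.continuous_psiC (m i).2).comp (continuous_apply i)
  · exact (hW.continuous_phiC (m i).2).comp (continuous_apply i)

lemma IsCDV.continuous_Phi_clamp (hW : W.IsCDV S) (l : ℕ)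
    (m : Fin d → Fin (2 ^ l)) : Continuous fun x => W.Phi l m (cubeClamp x) := by
  simp_rw [Phi_clamp]
  exact continuous_finsetProd _ fun i _ =>
    (hW.continuous_phiC (m i).2).comp (continuous_apply i)

lemma integral_cube_clamp (f : (Fin d → ℝ) → ℝ) :
    ∫ x in Icc (0 : Fin d → ℝ) 1, f x = ∫ x, f (cubeClamp x) ∂cubeMeasure d :=
  integral_cube_congr fun x hx => by rw [cubeClamp_of_mem hx]

lemma HolderBall.abs_integral_Psi_le {α M : ℝ} {h : (Fin d → ℝ) → ℝ} (hh : W.HolderBall α M h)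
    {l : ℕ} (hl : W.J₀ ≤ l) (m : Fin d → Fin (2 ^ l)) {ι : Fin d → Bool} (hι : ∃ i, ι i = true) :
    |∫ x, h (cubeClamp x) * W.Psi ι l m (cubeClamp x) ∂cubeMeasure d| ≤
      M * 2 ^ (-((l : ℝ) * (α + d / 2))) := by
  have := hh.2 (fun _ => ⟨0, by positivity⟩) l m ι hl hι
  rw [integral_cube_clamp, integral_cube_clamp] at this
  rw [Real.rpow_neg two_pos.le, ← div_eq_mul_inv, le_div_iff₀ (by positivity), mul_comm]
  refine le_trans ?_ this
  exact le_add_of_nonneg_left (by positivity)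

/-- The approximation error: the error `∫ p Π_j b - ∫ p b` of the projection `Π_j` telescopes over
the levels above `j` into sums of products of wavelet coefficients of `p` and `b`, which the two
Hölder conditions bound. -/
lemma IsCDV.exists_bias_le (hW : W.IsCDV S) (hS : 0 < S) (d : ℕ) {α β : ℝ} (hαβ : 0 < α + β)
    {M : ℝ} (hM : 0 ≤ M) : ∃ C, 0 ≤ C ∧ ∀ p b : (Fin d → ℝ) → ℝ, W.HolderBall α M p →
      W.HolderBall β M b → ∀ j, W.J₀ ≤ j →
        |(∫ x, p (cubeClamp x) * W.proj j (fun y => b (cubeClamp y)) x ∂cubeMeasure d) -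
          ∫ x, p (cubeClamp x) * b (cubeClamp x) ∂cubeMeasure d| ≤
            C * 2 ^ (-((α + β) * j)) := by
  set s := α + β with hs
  set r : ℝ := 2 ^ (-s) with hr
  have hr0 : 0 < r := by positivity
  have hr1 : r < 1 := Real.rpow_lt_one_of_one_lt_of_neg one_lt_two (by linarith)
  refine ⟨2 ^ d * M ^ 2 / (1 - r), div_nonneg (by positivity) (by linarith),
    fun p b hp hb j hj => ?_⟩
  set p' : (Fin d → ℝ) → ℝ := fun x => p (cubeClamp x) with hp'
  set b' : (Fin d → ℝ) → ℝ := fun x => b (cubeClamp x) with hb'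
  have hpc : Continuous p' := hp.continuous_comp
  have hbc : Continuous b' := hb.continuous_comp
  let u : ℕ → ℝ := fun l => ∫ x, p' x * W.proj l b' x ∂cubeMeasure d
  have hlim : Tendsto u atTop (nhds (∫ x, p' x * b' x ∂cubeMeasure d)) := by
    obtain ⟨B, hB⟩ := isCompact_Icc.exists_bound_of_continuousOn hp.1.continuousOn
    have hB' : ∀ x, |p' x| ≤ |B| := fun x =>
      (hB _ (cubeClamp_mem x)).trans (le_abs_self B)
    rw [Metric.tendsto_nhds]
    intro ε hε
    filter_upwards [hW.eventually_proj_sub_le hS hb.1 (ε := ε / (|B| + 1)) (by positivity)]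
      with l hl
    have e : u l - ∫ x, p' x * b' x ∂cubeMeasure d =
        ∫ x, p' x * (W.proj l b' x - b' x) ∂cubeMeasure d := by
      simp_rw [mul_sub]
      rw [integral_sub]
      · exact (hpc.mul (hW.continuous_proj l hbc)).integrable_cube
      · exact (hpc.mul hbc).integrable_cube
    rw [Real.dist_eq, e]
    calc |∫ x, p' x * (W.proj l b' x - b' x) ∂cubeMeasure d|
        ≤ ∫ x, |p' x * (W.proj l b' x - b' x)| ∂cubeMeasure d := abs_integral_le_integral_abs
      _ ≤ ∫ x, |B| * (ε / (|B| + 1)) ∂cubeMeasure d := by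
          refine integral_mono
            ((hpc.mul ((hW.continuous_proj l hbc).sub hbc)).abs).integrable_cube
            (integrable_const _) fun x => ?_
          rw [abs_mul]
          exact mul_le_mul (hB' x) (hl x) (abs_nonneg _) (abs_nonneg _)
      _ < ε := by
          simp only [integral_const, probReal_univ, one_smul]
          rw [mul_div_assoc', div_lt_iff₀ (by positivity)]
          nlinarith [abs_nonneg B]
  -- Level `l` has `2 ^ (l * d)` wavelets of each of the at most `2 ^ d` types, and the product of
  -- two coefficients is at most `M ^ 2 * 2 ^ (-l * (α + β + d))`.
  have hstep : ∀ l, W.J₀ ≤ l → |u (l + 1) - u l| ≤ 2 ^ d * M ^ 2 * 2 ^ (-(s * l)) := by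
    intro l hl
    have hproj : ∀ x, W.proj (l + 1) b' x = W.proj l b' x +
        ∑ ι ∈ Finset.univ.filter (fun ι : Fin d → Bool => ∃ i, ι i = true),
          ∑ m : Fin d → Fin (2 ^ l), W.Psi ι l m (cubeClamp x) *
            ∫ y, b' y * W.Psi ι l m (cubeClamp y) ∂cubeMeasure d := by
      intro x
      unfold proj
      simp_rw [hW.kernelC_succ hl, add_mul, Finset.sum_mul]
      rw [integral_add, integral_finsetSum]
      · congr 1
        refine Finset.sum_congr rfl fun ι _ => ?_
        rw [integral_finsetSum]
        · refine Finset.sum_congr rfl fun m _ => ?_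
          rw [← integral_const_mul]
          congr 1; ext y; ring
        · exact fun m _ => ((continuous_const.mul
            (hW.continuous_Psi_clamp ι l m)).mul hbc).integrable_cube
      · exact fun ι _ => (continuous_finsetSum _ fun m _ => (continuous_const.mul
            (hW.continuous_Psi_clamp ι l m)).mul hbc).integrable_cube
      · exact ((hW.continuous_kernelC_right l x).mul hbc).integrable_cube
      · exact (continuous_finsetSum _ fun ι _ => continuous_finsetSum _ fun m _ =>
          (continuous_const.mul (hW.continuous_Psi_clamp ι l m)).mul hbc).integrable_cube
    have hdiff : u (l + 1) - u l =
        ∑ ι ∈ Finset.univ.filter (fun ι : Fin d → Bool => ∃ i, ι i = true),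
          ∑ m : Fin d → Fin (2 ^ l), (∫ x, p' x * W.Psi ι l m (cubeClamp x) ∂cubeMeasure d) *
            ∫ y, b' y * W.Psi ι l m (cubeClamp y) ∂cubeMeasure d := by
      simp only [u]
      rw [← integral_sub]
      rotate_left
      · exact (hpc.mul (hW.continuous_proj _ hbc)).integrable_cube
      · exact (hpc.mul (hW.continuous_proj _ hbc)).integrable_cube
      simp_rw [hproj, mul_add, add_sub_cancel_left, Finset.mul_sum]
      rw [integral_finsetSum]
      · refine Finset.sum_congr rfl fun ι _ => ?_
        rw [integral_finsetSum]
        · refine Finset.sum_congr rfl fun m _ => ?_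
          rw [← integral_mul_const]
          congr 1; ext y; ring
        · exact fun m _ => (hpc.mul ((hW.continuous_Psi_clamp ι l m).mul
            continuous_const)).integrable_cube
      · exact fun ι _ => (continuous_finsetSum _ fun m _ => hpc.mul
          ((hW.continuous_Psi_clamp ι l m).mul continuous_const)).integrable_cube
    rw [hdiff]
    calc _ ≤ ∑ ι ∈ Finset.univ.filter (fun ι : Fin d → Bool => ∃ i, ι i = true),
          ∑ m : Fin d → Fin (2 ^ l), M * 2 ^ (-((l : ℝ) * (α + d / 2))) *
            (M * 2 ^ (-((l : ℝ) * (β + d / 2)))) := by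
          refine (Finset.abs_sum_le_sum_abs _ _).trans (Finset.sum_le_sum fun ι hι => ?_)
          refine (Finset.abs_sum_le_sum_abs _ _).trans (Finset.sum_le_sum fun m _ => ?_)
          rw [abs_mul]
          have hι' := (Finset.mem_filter.1 hι).2
          exact mul_le_mul (hp.abs_integral_Psi_le hl m hι') (hb.abs_integral_Psi_le hl m hι')
            (abs_nonneg _) (by positivity)
      _ ≤ ∑ ι : Fin d → Bool,
          ∑ m : Fin d → Fin (2 ^ l), M * 2 ^ (-((l : ℝ) * (α + d / 2))) *
            (M * 2 ^ (-((l : ℝ) * (β + d / 2)))) :=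
          Finset.sum_le_sum_of_subset_of_nonneg (Finset.filter_subset _ _)
            fun _ _ _ => by positivity
      _ = _ := by
          simp only [Finset.sum_const, Finset.card_univ, Fintype.card_fun, Fintype.card_fin,
            Fintype.card_bool, nsmul_eq_mul]
          have e1 : ((2 ^ l) ^ d : ℝ) = 2 ^ ((l : ℝ) * d) := by
            rw [← pow_mul, ← Real.rpow_natCast]; push_cast; rfl
          push_cast
          rw [e1]
          have e2 : (2 : ℝ) ^ ((l : ℝ) * d) * 2 ^ (-((l : ℝ) * (α + d / 2))) *
              2 ^ (-((l : ℝ) * (β + d / 2))) = 2 ^ (-(s * l)) := by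
            rw [← Real.rpow_add two_pos, ← Real.rpow_add two_pos]
            congr 1; rw [hs]; ring
          rw [← e2]; ring
  have hgeo := dist_le_of_le_geometric_of_tendsto₀ r (2 ^ d * M ^ 2 * 2 ^ (-(s * j))) hr1
    (f := fun n => u (j + n)) (a := ∫ x, p' x * b' x ∂cubeMeasure d) (fun n => by
      rw [dist_comm, Real.dist_eq]
      refine (hstep (j + n) (by omega)).trans_eq ?_
      rw [mul_assoc, mul_assoc, mul_assoc]
      congr 2
      rw [hr, ← Real.rpow_natCast, ← Real.rpow_mul two_pos.le, ← Real.rpow_add two_pos]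
      congr 1; push_cast; ring) (by
      have := (tendsto_add_atTop_iff_nat j).2 hlim
      simpa only [add_comm j] using this)
  rw [Real.dist_eq] at hgeo
  refine hgeo.trans_eq ?_
  ring

/-- The product over the coordinates of the sums of all wavelets of a level. Up to scaling, this is
the perturbation of the regression functions that yields the lower bounds. -/
def bump (W : CDVData) (l : ℕ) (x : Fin d → ℝ) : ℝ := ∏ i, W.psiSum l (x i)

lemma IsCDV.continuous_bump (hW : W.IsCDV S) (l : ℕ) : Continuous (W.bump (d := d) l) :=
  continuous_finsetProd _ fun i _ => (hW.continuous_psiSum l).comp (continuous_apply i)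

lemma IsCDV.exists_bump_le (hW : W.IsCDV S) (d : ℕ) :
    ∃ C, 0 ≤ C ∧ ∀ l (x : Fin d → ℝ), |W.bump l x| ≤ C * 2 ^ ((l : ℝ) * (d / 2)) := by
  obtain ⟨C, hC0, hC⟩ := hW.exists_psiSum_le
  refine ⟨C ^ d, by positivity, fun l x => ?_⟩
  unfold bump
  rw [Finset.abs_prod]
  refine (Finset.prod_le_prod (fun _ _ => abs_nonneg _) fun i _ => hC l (x i)).trans_eq ?_
  rw [Finset.prod_const, Finset.card_univ, Fintype.card_fin, mul_pow, ← Real.rpow_natCast (2 ^ _),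
    ← Real.rpow_mul two_pos.le]
  congr 2; ring

lemma IsCDV.integral_bump_sq (hW : W.IsCDV S) {l : ℕ} (hl : W.J₀ ≤ l) :
    ∫ x, W.bump l x * W.bump l x ∂cubeMeasure d = 2 ^ (l * d) := by
  unfold bump
  simp_rw [← Finset.prod_mul_distrib]
  rw [integral_cube_prod (fun _ t => W.psiSum l t * W.psiSum l t)]
  simp [hW.integral_psiSum_sq hl, pow_mul]

lemma IsCDV.integral_bump (hW : W.IsCDV S) (hS : 0 < S) (hd : 0 < d) {l : ℕ} (hl : W.J₀ ≤ l) :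
    ∫ x, W.bump l x ∂cubeMeasure d = 0 := by
  unfold bump
  rw [integral_cube_prod (fun _ t => W.psiSum l t)]
  have := hW.integral_inV_psiSum hl (hW.inV_one hS hl)
  simp only [one_mul] at this
  simp [this, hd.ne']

/-- The bump of a level is invisible to the projections up to this level, because the wavelets of
the level are orthogonal to all coarser functions in every coordinate. -/
lemma IsCDV.proj_bump (hW : W.IsCDV S) (hd : 0 < d) {j l : ℕ} (hj : W.J₀ ≤ j) (hjl : j ≤ l)
    (x : Fin d → ℝ) : W.proj j (W.bump l) x = 0 := by
  unfold proj bump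
  simp_rw [kernelC_eq_prod, ← Finset.prod_mul_distrib]
  rw [integral_cube_prod (fun i t => W.kphi j (x i) t * W.psiSum l t)]
  exact Finset.prod_eq_zero (Finset.mem_univ ⟨0, hd⟩)
    (hW.integral_inV_psiSum (hj.trans hjl) (hW.inV_mono hj hjl (inV_kphi j _)))

lemma IsCDV.integral_bump_Phi (hW : W.IsCDV S) (hd : 0 < d) {l : ℕ} (hl : W.J₀ ≤ l)
    (m : Fin d → Fin (2 ^ W.J₀)) :
    ∫ x, W.bump l x * W.Phi W.J₀ m (cubeClamp x) ∂cubeMeasure d = 0 := by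
  simp_rw [Phi_clamp, bump, ← Finset.prod_mul_distrib]
  rw [integral_cube_prod (fun i t => W.psiSum l t * W.phiC W.J₀ (m i) t)]
  refine Finset.prod_eq_zero (Finset.mem_univ ⟨0, hd⟩) ?_
  simp_rw [mul_comm (W.psiSum l _)]
  exact hW.integral_inV_psiSum hl (hW.inV_mono le_rfl hl (inV_phiC _ _))

/-- The wavelet coefficients of the bump are at most one and vanish on all other levels. -/
lemma IsCDV.abs_integral_bump_Psi_le (hW : W.IsCDV S) {l l' : ℕ} (hl : W.J₀ ≤ l)
    (hl' : W.J₀ ≤ l') (m : Fin d → Fin (2 ^ l')) {ι : Fin d → Bool} (hι : ∃ i, ι i = true) :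
    |∫ x, W.bump l x * W.Psi ι l' m (cubeClamp x) ∂cubeMeasure d| ≤ if l = l' then 1 else 0 := by
  simp_rw [Psi_clamp, bump, ← Finset.prod_mul_distrib]
  rw [integral_cube_prod (fun i t => W.psiSum l t *
    if ι i then W.psiC l' (m i) t else W.phiC l' (m i) t), Finset.abs_prod]
  split_ifs with h
  · subst h
    refine Finset.prod_le_one (fun _ _ => abs_nonneg _) fun i _ => ?_
    split_ifs with hi
    · rw [hW.integral_psiSum_psiC hl hl]; simp
    · have := hW.integral_inV_psiSum hl (inV_phiC l (m i))
      simp_rw [mul_comm (W.psiSum l _), this]; simp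
  · obtain ⟨i, hi⟩ := hι
    refine (Finset.prod_eq_zero (Finset.mem_univ i) ?_).le
    simp only [hi, if_true]
    rw [hW.integral_psiSum_psiC hl hl', if_neg h, abs_zero]

lemma IsCDV.integral_Psi (hW : W.IsCDV S) (hS : 0 < S) {l : ℕ} (hl : W.J₀ ≤ l)
    (m : Fin d → Fin (2 ^ l)) {ι : Fin d → Bool} (hι : ∃ i, ι i = true) :
    ∫ x, W.Psi ι l m (cubeClamp x) ∂cubeMeasure d = 0 := by
  simp_rw [Psi_clamp]
  rw [integral_cube_prod (fun i t => if ι i then W.psiC l (m i) t else W.phiC l (m i) t)]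
  obtain ⟨i, hi⟩ := hι
  refine Finset.prod_eq_zero (Finset.mem_univ i) ?_
  simp only [hi, if_true]
  simpa using hW.integral_inV_psiC hl (hW.inV_one hS hl) (m i)

/-- Adding a sufficiently scaled bump to a constant function keeps it in a slightly larger
Hölder ball. -/
lemma IsCDV.holderBall_add_bump (hW : W.IsCDV S) (hd : 0 < d) {l : ℕ} (hl : W.J₀ ≤ l)
    {α M' M ε a c : ℝ} (hc : W.HolderBall α M' (fun _ : Fin d → ℝ => c)) (hM : M' + ε ≤ M)
    (ha : |a| ≤ ε * 2 ^ (-((l : ℝ) * (α + d / 2)))) :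
    W.HolderBall α M (fun x : Fin d → ℝ => c + a * W.bump l x) := by
  have hcont : Continuous fun x : Fin d → ℝ => c + a * W.bump l x :=
    continuous_const.add (continuous_const.mul (hW.continuous_bump l))
  have hε : 0 ≤ ε :=
    nonneg_of_mul_nonneg_left ((abs_nonneg _).trans ha) (by positivity)
  refine ⟨isCompact_Icc.uniformContinuousOn_of_continuous hcont.continuousOn,
    fun m₀ l' m ι hl' hι => ?_⟩
  refine le_trans ?_ hM
  refine le_trans ?_ (add_le_add_left (hc.2 m₀ l' m ι hl' hι) ε)
  have h1 : ∫ x in Icc (0 : Fin d → ℝ) 1, (c + a * W.bump l x) * W.Phi W.J₀ m₀ x =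
      ∫ x in Icc (0 : Fin d → ℝ) 1, c * W.Phi W.J₀ m₀ x := by
    have e : ∫ x in Icc (0 : Fin d → ℝ) 1, (c + a * W.bump l x) * W.Phi W.J₀ m₀ x =
        ∫ x, (c * W.Phi W.J₀ m₀ (cubeClamp x) +
          a * (W.bump l x * W.Phi W.J₀ m₀ (cubeClamp x))) ∂cubeMeasure d :=
      integral_cube_congr fun x hx => by rw [cubeClamp_of_mem hx]; ring
    rw [e, integral_cube_clamp, integral_add, integral_const_mul a, hW.integral_bump_Phi hd hl]
    · simp
    · exact (continuous_const.mul (hW.continuous_Phi_clamp _ _)).integrable_cube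
    · exact (continuous_const.mul ((hW.continuous_bump l).mul
        (hW.continuous_Phi_clamp _ _))).integrable_cube
  have h2 : ∫ x in Icc (0 : Fin d → ℝ) 1, (c + a * W.bump l x) * W.Psi ι l' m x =
      (∫ x in Icc (0 : Fin d → ℝ) 1, c * W.Psi ι l' m x) +
        a * ∫ x, W.bump l x * W.Psi ι l' m (cubeClamp x) ∂cubeMeasure d := by
    have e : ∫ x in Icc (0 : Fin d → ℝ) 1, (c + a * W.bump l x) * W.Psi ι l' m x =
        ∫ x, (c * W.Psi ι l' m (cubeClamp x) +
          a * (W.bump l x * W.Psi ι l' m (cubeClamp x))) ∂cubeMeasure d :=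
      integral_cube_congr fun x hx => by rw [cubeClamp_of_mem hx]; ring
    rw [e, integral_cube_clamp, integral_add, integral_const_mul a]
    · exact (continuous_const.mul (hW.continuous_Psi_clamp _ _ _)).integrable_cube
    · exact (continuous_const.mul ((hW.continuous_bump l).mul
        (hW.continuous_Psi_clamp _ _ _))).integrable_cube
  have h3 : (2 : ℝ) ^ ((l' : ℝ) * (α + d / 2)) *
      |a * ∫ x, W.bump l x * W.Psi ι l' m (cubeClamp x) ∂cubeMeasure d| ≤ ε := by
    have hb := hW.abs_integral_bump_Psi_le hl hl' m hι
    rw [abs_mul]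
    split_ifs at hb with h
    · subst h
      calc (2 : ℝ) ^ ((l : ℝ) * (α + d / 2)) * (|a| * _)
          ≤ 2 ^ ((l : ℝ) * (α + d / 2)) * (ε * 2 ^ (-((l : ℝ) * (α + d / 2))) * 1) := by
            gcongr
        _ = ε := by
            rw [Real.rpow_neg two_pos.le]; field_simp
    · rw [le_antisymm hb (abs_nonneg _)]; simpa using hε
  rw [h1, h2, add_assoc]
  refine add_le_add_right ?_ _
  refine (mul_le_mul_of_nonneg_left (abs_add_le _ _) (by positivity)).trans ?_
  rw [mul_add]
  exact add_le_add_right h3 _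

/-- Hölder balls of slightly larger radius contain the constant functions with nearby values. -/
lemma IsCDV.exists_holderBall_const (hW : W.IsCDV S) (hS : 0 < S) (d : ℕ) (α : ℝ) :
    ∃ D, 0 ≤ D ∧ ∀ M' c c' : ℝ, W.HolderBall α M' (fun _ : Fin d → ℝ => c) →
      W.HolderBall α (M' + D * |c' - c|) (fun _ : Fin d → ℝ => c') := by
  refine ⟨2 ^ ((W.J₀ : ℝ) * (α + d / 2)) * ∑ m : Fin d → Fin (2 ^ W.J₀),
    |∫ x in Icc (0 : Fin d → ℝ) 1, W.Phi W.J₀ m x|, by positivity, fun M' c c' hc => ?_⟩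
  refine ⟨uniformContinuous_const.uniformContinuousOn, fun m₀ l m ι hl hι => ?_⟩
  have h0 := hc.2 m₀ l m ι hl hι
  have hΨ : ∫ x in Icc (0 : Fin d → ℝ) 1, W.Psi ι l m x = 0 := by
    rw [integral_cube_clamp, hW.integral_Psi hS hl m hι]
  simp only [integral_const_mul, hΨ, mul_zero, abs_zero, add_zero] at h0 ⊢
  have h1 : |c' * ∫ x in Icc (0 : Fin d → ℝ) 1, W.Phi W.J₀ m₀ x| ≤
      |c * ∫ x in Icc (0 : Fin d → ℝ) 1, W.Phi W.J₀ m₀ x| +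
        |c' - c| * |∫ x in Icc (0 : Fin d → ℝ) 1, W.Phi W.J₀ m₀ x| := by
    rw [← abs_mul]
    refine le_trans (le_of_eq ?_) (abs_add_le _ _)
    congr 1; ring
  have h2 : |∫ x in Icc (0 : Fin d → ℝ) 1, W.Phi W.J₀ m₀ x| ≤
      ∑ m : Fin d → Fin (2 ^ W.J₀), |∫ x in Icc (0 : Fin d → ℝ) 1, W.Phi W.J₀ m x| :=
    Finset.single_le_sum (f := fun m : Fin d → Fin (2 ^ W.J₀) =>
      |∫ x in Icc (0 : Fin d → ℝ) 1, W.Phi W.J₀ m x|) (fun _ _ => abs_nonneg _)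
      (Finset.mem_univ m₀)
  calc _ ≤ (2 : ℝ) ^ ((W.J₀ : ℝ) * (α + d / 2)) *
        (|c * ∫ x in Icc (0 : Fin d → ℝ) 1, W.Phi W.J₀ m₀ x| + |c' - c| *
        ∑ m : Fin d → Fin (2 ^ W.J₀), |∫ x in Icc (0 : Fin d → ℝ) 1, W.Phi W.J₀ m x|) := by
        refine mul_le_mul_of_nonneg_left (h1.trans ?_) (by positivity)
        gcongr
    _ ≤ _ := by
        rw [mul_add]
        refine (add_le_add_left h0 _).trans_eq ?_
        ring

end CDVData
end

/-! ### Moments of functions of an independent sample -/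

section

/-- Bounded measurable real functions. -/
structure BddMeas {Ω : Type*} [MeasurableSpace Ω] (f : Ω → ℝ) : Prop where
  meas : Measurable f
  bdd : ∃ C, ∀ x, |f x| ≤ C

namespace BddMeas

variable {Ω Ω' : Type*} [MeasurableSpace Ω] [MeasurableSpace Ω'] {f g : Ω → ℝ}

lemma of_le {C : ℝ} (hf : Measurable f) (h : ∀ x, |f x| ≤ C) : BddMeas f := ⟨hf, C, h⟩

lemma const (c : ℝ) : BddMeas fun _ : Ω => c := ⟨measurable_const, |c|, fun _ => le_rfl⟩

lemma add (hf : BddMeas f) (hg : BddMeas g) : BddMeas fun x => f x + g x := by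
  obtain ⟨C, hC⟩ := hf.bdd
  obtain ⟨D, hD⟩ := hg.bdd
  exact ⟨hf.meas.add hg.meas, C + D, fun x => (abs_add_le _ _).trans (add_le_add (hC x) (hD x))⟩

lemma mul (hf : BddMeas f) (hg : BddMeas g) : BddMeas fun x => f x * g x := by
  obtain ⟨C, hC⟩ := hf.bdd
  obtain ⟨D, hD⟩ := hg.bdd
  refine ⟨hf.meas.mul hg.meas, C * D, fun x => ?_⟩
  rw [abs_mul]
  exact mul_le_mul (hC x) (hD x) (abs_nonneg _) ((abs_nonneg _).trans (hC x))

lemma const_mul (c : ℝ) (hf : BddMeas f) : BddMeas fun x => c * f x := (const c).mul hf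

lemma neg (hf : BddMeas f) : BddMeas fun x => - f x := by
  simpa using hf.const_mul (-1)

lemma sub (hf : BddMeas f) (hg : BddMeas g) : BddMeas fun x => f x - g x := by
  simpa [sub_eq_add_neg] using hf.add hg.neg

lemma pow (hf : BddMeas f) (k : ℕ) : BddMeas fun x => f x ^ k := by
  induction k with
  | zero => simpa using const (Ω := Ω) 1
  | succ k ih => simpa only [pow_succ] using ih.mul hf

lemma abs (hf : BddMeas f) : BddMeas fun x => |f x| := by
  obtain ⟨C, hC⟩ := hf.bdd
  exact ⟨hf.meas.abs, C, fun x => by simpa using hC x⟩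

lemma sum {ι : Type*} (s : Finset ι) {f : ι → Ω → ℝ} (hf : ∀ i ∈ s, BddMeas (f i)) :
    BddMeas fun x => ∑ i ∈ s, f i x := by
  classical
  induction s using Finset.induction_on with
  | empty => simpa using const (Ω := Ω) 0
  | insert i s hi ih =>
    simp only [Finset.sum_insert hi]
    exact (hf i (by simp)).add (ih fun k hk => hf k (by simp [hk]))

lemma comp (hf : BddMeas f) {u : Ω' → Ω} (hu : Measurable u) : BddMeas fun x => f (u x) := by
  obtain ⟨C, hC⟩ := hf.bdd
  exact ⟨hf.meas.comp hu, C, fun x => hC _⟩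

lemma integrable (hf : BddMeas f) (P : Measure Ω) [IsFiniteMeasure P] : Integrable f P := by
  obtain ⟨C, hC⟩ := hf.bdd
  exact Integrable.of_bound hf.meas.aestronglyMeasurable C (ae_of_all _ hC)

lemma integral_right {F : Ω → Ω' → ℝ} (hF : BddMeas fun q : Ω × Ω' => F q.1 q.2)
    (P : Measure Ω') [IsProbabilityMeasure P] : BddMeas fun x => ∫ y, F x y ∂P := by
  obtain ⟨C, hC⟩ := hF.bdd
  refine ⟨(hF.meas.stronglyMeasurable.integral_prod_right (ν := P)).measurable, C, fun x => ?_⟩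
  have := norm_integral_le_of_norm_le_const (μ := P) (f := F x) (C := C)
    (ae_of_all _ fun y => hC (x, y))
  simpa using this

lemma integral_left {F : Ω → Ω' → ℝ} (hF : BddMeas fun q : Ω × Ω' => F q.1 q.2)
    (P : Measure Ω) [IsProbabilityMeasure P] : BddMeas fun y => ∫ x, F x y ∂P :=
  integral_right (F := fun y x => F x y) (hF.comp measurable_swap) P

lemma mk_right {F : Ω → Ω' → ℝ} (hF : BddMeas fun q : Ω × Ω' => F q.1 q.2) (x : Ω) :
    BddMeas fun y => F x y := hF.comp measurable_prodMk_left

lemma mk_left {F : Ω → Ω' → ℝ} (hF : BddMeas fun q : Ω × Ω' => F q.1 q.2) (y : Ω') :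
    BddMeas fun x => F x y := hF.comp measurable_prodMk_right

lemma comp₂ {Ω₁ Ω₂ : Type*} [MeasurableSpace Ω₁] [MeasurableSpace Ω₂] {F : Ω₁ → Ω₂ → ℝ}
    (hF : BddMeas fun q : Ω₁ × Ω₂ => F q.1 q.2) {u : Ω → Ω₁} {v : Ω → Ω₂} (hu : Measurable u)
    (hv : Measurable v) : BddMeas fun x => F (u x) (v x) := hF.comp (hu.prodMk hv)

lemma integral_swap {F : Ω → Ω' → ℝ} (hF : BddMeas fun q : Ω × Ω' => F q.1 q.2)
    (P : Measure Ω) (Q : Measure Ω') [IsProbabilityMeasure P] [IsProbabilityMeasure Q] :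
    ∫ x, ∫ y, F x y ∂Q ∂P = ∫ y, ∫ x, F x y ∂P ∂Q :=
  integral_integral_swap (hF.integrable (P.prod Q))

end BddMeas

section Sample

variable {Ω : Type*} [MeasurableSpace Ω] (P : Measure Ω) [IsProbabilityMeasure P] {n : ℕ}

/-- The law of a sample of `n` independent observations. -/
abbrev sampleLaw (n : ℕ) : Measure (Fin n → Ω) := Measure.pi fun _ => P

/-- Replacing one observation by an independent copy does not change the law of the sample. -/
lemma measurePreserving_update_sample (i : Fin n) :
    MeasurePreserving (fun q : (Fin n → Ω) × Ω => Function.update q.1 i q.2)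
      ((sampleLaw P n).prod P) (sampleLaw P n) := by
  refine ⟨measurable_update', ?_⟩
  symm
  refine Measure.pi_eq fun s hs => ?_
  rw [Measure.map_apply measurable_update' (MeasurableSet.univ_pi hs)]
  have h : (fun q : (Fin n → Ω) × Ω => Function.update q.1 i q.2) ⁻¹' (Set.univ.pi s) =
      (Set.univ.pi (Function.update s i Set.univ)) ×ˢ (s i) := by
    ext q
    simp only [Set.mem_preimage, Set.mem_pi, Set.mem_univ, true_implies, Set.mem_prod]
    constructor
    · intro h
      refine ⟨fun j => ?_, by simpa using h i⟩
      by_cases hj : j = i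
      · subst hj; simp
      · simpa [hj] using h j
    · rintro ⟨h1, h2⟩ j
      by_cases hj : j = i
      · subst hj; simpa using h2
      · simpa [hj] using h1 j
  rw [h, Measure.prod_prod, Measure.pi_pi, ← Finset.mul_prod_erase _ _ (Finset.mem_univ i),
    ← Finset.mul_prod_erase _ (fun j => P (s j)) (Finset.mem_univ i), mul_comm]
  simp only [Function.update_self, measure_univ, one_mul]
  congr 1
  refine Finset.prod_congr rfl fun j hj => ?_
  rw [Function.update_of_ne (Finset.ne_of_mem_erase hj)]

/-- The expectation can be computed with observation `i` replaced by an independent copy `w`, which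
is integrated out first. -/
lemma integral_resample (i : Fin n) {f : (Fin n → Ω) → ℝ} (hf : BddMeas f) :
    ∫ z, f z ∂sampleLaw P n = ∫ z, ∫ w, f (Function.update z i w) ∂P ∂sampleLaw P n := by
  have h := measurePreserving_update_sample P i
  rw [← integral_prod (fun q : (Fin n → Ω) × Ω => f (Function.update q.1 i q.2))
    ((hf.comp measurable_update').integrable _), ← integral_map h.measurable.aemeasurable
      hf.meas.aestronglyMeasurable, h.map_eq]

lemma integral_eval (i : Fin n) {f : Ω → ℝ} (hf : BddMeas f) :
    ∫ z, f (z i) ∂sampleLaw P n = ∫ w, f w ∂P := by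
  have h := measurePreserving_eval (fun _ : Fin n => P) i
  rw [← h.map_eq, integral_map h.measurable.aemeasurable hf.meas.aestronglyMeasurable]
  rw [h.map_eq]

lemma integral_eval_pair {i l : Fin n} (hil : i ≠ l) {F : Ω → Ω → ℝ}
    (hF : BddMeas fun q : Ω × Ω => F q.1 q.2) :
    ∫ z, F (z i) (z l) ∂sampleLaw P n = ∫ x, ∫ y, F x y ∂P ∂P := by
  rw [integral_resample P l (f := fun z => F (z i) (z l))
    (hF.comp₂ (measurable_pi_apply i) (measurable_pi_apply l))]
  simp only [Function.update_self, Function.update_of_ne hil]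
  exact integral_eval P i (hF.integral_right P)

/-- The mean squared deviation of an average of independent bounded variables from its mean. -/
lemma integral_avg_sub_sq_le (hn : 0 < n) {f : Ω → ℝ} (hf : BddMeas f) {C : ℝ}
    (hC : ∀ x, |f x| ≤ C) :
    ∫ z, ((1 / (n : ℝ)) * ∑ i, f (z i) - ∫ w, f w ∂P) ^ 2 ∂sampleLaw P n ≤ C ^ 2 / n := by
  have hn' : (0 : ℝ) < n := by exact_mod_cast hn
  have hS : BddMeas fun z : Fin n → Ω => ∑ i, f (z i) :=
    BddMeas.sum _ fun i _ => hf.comp (measurable_pi_apply i)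
  have hmean : ∫ z, ∑ i, f (z i) ∂sampleLaw P n = n * ∫ w, f w ∂P := by
    rw [integral_finsetSum _ fun i _ => (hf.comp (measurable_pi_apply i)).integrable _]
    simp [integral_eval P _ hf]
  have hvar := ProbabilityTheory.variance_sum_pi (μ := fun _ : Fin n => P) (X := fun _ => f)
    fun _ => MemLp.of_bound hf.meas.aestronglyMeasurable C (ae_of_all _ hC)
  have e : (∑ i, fun ω : Fin n → Ω => f (ω i)) = fun z => ∑ i, f (z i) := by
    ext z; simp
  rw [e, ProbabilityTheory.variance_eq_integral hS.meas.aemeasurable, hmean] at hvar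
  have hf2 : ProbabilityTheory.variance f P ≤ C ^ 2 := by
    refine (ProbabilityTheory.variance_le_expectation_sq hf.meas.aestronglyMeasurable).trans ?_
    have : ∫ x, f x ^ 2 ∂P ≤ ∫ x, C ^ 2 ∂P :=
      integral_mono ((hf.pow 2).integrable P) (integrable_const _) fun x => sq_le_sq' 
        (neg_le_of_abs_le (hC x)) (le_of_abs_le (hC x))
    simpa using this
  have e2 : ∀ z : Fin n → Ω, ((1 / (n : ℝ)) * ∑ i, f (z i) - ∫ w, f w ∂P) ^ 2 =
      (1 / (n : ℝ) ^ 2) * (∑ i, f (z i) - n * ∫ w, f w ∂P) ^ 2 := by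
    intro z; field_simp
  simp_rw [e2]
  rw [integral_const_mul, hvar]
  simp only [Finset.sum_const, Finset.card_univ, Fintype.card_fin, nsmul_eq_mul]
  rw [div_mul_eq_mul_div, one_mul, div_le_div_iff₀ (by positivity) hn']
  nlinarith [mul_le_mul_of_nonneg_left hf2 (sq_nonneg (n : ℝ))]

/-- The second moment of an off-diagonal double sum whose terms are centred in the second
argument. Two terms are uncorrelated unless their second arguments come from the same observation,
or each of them uses the second argument of the other. -/
lemma integral_offDiag_sq_le {a : Ω → Ω → ℝ} (ha : BddMeas fun q : Ω × Ω => a q.1 q.2)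
    (h0 : ∀ z, ∫ w, a z w ∂P = 0) {H V : ℝ} (hH : ∀ w, |∫ z, a z w ∂P| ≤ H)
    (hV : ∫ z, ∫ w, a z w ^ 2 ∂P ∂P ≤ V) :
    ∫ z, (∑ i, ∑ l, if i = l then 0 else a (z i) (z l)) ^ 2 ∂sampleLaw P n ≤
      n ^ 3 * H ^ 2 + 2 * n ^ 2 * V := by
  have hpair : ∀ i l : Fin n, BddMeas fun z : Fin n → Ω => a (z i) (z l) := fun i l =>
    ha.comp₂ (measurable_pi_apply i) (measurable_pi_apply l)
  have hV0 : 0 ≤ V := (integral_nonneg fun _ => integral_nonneg fun _ => sq_nonneg _).trans hV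
  let c : Fin n → Fin n → (Fin n → Ω) → ℝ := fun i l z => if i = l then 0 else a (z i) (z l)
  have hc : ∀ i l, BddMeas (c i l) := by
    intro i l
    by_cases h : i = l
    · simpa [c, h] using BddMeas.const (Ω := Fin n → Ω) 0
    · simpa [c, h] using hpair i l
  have hsq : ∀ i l : Fin n, i ≠ l → ∫ z, a (z i) (z l) ^ 2 ∂sampleLaw P n ≤ V := by
    intro i l hil
    rw [integral_eval_pair P hil (F := fun x y => a x y ^ 2) (ha.pow 2)]
    exact hV
  -- The expectation of the product of the terms `(i, l)` and `(i', l')`. If the observation `l`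
  -- occurs nowhere else in it, then centring makes it vanish, and likewise for `l'`.
  have key : ∀ i l i' l', ∫ z, c i l z * c i' l' z ∂sampleLaw P n ≤
      (if l = l' then H ^ 2 else 0) + (if i = i' ∧ l = l' then V else 0) +
        (if l = i' ∧ i = l' then V else 0) := by
    intro i l i' l'
    have hpos : 0 ≤ (if l = l' then H ^ 2 else 0) + (if i = i' ∧ l = l' then V else 0) +
        (if l = i' ∧ i = l' then V else 0) := by
      refine add_nonneg (add_nonneg ?_ ?_) ?_ <;> split_ifs <;> positivity
    by_cases hil : i = l
    · simpa [c, hil] using hpos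
    by_cases hil' : i' = l'
    · simpa [c, hil'] using hpos
    have hprod : BddMeas fun z : Fin n → Ω => a (z i) (z l) * a (z i') (z l') :=
      (hpair i l).mul (hpair i' l')
    simp only [c, hil, hil', if_false]
    by_cases hll : l = l'
    · subst hll
      by_cases hii : i = i'
      · subst hii
        have := hsq i l hil
        simp only [← sq]
        refine this.trans ?_
        simp only [and_self, if_true]
        have : 0 ≤ (if l = i ∧ i = l then V else 0) := by split_ifs <;> positivity
        nlinarith [sq_nonneg H]
      -- Only the second arguments coincide: the first ones are integrated out, which leaves the
      -- square of a function bounded by `H`.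
      · rw [integral_resample P i hprod]
        have e1 : ∀ z : Fin n → Ω, ∫ w, a (Function.update z i w i) (Function.update z i w l) *
            a (Function.update z i w i') (Function.update z i w l) ∂P =
            (∫ w, a w (z l) ∂P) * a (z i') (z l) := by
          intro z
          simp only [Function.update_self, Function.update_of_ne (Ne.symm hil),
            Function.update_of_ne (Ne.symm hii)]
          rw [integral_mul_const]
        simp_rw [e1]
        have hh : BddMeas fun w => ∫ z, a z w ∂P := ha.integral_left P
        rw [integral_resample P i' (f := fun z => (∫ w, a w (z l) ∂P) * a (z i') (z l))
          ((hh.comp (measurable_pi_apply l)).mul (hpair i' l))]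
        have e2 : ∀ z : Fin n → Ω, ∫ w, (∫ w', a w' (Function.update z i' w l) ∂P) *
            a (Function.update z i' w i') (Function.update z i' w l) ∂P =
            (∫ w, a w (z l) ∂P) ^ 2 := by
          intro z
          simp only [Function.update_self, Function.update_of_ne (Ne.symm hil')]
          rw [integral_const_mul, sq]
        simp_rw [e2]
        have : ∫ z : Fin n → Ω, (∫ w, a w (z l) ∂P) ^ 2 ∂sampleLaw P n ≤
            ∫ _, H ^ 2 ∂sampleLaw P n :=
          integral_mono (((hh.comp (measurable_pi_apply l)).pow 2).integrable _)
            (integrable_const _) fun z => sq_le_sq' (neg_le_of_abs_le (hH _))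
              (le_of_abs_le (hH _))
        refine this.trans ?_
        simp only [integral_const, probReal_univ, one_smul, hii, false_and, if_false, if_true]
        split_ifs <;> linarith
    · by_cases hli : l = i'
      · subst hli
        -- The transposed pair is bounded by the second moments.
        by_cases hil2 : i = l'
        · subst hil2
          have h1 := hsq i l hil
          have h2 := hsq l i hil'
          have : ∫ z : Fin n → Ω, a (z i) (z l) * a (z l) (z i) ∂sampleLaw P n ≤
              ∫ z : Fin n → Ω, (1 / 2) * (a (z i) (z l) ^ 2 + a (z l) (z i) ^ 2)
                ∂sampleLaw P n :=
            integral_mono (hprod.integrable _)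
              ((((hpair i l).pow 2).add ((hpair l i).pow 2)).const_mul (1 / 2) |>.integrable _)
              fun z => by nlinarith [sq_nonneg (a (z i) (z l) - a (z l) (z i))]
          rw [integral_const_mul, integral_add (((hpair i l).pow 2).integrable _)
            (((hpair l i).pow 2).integrable _)] at this
          simp only [hll, hil, and_self, if_true, if_false]
          linarith
        · rw [integral_resample P l' hprod]
          have e1 : ∀ z : Fin n → Ω, ∫ w, a (Function.update z l' w i) (Function.update z l' w l) *
              a (Function.update z l' w l) (Function.update z l' w l') ∂P = 0 := by
            intro z
            simp only [Function.update_self, Function.update_of_ne hil2,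
              Function.update_of_ne hil']
            rw [integral_const_mul, h0, mul_zero]
          simp_rw [e1]
          simpa using hpos
      · rw [integral_resample P l hprod]
        have e1 : ∀ z : Fin n → Ω, ∫ w, a (Function.update z l w i) (Function.update z l w l) *
            a (Function.update z l w i') (Function.update z l w l') ∂P = 0 := by
          intro z
          simp only [Function.update_self, Function.update_of_ne hil,
            Function.update_of_ne (Ne.symm hll), Function.update_of_ne (Ne.symm hli)]
          rw [integral_mul_const, h0, zero_mul]
        simp_rw [e1]
        simpa using hpos
  have hexp : ∀ z : Fin n → Ω, (∑ i, ∑ l, if i = l then 0 else a (z i) (z l)) ^ 2 =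
      ∑ i, ∑ i', ∑ l, ∑ l', c i l z * c i' l' z := by
    intro z
    rw [sq, Finset.sum_mul_sum]
    simp_rw [Finset.sum_mul_sum]
    rfl
  simp_rw [hexp]
  rw [integral_finsetSum _ fun i _ => (BddMeas.sum _ fun i' _ => BddMeas.sum _ fun l _ =>
    BddMeas.sum _ fun l' _ => (hc i l).mul (hc i' l')).integrable _]
  calc _ ≤ ∑ i : Fin n, ∑ i' : Fin n, ∑ l : Fin n, ∑ l' : Fin n,
      ((if l = l' then H ^ 2 else 0) + (if i = i' ∧ l = l' then V else 0) +
        (if l = i' ∧ i = l' then V else 0)) := by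
        refine Finset.sum_le_sum fun i _ => ?_
        rw [integral_finsetSum _ fun i' _ => (BddMeas.sum _ fun l _ =>
          BddMeas.sum _ fun l' _ => (hc i l).mul (hc i' l')).integrable _]
        refine Finset.sum_le_sum fun i' _ => ?_
        rw [integral_finsetSum _ fun l _ => (
          BddMeas.sum _ fun l' _ => (hc i l).mul (hc i' l')).integrable _]
        refine Finset.sum_le_sum fun l _ => ?_
        rw [integral_finsetSum _ fun l' _ => ((hc i l).mul (hc i' l')).integrable _]
        exact Finset.sum_le_sum fun l' _ => key i l i' l'
    _ = _ := by
        simp only [Finset.sum_add_distrib, ite_and]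
        simp
        ring

/-- The fourth moment of an average of independent centred variables, by exponential moments:
`t` is a scale on which the average is of constant order. -/
lemma integral_avg_pow_four_le (hn : 0 < n) {ξ : Ω → ℝ} (hξ : BddMeas ξ)
    (h0 : ∫ w, ξ w ∂P = 0) {b v t : ℝ} (hb : ∀ w, |ξ w| ≤ b) (hv : ∫ w, ξ w ^ 2 ∂P ≤ v)
    (ht : 0 < t) (htb : t * b ≤ n) (htv : t ^ 2 * v ≤ n) :
    ∫ z, ((1 / (n : ℝ)) * ∑ i, ξ (z i)) ^ 4 ∂sampleLaw P n ≤ 150 / t ^ 4 := by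
  have hn' : (0 : ℝ) < n := by exact_mod_cast hn
  have hbdd : ∀ θ : ℝ, BddMeas fun w => Real.exp (θ * ξ w) := by
    intro θ
    refine ⟨(hξ.meas.const_mul θ).exp, Real.exp (|θ| * b), fun w => ?_⟩
    rw [abs_of_pos (Real.exp_pos _), Real.exp_le_exp]
    refine (le_abs_self _).trans ?_
    rw [abs_mul]
    exact mul_le_mul_of_nonneg_left (hb w) (abs_nonneg _)
  -- The exponential moment of one summand, from `exp x ≤ 1 + x + x ^ 2` for `|x| ≤ 1`.
  have hone : ∀ θ : ℝ, |θ| = t / n → ∫ w, Real.exp (θ * ξ w) ∂P ≤ Real.exp (1 / n) := by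
    intro θ hθ
    have hle : ∀ w, Real.exp (θ * ξ w) ≤ 1 + θ * ξ w + θ ^ 2 * ξ w ^ 2 := by
      intro w
      have h1 : |θ * ξ w| ≤ 1 := by
        rw [abs_mul, hθ, div_mul_eq_mul_div, div_le_one hn']
        exact (mul_le_mul_of_nonneg_left (hb w) ht.le).trans htb
      have := (abs_le.1 (Real.abs_exp_sub_one_sub_id_le h1)).2
      rw [mul_pow] at this
      linarith
    have hr : BddMeas fun w => 1 + θ * ξ w + θ ^ 2 * ξ w ^ 2 :=
      ((BddMeas.const 1).add (hξ.const_mul θ)).add ((hξ.pow 2).const_mul _)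
    refine (integral_mono ((hbdd θ).integrable P) (hr.integrable P) hle).trans ?_
    rw [integral_add (((BddMeas.const 1).add (hξ.const_mul θ)).integrable P)
      (((hξ.pow 2).const_mul _).integrable P), integral_add ((BddMeas.const 1).integrable P)
      ((hξ.const_mul θ).integrable P), integral_const_mul, integral_const_mul, h0]
    simp only [integral_const, probReal_univ, one_smul, mul_zero, add_zero]
    have h2 : θ ^ 2 * ∫ w, ξ w ^ 2 ∂P ≤ 1 / n := by
      rw [← sq_abs, hθ, div_pow, div_mul_eq_mul_div, div_le_div_iff₀ (by positivity) hn']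
      nlinarith [mul_le_mul_of_nonneg_left hv (sq_nonneg t)]
    have := Real.add_one_le_exp (1 / (n : ℝ))
    linarith
  have hexp : ∀ θ : ℝ, |θ| = t / n →
      ∫ z : Fin n → Ω, Real.exp (θ * ∑ i, ξ (z i)) ∂sampleLaw P n ≤ Real.exp 1 := by
    intro θ hθ
    simp_rw [Finset.mul_sum, Real.exp_sum]
    rw [integral_fintype_prod_eq_prod (f := fun _ w => Real.exp (θ * ξ w))]
    rw [Finset.prod_const, Finset.card_univ, Fintype.card_fin]
    refine (pow_le_pow_left₀ (integral_nonneg fun _ => (Real.exp_pos _).le) (hone θ hθ) n).trans ?_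
    rw [← Real.exp_nat_mul, mul_one_div_cancel hn'.ne']
  have hS : BddMeas fun z : Fin n → Ω => ∑ i, ξ (z i) :=
    BddMeas.sum _ fun i _ => hξ.comp (measurable_pi_apply i)
  have hpt : ∀ x : ℝ, x ^ 4 ≤ 24 * (Real.exp x + Real.exp (-x)) := by
    intro x
    have h1 := Real.pow_div_factorial_le_exp |x| (abs_nonneg x) 4
    have h2 : Real.exp |x| ≤ Real.exp x + Real.exp (-x) := by
      rcases abs_cases x with ⟨h, -⟩ | ⟨h, -⟩ <;> rw [h]
      · linarith [Real.exp_pos (-x)]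
      · linarith [Real.exp_pos x]
    rw [Even.pow_abs (by decide)] at h1
    norm_num [Nat.factorial] at h1
    linarith
  have hE : ∀ θ : ℝ, BddMeas fun z : Fin n → Ω => Real.exp (θ * ∑ i, ξ (z i)) := by
    intro θ
    obtain ⟨C, hC⟩ := hS.bdd
    refine ⟨(hS.meas.const_mul θ).exp, Real.exp (|θ| * C), fun w => ?_⟩
    rw [abs_of_pos (Real.exp_pos _), Real.exp_le_exp]
    refine (le_abs_self _).trans ?_
    rw [abs_mul]
    exact mul_le_mul_of_nonneg_left (hC w) (abs_nonneg _)
  have habs : |t / n| = t / n := abs_of_nonneg (by positivity)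
  have e : ∀ z : Fin n → Ω, ((1 / (n : ℝ)) * ∑ i, ξ (z i)) ^ 4 =
      (1 / t ^ 4) * ((t / n) * ∑ i, ξ (z i)) ^ 4 := by
    intro z; field_simp
  calc ∫ z, ((1 / (n : ℝ)) * ∑ i, ξ (z i)) ^ 4 ∂sampleLaw P n
      ≤ ∫ z, (24 / t ^ 4) * (Real.exp ((t / n) * ∑ i, ξ (z i)) +
          Real.exp ((-(t / n)) * ∑ i, ξ (z i))) ∂sampleLaw P n := by
        refine integral_mono (((hS.const_mul _).pow 4).integrable _)
          ((((hE _).add (hE _)).const_mul _).integrable _) fun z => ?_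
        have h := mul_le_mul_of_nonneg_left (hpt ((t / n) * ∑ i, ξ (z i)))
          (by positivity : (0 : ℝ) ≤ 1 / t ^ 4)
        refine ((e z).le.trans h).trans_eq ?_
        rw [neg_mul]
        ring
    _ ≤ (24 / t ^ 4) * (Real.exp 1 + Real.exp 1) := by
        rw [integral_const_mul, integral_add ((hE _).integrable _) ((hE _).integrable _)]
        refine mul_le_mul_of_nonneg_left (add_le_add (hexp _ habs) (hexp _ ?_)) (by positivity)
        rw [abs_neg, habs]
    _ ≤ 150 / t ^ 4 := by
        rw [div_mul_eq_mul_div]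
        refine div_le_div_of_nonneg_right ?_ (by positivity)
        have := Real.exp_one_lt_d9
        linarith

end Sample
end

/-! ### Stochastic errors of kernel estimators -/

section

section Upper

variable {Ω : Type*} [MeasurableSpace Ω] {P : Measure Ω} {n : ℕ}
  {κ κ' : Ω → Ω → ℝ} {A Y G : Ω → ℝ} {B k D C₀ : ℝ}

/-- A bounded symmetric kernel with the size and the `L¹` norms of a projection kernel of
resolution `k`. -/
structure KernelBound (P : Measure Ω) (κ : Ω → Ω → ℝ) (B k : ℝ) : Prop where
  bddMeas : BddMeas fun q : Ω × Ω => κ q.1 q.2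
  comm : ∀ z w, κ z w = κ w z
  le : ∀ z w, |κ z w| ≤ B * k
  integral_abs_le : ∀ z, ∫ w, |κ z w| ∂P ≤ B

lemma KernelBound.mono (h : KernelBound P κ B k) (hB : 0 ≤ B) {k' : ℝ} (hk : k ≤ k') :
    KernelBound P κ B k' :=
  ⟨h.bddMeas, h.comm, fun z w => (h.le z w).trans (mul_le_mul_of_nonneg_left hk hB),
    h.integral_abs_le⟩

/-- The kernel estimator of the regression function of `Y`. -/
def kernelEst (κ : Ω → Ω → ℝ) (Y : Ω → ℝ) (z : Fin n → Ω) (x : Ω) : ℝ :=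
  (1 / (n : ℝ)) * ∑ l, Y (z l) * κ (z l) x

/-- The mean of the kernel estimator. -/
def kernelMean (P : Measure Ω) (κ : Ω → Ω → ℝ) (Y : Ω → ℝ) (x : Ω) : ℝ :=
  ∫ w, Y w * κ w x ∂P

/-- The stochastic error of the kernel estimator. -/
def kernelDev (P : Measure Ω) (κ : Ω → Ω → ℝ) (Y : Ω → ℝ) (z : Fin n → Ω) (x : Ω) : ℝ :=
  kernelEst κ Y z x - kernelMean P κ Y x

lemma KernelBound.bdd_mul (hκ : KernelBound P κ B k) (hY : BddMeas Y) :
    BddMeas fun q : Ω × Ω => Y q.1 * κ q.1 q.2 := (hY.comp measurable_fst).mul hκ.bddMeas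

lemma KernelBound.bdd_est (hκ : KernelBound P κ B k) (hY : BddMeas Y) :
    BddMeas fun q : (Fin n → Ω) × Ω => kernelEst κ Y q.1 q.2 := by
  refine BddMeas.const_mul _ (BddMeas.sum _ fun l _ => ?_)
  exact (hκ.bdd_mul hY).comp₂ (F := fun w x => Y w * κ w x)
    ((measurable_pi_apply l).comp measurable_fst) measurable_snd

variable [IsProbabilityMeasure P]

lemma KernelBound.bdd_mean (hκ : KernelBound P κ B k) (hY : BddMeas Y) :
    BddMeas (kernelMean P κ Y) :=
  BddMeas.integral_left (F := fun w x => Y w * κ w x) (hκ.bdd_mul hY) P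

lemma KernelBound.abs_mean_le (hκ : KernelBound P κ B k) (hY : BddMeas Y)
    (hYB : ∀ x, |Y x| ≤ B) (x : Ω) : |kernelMean P κ Y x| ≤ B ^ 2 := by
  have hB : 0 ≤ B := (abs_nonneg _).trans (hYB x)
  refine abs_integral_le_integral_abs.trans ?_
  calc ∫ w, |Y w * κ w x| ∂P ≤ ∫ w, B * |κ x w| ∂P := by
        refine integral_mono ((((hκ.bdd_mul hY).mk_left (F := fun w x => Y w * κ w x)
          x).abs).integrable P)
          (((hκ.bddMeas.mk_right (F := κ) x).abs.const_mul B).integrable P) fun w => ?_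
        simp only [abs_mul, hκ.comm w x]
        exact mul_le_mul_of_nonneg_right (hYB w) (abs_nonneg _)
    _ ≤ B ^ 2 := by
        rw [integral_const_mul, sq]
        exact mul_le_mul_of_nonneg_left (hκ.integral_abs_le x) hB

lemma KernelBound.bdd_dev (hκ : KernelBound P κ B k) (hY : BddMeas Y) :
    BddMeas fun q : (Fin n → Ω) × Ω => kernelDev P κ Y q.1 q.2 :=
  (hκ.bdd_est hY).sub ((hκ.bdd_mean hY).comp measurable_snd)

lemma KernelBound.bdd_dev_eval (hκ : KernelBound P κ B k) (hY : BddMeas Y) (i : Fin n) :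
    BddMeas fun z : Fin n → Ω => kernelDev P κ Y z (z i) :=
  (hκ.bdd_dev hY).comp₂ (F := fun z x => kernelDev P κ Y z x) measurable_id (measurable_pi_apply i)

/-- The deviation `Y(w) κ(w, x) - E[Y κ(·, x)]` is centred and its variance is of the order of the
resolution. -/
lemma KernelBound.integral_centred_sq_le (hκ : KernelBound P κ B k) (hY : BddMeas Y)
    (hYB : ∀ x, |Y x| ≤ B) (hk : 0 ≤ k) (x : Ω) :
    ∫ w, (Y w * κ w x - kernelMean P κ Y x) ^ 2 ∂P ≤ B ^ 4 * k := by
  have hB : 0 ≤ B := (abs_nonneg _).trans (hYB x)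
  have hf : BddMeas fun w => Y w * κ w x :=
    (hκ.bdd_mul hY).mk_left (F := fun w x => Y w * κ w x) x
  have e : ∀ w, (Y w * κ w x - kernelMean P κ Y x) ^ 2 = (Y w * κ w x) ^ 2 -
      2 * kernelMean P κ Y x * (Y w * κ w x) + kernelMean P κ Y x ^ 2 := fun w => by ring
  simp_rw [e]
  rw [integral_add (((hf.pow 2).sub (hf.const_mul _)).integrable P)
    ((BddMeas.const _).integrable P), integral_sub ((hf.pow 2).integrable P)
    ((hf.const_mul _).integrable P), integral_const_mul]
  simp only [integral_const, probReal_univ, one_smul]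
  have h1 : ∫ w, (Y w * κ w x) ^ 2 ∂P ≤ B ^ 4 * k := by
    calc ∫ w, (Y w * κ w x) ^ 2 ∂P ≤ ∫ w, (B ^ 3 * k) * |κ x w| ∂P := by
          refine integral_mono ((hf.pow 2).integrable P)
            (((hκ.bddMeas.mk_right (F := κ) x).abs.const_mul _).integrable P) fun w => ?_
          simp only [hκ.comm w x]
          rw [mul_pow, ← sq_abs (Y w), ← sq_abs (κ x w)]
          have h1 := hYB w
          have h2 := hκ.le x w
          calc |Y w| ^ 2 * |κ x w| ^ 2 ≤ B ^ 2 * ((B * k) * |κ x w|) := by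
                refine mul_le_mul (pow_le_pow_left₀ (abs_nonneg _) h1 2) ?_ (by positivity)
                  (by positivity)
                rw [sq]
                exact mul_le_mul_of_nonneg_right h2 (abs_nonneg _)
            _ = _ := by ring
      _ ≤ B ^ 4 * k := by
          rw [integral_const_mul]
          refine (mul_le_mul_of_nonneg_left (hκ.integral_abs_le x) (by positivity)).trans_eq ?_
          ring
  have h2 : ∫ w, Y w * κ w x ∂P = kernelMean P κ Y x := rfl
  rw [h2]
  nlinarith [sq_nonneg (kernelMean P κ Y x)]

/-- The off-diagonal part of the interaction of a bounded weight with the stochastic error of a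
kernel estimator is a centred double sum, and its second moment is that of `integral_offDiag_sq_le`
with `V` of the order of the resolution. -/
lemma KernelBound.integral_offDiag_le (hκ : KernelBound P κ B k) (hY : BddMeas Y)
    (hYB : ∀ x, |Y x| ≤ B) (hk : 0 ≤ k) (hG : BddMeas G) (hGD : ∀ x, |G x| ≤ D) :
    ∫ z, (∑ i, ∑ l, if i = l then 0 else
      G (z i) * (Y (z l) * κ (z l) (z i) - kernelMean P κ Y (z i))) ^ 2 ∂sampleLaw P n ≤
      n ^ 3 * (2 * B ^ 2 * D) ^ 2 + 2 * n ^ 2 * (D ^ 2 * (B ^ 4 * k)) := by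
  have hm := hκ.bdd_mean hY
  have hin : BddMeas fun q : Ω × Ω => Y q.2 * κ q.2 q.1 :=
    (hκ.bdd_mul hY).comp measurable_swap
  have ha : BddMeas fun q : Ω × Ω => G q.1 * (Y q.2 * κ q.2 q.1 - kernelMean P κ Y q.1) :=
    (hG.comp measurable_fst).mul (hin.sub (hm.comp measurable_fst))
  refine integral_offDiag_sq_le P
    (a := fun x w => G x * (Y w * κ w x - kernelMean P κ Y x)) ha (fun x => ?_) (fun w => ?_) ?_
  · rw [integral_const_mul, integral_sub ((hin.mk_right (F := fun x w => Y w * κ w x)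
      x).integrable P) (integrable_const _)]
    simp [kernelMean]
  · have hB : 0 ≤ B := (abs_nonneg _).trans (hYB w)
    have hD : 0 ≤ D := (abs_nonneg _).trans (hGD w)
    refine abs_integral_le_integral_abs.trans ?_
    calc ∫ x, |G x * (Y w * κ w x - kernelMean P κ Y x)| ∂P
        ≤ ∫ x, D * (B * |κ w x| + B ^ 2) ∂P := by
          refine integral_mono ((ha.mk_left (F := fun x w =>
            G x * (Y w * κ w x - kernelMean P κ Y x)) w).abs.integrable P)
            (((((hκ.bddMeas.mk_right (F := κ) w).abs.const_mul B).add
              (BddMeas.const _)).const_mul D).integrable P) fun x => ?_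
          simp only [abs_mul]
          refine mul_le_mul (hGD x) ?_ (abs_nonneg _) hD
          refine (abs_sub _ _).trans (add_le_add ?_ (hκ.abs_mean_le hY hYB x))
          rw [abs_mul]
          exact mul_le_mul_of_nonneg_right (hYB w) (abs_nonneg _)
      _ ≤ 2 * B ^ 2 * D := by
          rw [integral_const_mul, integral_add (((hκ.bddMeas.mk_right (F := κ)
            w).abs.const_mul B).integrable P) (integrable_const _), integral_const_mul]
          simp only [integral_const, probReal_univ, one_smul]
          have := mul_le_mul_of_nonneg_left (hκ.integral_abs_le w) (mul_nonneg hD hB)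
          nlinarith
  · calc ∫ x, ∫ w, (G x * (Y w * κ w x - kernelMean P κ Y x)) ^ 2 ∂P ∂P
        ≤ ∫ x, D ^ 2 * (B ^ 4 * k) ∂P := by
          refine integral_mono ((BddMeas.integral_right (F := fun x w =>
            (G x * (Y w * κ w x - kernelMean P κ Y x)) ^ 2) (ha.pow 2) P).integrable P)
            (integrable_const _) fun x => ?_
          simp only [mul_pow]
          rw [integral_const_mul]
          refine mul_le_mul ?_ (hκ.integral_centred_sq_le hY hYB hk x)
            (integral_nonneg fun _ => sq_nonneg _) (sq_nonneg _)
          rw [← sq_abs]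
          exact pow_le_pow_left₀ (abs_nonneg _) (hGD x) 2
      _ = _ := by simp

/-- The interaction of a bounded weight with the stochastic error of a kernel estimator. The
diagonal terms contribute the square of `k / n`, which dominates the share `k / n ^ 2` of the
variance of the other terms. -/
lemma KernelBound.integral_avg_mul_dev_sq_le (hκ : KernelBound P κ B k) (hn : 0 < n)
    (hY : BddMeas Y) (hYB : ∀ x, |Y x| ≤ B) (hB : 1 ≤ B) (hk : 1 ≤ k) (hG : BddMeas G)
    (hGD : ∀ x, |G x| ≤ D) :
    ∫ z, ((1 / (n : ℝ)) * ∑ i, G (z i) * kernelDev P κ Y z (z i)) ^ 2 ∂sampleLaw P n ≤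
      24 * D ^ 2 * B ^ 4 * (1 / n + (k / n) ^ 2) := by
  have hn' : (0 : ℝ) < n := by exact_mod_cast hn
  have hn1 : (1 : ℝ) ≤ n := by exact_mod_cast hn
  let c : Ω → Ω → ℝ := fun x w => G x * (Y w * κ w x - kernelMean P κ Y x)
  have hm := hκ.bdd_mean hY
  have hc : BddMeas fun q : Ω × Ω => c q.1 q.2 := (hG.comp measurable_fst).mul
    (((hκ.bdd_mul hY).comp measurable_swap).sub (hm.comp measurable_fst))
  have hcd : ∀ x, |c x x| ≤ 2 * D * B ^ 2 * k := by
    intro x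
    have hD : 0 ≤ D := (abs_nonneg _).trans (hGD x)
    simp only [c, abs_mul]
    calc |G x| * |Y x * κ x x - kernelMean P κ Y x| ≤ D * (B * (B * k) + B ^ 2) := by
          refine mul_le_mul (hGD x) ?_ (abs_nonneg _) hD
          refine (abs_sub _ _).trans (add_le_add ?_ (hκ.abs_mean_le hY hYB x))
          rw [abs_mul]
          exact mul_le_mul (hYB x) (hκ.le x x) (abs_nonneg _) (by linarith)
      _ ≤ _ := by
          have : 0 ≤ D * B ^ 2 := by positivity
          nlinarith
  have hdecomp : ∀ z : Fin n → Ω, (1 / (n : ℝ)) * ∑ i, G (z i) * kernelDev P κ Y z (z i) =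
      (1 / (n : ℝ) ^ 2) * (∑ i, ∑ l, if i = l then 0 else c (z i) (z l)) +
        (1 / (n : ℝ) ^ 2) * ∑ i, c (z i) (z i) := by
    intro z
    have h1 : ∀ i, G (z i) * kernelDev P κ Y z (z i) = (1 / (n : ℝ)) * ∑ l, c (z i) (z l) := by
      intro i
      simp only [kernelDev, kernelEst, c, ← Finset.mul_sum, Finset.sum_sub_distrib]
      simp only [Finset.sum_const, Finset.card_univ, Fintype.card_fin, nsmul_eq_mul]
      field_simp
    have h2 : ∀ i, ∑ l, c (z i) (z l) =
        (∑ l, if i = l then 0 else c (z i) (z l)) + c (z i) (z i) := by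
      intro i
      rw [← Finset.sum_erase_add _ _ (Finset.mem_univ i)]
      congr 1
      rw [← Finset.sum_erase_add (a := i) (f := fun l => if i = l then 0 else c (z i) (z l)) _
        (Finset.mem_univ i)]
      simp only [if_true, add_zero]
      exact Finset.sum_congr rfl fun l hl => by rw [if_neg (Finset.ne_of_mem_erase hl).symm]
    simp_rw [h1, h2, mul_add, Finset.sum_add_distrib, ← Finset.mul_sum]
    field_simp
  have hbo : BddMeas fun z : Fin n → Ω => ∑ i, ∑ l, if i = l then 0 else c (z i) (z l) := by
    refine BddMeas.sum _ fun i _ => BddMeas.sum _ fun l _ => ?_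
    split_ifs
    · exact BddMeas.const 0
    · exact hc.comp₂ (F := c) (measurable_pi_apply i) (measurable_pi_apply l)
  have hdiag : ∀ z : Fin n → Ω, ((1 / (n : ℝ) ^ 2) * ∑ i, c (z i) (z i)) ^ 2 ≤
      (2 * D * B ^ 2 * k / n) ^ 2 := by
    intro z
    rw [← sq_abs]
    refine pow_le_pow_left₀ (abs_nonneg _) ?_ 2
    rw [abs_mul, abs_of_pos (by positivity : (0 : ℝ) < 1 / (n : ℝ) ^ 2), div_mul_eq_mul_div,
      one_mul, div_le_div_iff₀ (by positivity) hn']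
    have : |∑ i, c (z i) (z i)| ≤ n * (2 * D * B ^ 2 * k) := by
      refine (Finset.abs_sum_le_sum_abs _ _).trans
        ((Finset.sum_le_sum fun i _ => hcd _).trans_eq ?_)
      simp
    nlinarith
  have hoff := hκ.integral_offDiag_le (n := n) hY hYB (by linarith) hG hGD
  calc _ ≤ ∫ z, ((2 / (n : ℝ) ^ 4) * (∑ i, ∑ l, if i = l then 0 else c (z i) (z l)) ^ 2 +
          2 * (2 * D * B ^ 2 * k / n) ^ 2) ∂sampleLaw P n := by
        refine integral_mono ?_ (((hbo.pow 2).const_mul _).add (BddMeas.const _) |>.integrable _)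
          fun z => ?_
        · have hd : ∀ i, BddMeas fun z : Fin n → Ω => kernelDev P κ Y z (z i) :=
            fun i => hκ.bdd_dev_eval hY i
          exact (((BddMeas.sum _ fun i _ => (hG.comp (measurable_pi_apply i)).mul
            (hd i)).const_mul _).pow 2).integrable _
        · simp only [hdecomp]
          refine (add_sq_le).trans ?_
          rw [mul_add]
          refine add_le_add (le_of_eq ?_) (mul_le_mul_of_nonneg_left (hdiag z) two_pos.le)
          field_simp
    _ ≤ (2 / (n : ℝ) ^ 4) * (n ^ 3 * (2 * B ^ 2 * D) ^ 2 + 2 * n ^ 2 * (D ^ 2 * (B ^ 4 * k))) +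
          2 * (2 * D * B ^ 2 * k / n) ^ 2 := by
        rw [integral_add (((hbo.pow 2).const_mul _).integrable _) (integrable_const _),
          integral_const_mul]
        simp only [integral_const, probReal_univ, one_smul]
        gcongr
    _ = D ^ 2 * B ^ 4 * (8 / n + 4 * k / n ^ 2 + 8 * (k / n) ^ 2) := by
        field_simp
        ring
    _ ≤ D ^ 2 * B ^ 4 * (24 * (1 / n + (k / n) ^ 2)) := by
        refine mul_le_mul_of_nonneg_left ?_ (by positivity)
        have h1 : k / (n : ℝ) ^ 2 ≤ (k / n) ^ 2 := by
          rw [div_pow]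
          exact div_le_div_of_nonneg_right (by nlinarith) (by positivity)
        have h2 : 4 * k / (n : ℝ) ^ 2 = 4 * (k / n ^ 2) := by ring
        have h3 : 8 / (n : ℝ) = 8 * (1 / n) := by ring
        have h4 : (0 : ℝ) ≤ 1 / n := by positivity
        rw [h2, h3]
        nlinarith [sq_nonneg (k / (n : ℝ))]
    _ = _ := by ring

/-- The fourth moment of the stochastic error of a kernel estimator, evaluated at one of the
observations it is built from. -/
lemma KernelBound.integral_dev_pow_four_le (hκ : KernelBound P κ B k) (hn : 0 < n)
    (hY : BddMeas Y) (hYB : ∀ x, |Y x| ≤ B) (hB : 1 ≤ B) (hk : 1 ≤ k) (hC₀ : 1 ≤ C₀)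
    (hkn : k ≤ C₀ * n) (i : Fin n) :
    ∫ z, kernelDev P κ Y z (z i) ^ 4 ∂sampleLaw P n ≤ 20000 * B ^ 8 * C₀ ^ 2 * (k / n) ^ 2 := by
  have hn' : (0 : ℝ) < n := by exact_mod_cast hn
  have hk0 : 0 < k := by linarith
  have hBk : 1 ≤ B ^ 2 * k := by nlinarith
  -- The error at a fixed point is an average of independent centred variables of size `k` and
  -- variance of order `k`, hence of order `√(k / n)`; this is the scale `1 / t`.
  have hfix : ∀ x, ∫ z, kernelDev P κ Y z x ^ 4 ∂sampleLaw P n ≤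
      2400 * B ^ 8 * C₀ ^ 2 * (k / n) ^ 2 := by
    intro x
    have hf : BddMeas fun w => Y w * κ w x :=
      (hκ.bdd_mul hY).mk_left (F := fun w x => Y w * κ w x) x
    set t : ℝ := Real.sqrt (n / k / C₀) / (2 * B ^ 2) with ht
    have ht0 : 0 < t := by positivity
    have ht2 : t ^ 2 = n / k / C₀ / (4 * B ^ 4) := by
      rw [ht, div_pow, Real.sq_sqrt (by positivity)]; ring
    have h := integral_avg_pow_four_le P hn (hf.sub (BddMeas.const (kernelMean P κ Y x)))
      (b := 2 * B ^ 2 * k) (v := B ^ 4 * k) (t := t) (by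
        rw [integral_sub (hf.integrable P) (integrable_const _)]
        simp [kernelMean]) (fun w => by
        refine (abs_sub _ _).trans ?_
        have h1 := hκ.abs_mean_le hY hYB x
        have h2 : |Y w * κ w x| ≤ B * (B * k) := by
          rw [abs_mul]
          exact mul_le_mul (hYB w) (hκ.le w x) (abs_nonneg _) (by linarith)
        nlinarith) (hκ.integral_centred_sq_le hY hYB hk0.le x) ht0 (by
        refine le_of_pow_le_pow_left₀ two_ne_zero hn'.le ?_
        have : (t * (2 * B ^ 2 * k)) ^ 2 = k / C₀ * n := by
          rw [mul_pow, ht2]; field_simp; ring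
        rw [this, sq]
        refine mul_le_mul_of_nonneg_right ?_ hn'.le
        rw [div_le_iff₀ (by linarith)]
        linarith) (by
        rw [ht2]
        have : n / k / C₀ / (4 * B ^ 4) * (B ^ 4 * k) = n / (4 * C₀) := by field_simp
        rw [this]
        exact div_le_self hn'.le (by linarith))
    have e : ∀ z : Fin n → Ω, (1 / (n : ℝ)) * ∑ i, (Y (z i) * κ (z i) x - kernelMean P κ Y x) =
        kernelDev P κ Y z x := by
      intro z
      simp only [kernelDev, kernelEst, Finset.sum_sub_distrib, Finset.sum_const, Finset.card_univ,
        Fintype.card_fin, nsmul_eq_mul]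
      field_simp
    simp_rw [e] at h
    refine h.trans_eq ?_
    have : t ^ 4 = (n / k / C₀ / (4 * B ^ 4)) ^ 2 := by rw [← ht2]; ring
    rw [this]
    field_simp
    ring
  -- Replacing observation `i` by an independent copy `w` of it changes the error at `w` by at most
  -- `2 * B ^ 2 * k / n`.
  rw [integral_resample P i ((hκ.bdd_dev_eval hY i).pow 4)]
  have hupd : ∀ (z : Fin n → Ω) w, kernelDev P κ Y (Function.update z i w) w =
      kernelDev P κ Y z w + (1 / (n : ℝ)) * (Y w * κ w w - Y (z i) * κ (z i) w) := by
    intro z w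
    unfold kernelDev kernelEst
    rw [← Finset.add_sum_erase _ _ (Finset.mem_univ i),
      ← Finset.add_sum_erase _ (fun l => Y (z l) * κ (z l) w) (Finset.mem_univ i)]
    have : ∑ l ∈ Finset.univ.erase i, Y (Function.update z i w l) * κ (Function.update z i w l) w =
        ∑ l ∈ Finset.univ.erase i, Y (z l) * κ (z l) w :=
      Finset.sum_congr rfl fun l hl => by rw [Function.update_of_ne (Finset.ne_of_mem_erase hl)]
    rw [this, Function.update_self]
    ring
  have hpt : ∀ (z : Fin n → Ω) w, kernelDev P κ Y (Function.update z i w) w ^ 4 ≤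
      8 * kernelDev P κ Y z w ^ 4 + 128 * B ^ 8 * C₀ ^ 2 * (k / n) ^ 2 := by
    intro z w
    rw [hupd]
    set u := kernelDev P κ Y z w
    set v := (1 / (n : ℝ)) * (Y w * κ w w - Y (z i) * κ (z i) w)
    have hv : |v| ≤ 2 * B ^ 2 * (k / n) := by
      simp only [v, abs_mul, abs_of_pos (by positivity : (0 : ℝ) < 1 / n)]
      have h1 : |Y w * κ w w - Y (z i) * κ (z i) w| ≤ B * (B * k) + B * (B * k) := by
        refine (abs_sub _ _).trans (add_le_add ?_ ?_) <;>
        · rw [abs_mul]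
          exact mul_le_mul (hYB _) (hκ.le _ _) (abs_nonneg _) (by linarith)
      calc _ ≤ (1 / (n : ℝ)) * (B * (B * k) + B * (B * k)) := by gcongr
        _ = _ := by ring
    have hv4 : v ^ 4 ≤ 16 * B ^ 8 * C₀ ^ 2 * (k / n) ^ 2 := by
      rw [← Even.pow_abs (by decide : Even 4) v]
      have h3 : k / n ≤ C₀ := by rw [div_le_iff₀ hn']; exact hkn
      have h4 : (k / n) ^ 2 ≤ C₀ ^ 2 := pow_le_pow_left₀ (by positivity) h3 2
      calc |v| ^ 4 ≤ (2 * B ^ 2 * (k / n)) ^ 4 := pow_le_pow_left₀ (abs_nonneg _) hv 4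
        _ = 16 * B ^ 8 * (k / n) ^ 2 * (k / n) ^ 2 := by ring
        _ ≤ 16 * B ^ 8 * C₀ ^ 2 * (k / n) ^ 2 := by gcongr
    have h5 : (u + v) ^ 4 ≤ 8 * (u ^ 4 + v ^ 4) := by
      have h6 : (u + v) ^ 2 ≤ 2 * (u ^ 2 + v ^ 2) := add_sq_le
      have h7 : (u ^ 2 + v ^ 2) ^ 2 ≤ 2 * ((u ^ 2) ^ 2 + (v ^ 2) ^ 2) := add_sq_le
      have h8 := pow_le_pow_left₀ (sq_nonneg (u + v)) h6 2
      nlinarith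
    linarith
  have hdev : BddMeas fun q : (Fin n → Ω) × Ω => kernelDev P κ Y q.1 q.2 := hκ.bdd_dev hY
  simp only [Function.update_self]
  calc ∫ z, ∫ w, kernelDev P κ Y (Function.update z i w) w ^ 4 ∂P ∂sampleLaw P n
      ≤ ∫ z, ∫ w, (8 * kernelDev P κ Y z w ^ 4 + 128 * B ^ 8 * C₀ ^ 2 * (k / n) ^ 2) ∂P
          ∂sampleLaw P n := by
        have hb1 : BddMeas fun q : (Fin n → Ω) × Ω =>
            kernelDev P κ Y (Function.update q.1 i q.2) q.2 ^ 4 :=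
          (hdev.comp₂ (F := fun z x => kernelDev P κ Y z x) measurable_update'
            measurable_snd).pow 4
        have hb2 : BddMeas fun q : (Fin n → Ω) × Ω =>
            8 * kernelDev P κ Y q.1 q.2 ^ 4 + 128 * B ^ 8 * C₀ ^ 2 * (k / n) ^ 2 :=
          ((hdev.pow 4).const_mul 8).add (BddMeas.const _)
        exact integral_mono ((hb1.integral_right (F := fun z w =>
            kernelDev P κ Y (Function.update z i w) w ^ 4) P).integrable _)
          ((hb2.integral_right (F := fun z w =>
            8 * kernelDev P κ Y z w ^ 4 + 128 * B ^ 8 * C₀ ^ 2 * (k / n) ^ 2) P).integrable _)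
          fun z => integral_mono ((hb1.mk_right (F := fun z w =>
            kernelDev P κ Y (Function.update z i w) w ^ 4) z).integrable P)
            ((hb2.mk_right (F := fun z w =>
            8 * kernelDev P κ Y z w ^ 4 + 128 * B ^ 8 * C₀ ^ 2 * (k / n) ^ 2) z).integrable P)
            fun w => hpt z w
    _ = ∫ w, ∫ z, (8 * kernelDev P κ Y z w ^ 4 + 128 * B ^ 8 * C₀ ^ 2 * (k / n) ^ 2)
          ∂sampleLaw P n ∂P :=
        BddMeas.integral_swap (F := fun z w =>
            8 * kernelDev P κ Y z w ^ 4 + 128 * B ^ 8 * C₀ ^ 2 * (k / n) ^ 2)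
          (((hdev.pow 4).const_mul 8).add (BddMeas.const _)) _ _
    _ ≤ ∫ w, (8 * (2400 * B ^ 8 * C₀ ^ 2 * (k / n) ^ 2) + 128 * B ^ 8 * C₀ ^ 2 * (k / n) ^ 2)
          ∂P := by
        refine integral_mono ((BddMeas.integral_left (F := fun z w =>
            8 * kernelDev P κ Y z w ^ 4 + 128 * B ^ 8 * C₀ ^ 2 * (k / n) ^ 2)
          (((hdev.pow 4).const_mul 8).add (BddMeas.const _)) _).integrable P)
          (integrable_const _) fun w => ?_
        have hw : BddMeas fun z : Fin n → Ω => kernelDev P κ Y z w :=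
          hdev.mk_left (F := fun z x => kernelDev P κ Y z x) w
        simp only
        rw [integral_add (((hw.pow 4).const_mul 8).integrable _) (integrable_const _),
          integral_const_mul]
        simp only [integral_const, probReal_univ, one_smul]
        linarith [hfix w]
    _ ≤ _ := by
        simp only [integral_const, probReal_univ, one_smul]
        have : 0 ≤ B ^ 8 * C₀ ^ 2 * (k / n) ^ 2 := by positivity
        linarith

/-- The average of the product of the stochastic errors of two kernel estimators, by the
Cauchy-Schwarz inequality and the fourth moments of the errors. -/
lemma KernelBound.integral_avg_dev_mul_dev_sq_le (hκ : KernelBound P κ B k)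
    (hκ' : KernelBound P κ' B k) (hn : 0 < n) (hA : BddMeas A) (hAB : ∀ x, |A x| ≤ B)
    (hY : BddMeas Y) (hYB : ∀ x, |Y x| ≤ B) (hB : 1 ≤ B) (hk : 1 ≤ k) (hC₀ : 1 ≤ C₀)
    (hkn : k ≤ C₀ * n) :
    ∫ z, ((1 / (n : ℝ)) * ∑ i, kernelDev P κ A z (z i) * kernelDev P κ' Y z (z i)) ^ 2
      ∂sampleLaw P n ≤ 20000 * B ^ 8 * C₀ ^ 2 * (k / n) ^ 2 := by
  have hn' : (0 : ℝ) < n := by exact_mod_cast hn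
  have hu : ∀ i, BddMeas fun z : Fin n → Ω => kernelDev P κ A z (z i) := hκ.bdd_dev_eval hA
  have hv : ∀ i, BddMeas fun z : Fin n → Ω => kernelDev P κ' Y z (z i) := hκ'.bdd_dev_eval hY
  calc _ ≤ ∫ z, (1 / (n : ℝ)) * ∑ i, (1 / 2) * (kernelDev P κ A z (z i) ^ 4 +
        kernelDev P κ' Y z (z i) ^ 4) ∂sampleLaw P n := by
        refine integral_mono
          ((((BddMeas.sum _ fun i _ => (hu i).mul (hv i)).const_mul _).pow 2).integrable _)
          (((BddMeas.sum _ fun i _ => (((hu i).pow 4).add ((hv i).pow 4)).const_mul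
            (1 / 2)).const_mul _).integrable _) fun z => ?_
        have h1 := sq_sum_le_card_mul_sum_sq (s := (Finset.univ : Finset (Fin n)))
          (f := fun i => kernelDev P κ A z (z i) * kernelDev P κ' Y z (z i))
        simp only [Finset.card_univ, Fintype.card_fin] at h1
        have h2 : ∑ i, (kernelDev P κ A z (z i) * kernelDev P κ' Y z (z i)) ^ 2 ≤
            ∑ i, (1 / 2) * (kernelDev P κ A z (z i) ^ 4 + kernelDev P κ' Y z (z i) ^ 4) :=
          Finset.sum_le_sum fun i _ => by
            nlinarith [sq_nonneg (kernelDev P κ A z (z i) ^ 2 - kernelDev P κ' Y z (z i) ^ 2)]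
        simp only [mul_pow (1 / (n : ℝ))]
        calc _ ≤ (1 / (n : ℝ)) ^ 2 *
              (n * ∑ i, (kernelDev P κ A z (z i) * kernelDev P κ' Y z (z i)) ^ 2) := by gcongr
          _ = (1 / (n : ℝ)) * ∑ i, (kernelDev P κ A z (z i) * kernelDev P κ' Y z (z i)) ^ 2 := by
              field_simp
          _ ≤ _ := by gcongr
    _ ≤ (1 / (n : ℝ)) * ∑ i : Fin n, 20000 * B ^ 8 * C₀ ^ 2 * (k / n) ^ 2 := by
        rw [integral_const_mul, integral_finsetSum _ fun i _ =>
          ((((hu i).pow 4).add ((hv i).pow 4)).const_mul (1 / 2)).integrable _]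
        refine mul_le_mul_of_nonneg_left (Finset.sum_le_sum fun i _ => ?_) (by positivity)
        rw [integral_const_mul, integral_add (((hu i).pow 4).integrable _)
          (((hv i).pow 4).integrable _)]
        have h1 := hκ.integral_dev_pow_four_le hn hA hAB hB hk hC₀ hkn i
        have h2 := hκ'.integral_dev_pow_four_le hn hY hYB hB hk hC₀ hkn i
        linarith
    _ = _ := by
        simp only [Finset.sum_const, Finset.card_univ, Fintype.card_fin, nsmul_eq_mul]
        field_simp

end Upper
end

/-! ### Risk bounds for kernel estimators of a covariance -/

section

section UpperRisk

variable {Ω : Type*} [MeasurableSpace Ω] {P : Measure Ω} [IsProbabilityMeasure P] {n : ℕ}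
  {κ κ' : Ω → Ω → ℝ} {A Y : Ω → ℝ} {B k C₀ ψ δ : ℝ}

lemma BddMeas.avg {f : Ω → ℝ} (hf : BddMeas f) (n : ℕ) :
    BddMeas fun z : Fin n → Ω => (1 / (n : ℝ)) * ∑ i, f (z i) :=
  (BddMeas.sum _ fun i _ => hf.comp (measurable_pi_apply i)).const_mul _

/-- The risk of the plug-in estimator that subtracts the average of `A` times the kernel estimator
of the regression function of `Y` from the average of `A Y`: the variance of an average, the
interaction of `A` with the stochastic error, and the bias. -/
lemma KernelBound.risk_plugin_le (hκ : KernelBound P κ B k) (hn : 0 < n) (hA : BddMeas A)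
    (hAB : ∀ x, |A x| ≤ B) (hY : BddMeas Y) (hYB : ∀ x, |Y x| ≤ B) (hB : 1 ≤ B) (hk : 1 ≤ k)
    (hδ : |∫ w, A w * (Y w - kernelMean P κ Y w) ∂P - ψ| ≤ δ) :
    ∫ z, ((1 / (n : ℝ)) * ∑ i, A (z i) * Y (z i) -
        (1 / (n : ℝ)) * ∑ i, A (z i) * kernelEst κ Y z (z i) - ψ) ^ 2 ∂sampleLaw P n ≤
      100 * B ^ 6 * (1 / n + (k / n) ^ 2 + δ ^ 2) := by
  have hn' : (0 : ℝ) < n := by exact_mod_cast hn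
  have hm := hκ.bdd_mean hY
  let f : Ω → ℝ := fun w => A w * (Y w - kernelMean P κ Y w)
  have hf : BddMeas f := hA.mul (hY.sub hm)
  have hfB : ∀ x, |f x| ≤ 2 * B ^ 3 := by
    intro x
    simp only [f, abs_mul]
    calc |A x| * |Y x - kernelMean P κ Y x| ≤ B * (B + B ^ 2) := by
          refine mul_le_mul (hAB x) ((abs_sub _ _).trans (add_le_add (hYB x)
            (hκ.abs_mean_le hY hYB x))) (abs_nonneg _) (by linarith)
      _ ≤ 2 * B ^ 3 := by nlinarith [sq_nonneg B]
  let X : (Fin n → Ω) → ℝ := fun z => (1 / (n : ℝ)) * ∑ i, f (z i) - ∫ w, f w ∂P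
  let Q : (Fin n → Ω) → ℝ := fun z => (1 / (n : ℝ)) * ∑ i, A (z i) * kernelDev P κ Y z (z i)
  have hX : BddMeas X := (hf.avg n).sub (BddMeas.const _)
  have hQ : BddMeas Q := (BddMeas.sum _ fun i _ => (hA.comp (measurable_pi_apply i)).mul
    (hκ.bdd_dev_eval hY i)).const_mul _
  have hX2 : ∫ z, X z ^ 2 ∂sampleLaw P n ≤ (2 * B ^ 3) ^ 2 / n :=
    integral_avg_sub_sq_le P hn hf hfB
  have hQ2 : ∫ z, Q z ^ 2 ∂sampleLaw P n ≤ 24 * B ^ 2 * B ^ 4 * (1 / n + (k / n) ^ 2) :=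
    hκ.integral_avg_mul_dev_sq_le hn hY hYB hB hk hA hAB
  set e := ∫ w, f w ∂P - ψ with he
  have hdec : ∀ z : Fin n → Ω, (1 / (n : ℝ)) * ∑ i, A (z i) * Y (z i) -
        (1 / (n : ℝ)) * ∑ i, A (z i) * kernelEst κ Y z (z i) - ψ = X z - Q z + e := by
    intro z
    simp only [X, Q, f, he, kernelDev, mul_sub, Finset.sum_sub_distrib]
    ring
  simp_rw [hdec]
  have he2 : e ^ 2 ≤ δ ^ 2 := by rw [← sq_abs]; exact pow_le_pow_left₀ (abs_nonneg _) hδ 2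
  calc ∫ z, (X z - Q z + e) ^ 2 ∂sampleLaw P n
      ≤ ∫ z, (3 * X z ^ 2 + 3 * Q z ^ 2 + 3 * e ^ 2) ∂sampleLaw P n := by
        refine integral_mono (((hX.sub hQ).add (BddMeas.const _)).pow 2 |>.integrable _)
          (((((hX.pow 2).const_mul 3).add ((hQ.pow 2).const_mul 3)).add
            (BddMeas.const _)).integrable _) fun z => ?_
        simp only
        nlinarith [sq_nonneg (X z + Q z), sq_nonneg (X z - e), sq_nonneg (Q z + e)]
    _ = 3 * ∫ z, X z ^ 2 ∂sampleLaw P n + 3 * ∫ z, Q z ^ 2 ∂sampleLaw P n + 3 * e ^ 2 := by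
        rw [integral_add ((((hX.pow 2).const_mul 3).add ((hQ.pow 2).const_mul 3)).integrable _)
          (integrable_const _), integral_add (((hX.pow 2).const_mul 3).integrable _)
          (((hQ.pow 2).const_mul 3).integrable _), integral_const_mul, integral_const_mul]
        simp
    _ ≤ 3 * ((2 * B ^ 3) ^ 2 / n) + 3 * (24 * B ^ 2 * B ^ 4 * (1 / n + (k / n) ^ 2)) +
          3 * δ ^ 2 := by gcongr
    _ ≤ _ := by
        have h1 : 3 * ((2 * B ^ 3) ^ 2 / (n : ℝ)) = 12 * B ^ 6 * (1 / n) := by ring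
        have hB6 : 1 ≤ B ^ 6 := one_le_pow₀ hB
        have h2 : δ ^ 2 ≤ B ^ 6 * δ ^ 2 := le_mul_of_one_le_left (sq_nonneg _) hB6
        have h3 : 0 ≤ B ^ 6 * (1 / (n : ℝ)) := by positivity
        have h4 : 0 ≤ B ^ 6 * (k / (n : ℝ)) ^ 2 := by positivity
        rw [h1]
        nlinarith

/-- The risk of an estimator that is an average plus weighted averages of the stochastic errors of
the kernel estimators plus or minus the average of their product. -/
lemma KernelBound.risk_third_order_le (hκ : KernelBound P κ B k) (hκ' : KernelBound P κ' B k)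
    (hn : 0 < n) (hA : BddMeas A) (hAB : ∀ x, |A x| ≤ B) (hY : BddMeas Y) (hYB : ∀ x, |Y x| ≤ B)
    (hB : 1 ≤ B) (hk : 1 ≤ k) (hC₀ : 1 ≤ C₀) (hkn : k ≤ C₀ * n) {f G G' : Ω → ℝ} (hf : BddMeas f)
    (hfB : ∀ x, |f x| ≤ 4 * B ^ 4) (hG : BddMeas G) (hGB : ∀ x, |G x| ≤ 2 * B ^ 2)
    (hG' : BddMeas G') (hGB' : ∀ x, |G' x| ≤ 2 * B ^ 2) (hδ : |∫ w, f w ∂P - ψ| ≤ δ) {σ : ℝ}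
    (hσ : σ ^ 2 = 1) {T : (Fin n → Ω) → ℝ}
    (hT : ∀ z, T z = (1 / (n : ℝ)) * ∑ i, f (z i) -
      (1 / (n : ℝ)) * ∑ i, G (z i) * kernelDev P κ' Y z (z i) -
      (1 / (n : ℝ)) * ∑ i, G' (z i) * kernelDev P κ A z (z i) +
      σ * ((1 / (n : ℝ)) * ∑ i, kernelDev P κ A z (z i) * kernelDev P κ' Y z (z i))) :
    ∫ z, (T z - ψ) ^ 2 ∂sampleLaw P n ≤
      110000 * B ^ 8 * C₀ ^ 2 * (1 / n + (k / n) ^ 2 + δ ^ 2) := by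
  have hn' : (0 : ℝ) < n := by exact_mod_cast hn
  let X : (Fin n → Ω) → ℝ := fun z => (1 / (n : ℝ)) * ∑ i, f (z i) - ∫ w, f w ∂P
  let Q : (Fin n → Ω) → ℝ := fun z => (1 / (n : ℝ)) * ∑ i, G (z i) * kernelDev P κ' Y z (z i)
  let Q' : (Fin n → Ω) → ℝ := fun z => (1 / (n : ℝ)) * ∑ i, G' (z i) * kernelDev P κ A z (z i)
  let R : (Fin n → Ω) → ℝ := fun z =>
    (1 / (n : ℝ)) * ∑ i, kernelDev P κ A z (z i) * kernelDev P κ' Y z (z i)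
  have hX : BddMeas X := (hf.avg n).sub (BddMeas.const _)
  have hQ : BddMeas Q := (BddMeas.sum _ fun i _ => (hG.comp (measurable_pi_apply i)).mul
    (hκ'.bdd_dev_eval hY i)).const_mul _
  have hQ' : BddMeas Q' := (BddMeas.sum _ fun i _ => (hG'.comp (measurable_pi_apply i)).mul
    (hκ.bdd_dev_eval hA i)).const_mul _
  have hR : BddMeas R := (BddMeas.sum _ fun i _ => (hκ.bdd_dev_eval hA i).mul
    (hκ'.bdd_dev_eval hY i)).const_mul _
  have hX2 : ∫ z, X z ^ 2 ∂sampleLaw P n ≤ (4 * B ^ 4) ^ 2 / n :=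
    integral_avg_sub_sq_le P hn hf hfB
  have hQ2 : ∫ z, Q z ^ 2 ∂sampleLaw P n ≤
      24 * (2 * B ^ 2) ^ 2 * B ^ 4 * (1 / n + (k / n) ^ 2) :=
    hκ'.integral_avg_mul_dev_sq_le hn hY hYB hB hk hG hGB
  have hQ2' : ∫ z, Q' z ^ 2 ∂sampleLaw P n ≤
      24 * (2 * B ^ 2) ^ 2 * B ^ 4 * (1 / n + (k / n) ^ 2) :=
    hκ.integral_avg_mul_dev_sq_le hn hA hAB hB hk hG' hGB'
  have hR2 : ∫ z, R z ^ 2 ∂sampleLaw P n ≤ 20000 * B ^ 8 * C₀ ^ 2 * (k / n) ^ 2 :=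
    hκ.integral_avg_dev_mul_dev_sq_le hκ' hn hA hAB hY hYB hB hk hC₀ hkn
  set e := ∫ w, f w ∂P - ψ with he
  have hdec : ∀ z : Fin n → Ω, T z - ψ = X z - Q z - Q' z + σ * R z + e := by
    intro z
    rw [hT]
    simp only [X, Q, Q', R, he]
    ring
  simp_rw [hdec]
  have he2 : e ^ 2 ≤ δ ^ 2 := by rw [← sq_abs]; exact pow_le_pow_left₀ (abs_nonneg _) hδ 2
  calc ∫ z, (X z - Q z - Q' z + σ * R z + e) ^ 2 ∂sampleLaw P n
      ≤ ∫ z, (5 * X z ^ 2 + 5 * Q z ^ 2 + 5 * Q' z ^ 2 + 5 * R z ^ 2 + 5 * e ^ 2)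
          ∂sampleLaw P n := by
        refine integral_mono
          (((((hX.sub hQ).sub hQ').add (hR.const_mul σ)).add (BddMeas.const _)).pow 2
            |>.integrable _)
          (((((((hX.pow 2).const_mul 5).add ((hQ.pow 2).const_mul 5)).add
            ((hQ'.pow 2).const_mul 5)).add ((hR.pow 2).const_mul 5)).add
            (BddMeas.const _)).integrable _) fun z => ?_
        have h : ∀ a b c r e : ℝ, (a - b - c + σ * r + e) ^ 2 ≤
            5 * a ^ 2 + 5 * b ^ 2 + 5 * c ^ 2 + 5 * r ^ 2 + 5 * e ^ 2 := by
          intro a b c r e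
          have h5 : r ^ 2 = (σ * r) ^ 2 := by rw [mul_pow, hσ, one_mul]
          rw [h5]
          generalize σ * r = r'
          nlinarith [sq_nonneg (a + b), sq_nonneg (a + c), sq_nonneg (a - r'), sq_nonneg (a - e),
            sq_nonneg (b - c), sq_nonneg (b + r'), sq_nonneg (b + e), sq_nonneg (c + r'),
            sq_nonneg (c + e), sq_nonneg (r' - e)]
        exact h _ _ _ _ _
    _ = 5 * ∫ z, X z ^ 2 ∂sampleLaw P n + 5 * ∫ z, Q z ^ 2 ∂sampleLaw P n +
          5 * ∫ z, Q' z ^ 2 ∂sampleLaw P n + 5 * ∫ z, R z ^ 2 ∂sampleLaw P n + 5 * e ^ 2 := by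
        have h1 := (hX.pow 2).const_mul 5
        have h2 := (hQ.pow 2).const_mul 5
        have h3 := (hQ'.pow 2).const_mul 5
        have h4 := (hR.pow 2).const_mul 5
        rw [integral_add ((((h1.add h2).add h3).add h4).integrable _) (integrable_const _),
          integral_add (((h1.add h2).add h3).integrable _) (h4.integrable _),
          integral_add ((h1.add h2).integrable _) (h3.integrable _),
          integral_add (h1.integrable _) (h2.integrable _)]
        simp [integral_const_mul]
    _ ≤ 5 * ((4 * B ^ 4) ^ 2 / n) + 5 * (24 * (2 * B ^ 2) ^ 2 * B ^ 4 * (1 / n + (k / n) ^ 2)) +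
          5 * (24 * (2 * B ^ 2) ^ 2 * B ^ 4 * (1 / n + (k / n) ^ 2)) +
          5 * (20000 * B ^ 8 * C₀ ^ 2 * (k / n) ^ 2) + 5 * δ ^ 2 := by gcongr
    _ = B ^ 8 * (1040 * (1 / n)) + B ^ 8 * (960 * (k / n) ^ 2) +
          100000 * (B ^ 8 * C₀ ^ 2 * (k / n) ^ 2) + 5 * δ ^ 2 := by ring
    _ ≤ _ := by
        have hB8 : 1 ≤ B ^ 8 := one_le_pow₀ hB
        have hC2 : 1 ≤ C₀ ^ 2 := one_le_pow₀ hC₀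
        have hM : 1 ≤ B ^ 8 * C₀ ^ 2 := one_le_mul_of_one_le_of_one_le hB8 hC2
        have hBM : B ^ 8 ≤ B ^ 8 * C₀ ^ 2 := le_mul_of_one_le_right (by positivity) hC2
        have h1 : δ ^ 2 ≤ B ^ 8 * C₀ ^ 2 * δ ^ 2 := le_mul_of_one_le_left (sq_nonneg _) hM
        have h3 : B ^ 8 * (1 / (n : ℝ)) ≤ B ^ 8 * C₀ ^ 2 * (1 / n) :=
          mul_le_mul_of_nonneg_right hBM (by positivity)
        have h4 : B ^ 8 * (k / (n : ℝ)) ^ 2 ≤ B ^ 8 * C₀ ^ 2 * (k / n) ^ 2 :=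
          mul_le_mul_of_nonneg_right hBM (by positivity)
        have h5 : 0 ≤ B ^ 8 * C₀ ^ 2 * (1 / (n : ℝ)) := by positivity
        have h6 : 0 ≤ B ^ 8 * C₀ ^ 2 * (k / (n : ℝ)) ^ 2 := by positivity
        have h7 : 0 ≤ B ^ 8 * C₀ ^ 2 * δ ^ 2 := by positivity
        nlinarith

/-- The risk of the Monte Carlo plug-in estimator. -/
lemma KernelBound.risk_monteCarlo_le (hκ : KernelBound P κ B k) (hκ' : KernelBound P κ' B k)
    (hn : 0 < n) (hA : BddMeas A) (hAB : ∀ x, |A x| ≤ B) (hY : BddMeas Y) (hYB : ∀ x, |Y x| ≤ B)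
    (hB : 1 ≤ B) (hk : 1 ≤ k) (hC₀ : 1 ≤ C₀) (hkn : k ≤ C₀ * n)
    (hδ : |∫ w, (A w * Y w - kernelMean P κ A w * kernelMean P κ' Y w) ∂P - ψ| ≤ δ) :
    ∫ z, ((1 / (n : ℝ)) * ∑ i, A (z i) * Y (z i) -
        (1 / (n : ℝ)) * ∑ i, kernelEst κ A z (z i) * kernelEst κ' Y z (z i) - ψ) ^ 2
          ∂sampleLaw P n ≤
      110000 * B ^ 8 * C₀ ^ 2 * (1 / n + (k / n) ^ 2 + δ ^ 2) := by
  have hmA := hκ.abs_mean_le hA hAB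
  have hmY := hκ'.abs_mean_le hY hYB
  have hB2 : 0 ≤ B ^ 2 := sq_nonneg B
  refine hκ.risk_third_order_le hκ' hn hA hAB hY hYB hB hk hC₀ hkn
    (f := fun w => A w * Y w - kernelMean P κ A w * kernelMean P κ' Y w)
    ((hA.mul hY).sub ((hκ.bdd_mean hA).mul (hκ'.bdd_mean hY))) (fun x => ?_)
    (G := kernelMean P κ A) (hκ.bdd_mean hA) (fun x => (hmA x).trans (by linarith))
    (G' := kernelMean P κ' Y) (hκ'.bdd_mean hY) (fun x => (hmY x).trans (by linarith)) hδ
    (σ := -1) (by norm_num) fun z => ?_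
  · refine (abs_sub _ _).trans ?_
    rw [abs_mul, abs_mul]
    have h1 := mul_le_mul (hAB x) (hYB x) (abs_nonneg _) (by linarith)
    have h2 := mul_le_mul (hmA x) (hmY x) (abs_nonneg _) hB2
    have h3 : B ^ 2 ≤ B ^ 4 := pow_le_pow_right₀ hB (by norm_num)
    nlinarith
  · have e : ∀ i, A (z i) * Y (z i) - kernelMean P κ A (z i) * kernelMean P κ' Y (z i) -
        kernelMean P κ A (z i) * kernelDev P κ' Y z (z i) -
        kernelMean P κ' Y (z i) * kernelDev P κ A z (z i) -
        kernelDev P κ A z (z i) * kernelDev P κ' Y z (z i) = A (z i) * Y (z i) -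
        kernelEst κ A z (z i) * kernelEst κ' Y z (z i) := by
      intro i; unfold kernelDev; ring
    rw [← mul_sub, ← Finset.sum_sub_distrib, ← Finset.sum_congr rfl fun i _ => e i]
    simp only [Finset.sum_sub_distrib]
    ring

/-- The risk of the influence function based estimator. -/
lemma KernelBound.risk_influence_le (hκ : KernelBound P κ B k) (hκ' : KernelBound P κ' B k)
    (hn : 0 < n) (hA : BddMeas A) (hAB : ∀ x, |A x| ≤ B) (hY : BddMeas Y) (hYB : ∀ x, |Y x| ≤ B)
    (hB : 1 ≤ B) (hk : 1 ≤ k) (hC₀ : 1 ≤ C₀) (hkn : k ≤ C₀ * n)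
    (hδ : |∫ w, (A w - kernelMean P κ A w) * (Y w - kernelMean P κ' Y w) ∂P - ψ| ≤ δ) :
    ∫ z, ((1 / (n : ℝ)) * ∑ i, (A (z i) - kernelEst κ A z (z i)) *
        (Y (z i) - kernelEst κ' Y z (z i)) - ψ) ^ 2 ∂sampleLaw P n ≤
      110000 * B ^ 8 * C₀ ^ 2 * (1 / n + (k / n) ^ 2 + δ ^ 2) := by
  have hmA := hκ.abs_mean_le hA hAB
  have hmY := hκ'.abs_mean_le hY hYB
  have hBB : B ≤ B ^ 2 := by nlinarith
  have hGA : ∀ x, |A x - kernelMean P κ A x| ≤ 2 * B ^ 2 := fun x =>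
    (abs_sub _ _).trans (by linarith [hAB x, hmA x])
  have hGY : ∀ x, |Y x - kernelMean P κ' Y x| ≤ 2 * B ^ 2 := fun x =>
    (abs_sub _ _).trans (by linarith [hYB x, hmY x])
  have hbA := hA.sub (hκ.bdd_mean hA)
  have hbY := hY.sub (hκ'.bdd_mean hY)
  refine hκ.risk_third_order_le hκ' hn hA hAB hY hYB hB hk hC₀ hkn
    (f := fun w => (A w - kernelMean P κ A w) * (Y w - kernelMean P κ' Y w))
    (hbA.mul hbY) (fun x => ?_) hbA hGA hbY hGY hδ (σ := 1) (by norm_num) fun z => ?_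
  · rw [abs_mul]
    refine (mul_le_mul (hGA x) (hGY x) (abs_nonneg _) (by positivity)).trans_eq ?_
    ring
  · have e : ∀ i, (A (z i) - kernelMean P κ A (z i)) * (Y (z i) - kernelMean P κ' Y (z i)) -
        (A (z i) - kernelMean P κ A (z i)) * kernelDev P κ' Y z (z i) -
        (Y (z i) - kernelMean P κ' Y (z i)) * kernelDev P κ A z (z i) +
        kernelDev P κ A z (z i) * kernelDev P κ' Y z (z i) =
        (A (z i) - kernelEst κ A z (z i)) * (Y (z i) - kernelEst κ' Y z (z i)) := by
      intro i; unfold kernelDev; ring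
    rw [← Finset.sum_congr rfl fun i _ => e i]
    simp only [Finset.sum_sub_distrib, Finset.sum_add_distrib]
    ring

/-- The second-order U-statistic: the diagonal terms of the plug-in estimator are left out, which
removes the part of the bias that is of order `k / n`. -/
def uStat (κ : Ω → Ω → ℝ) (A Y : Ω → ℝ) (z : Fin n → Ω) : ℝ :=
  (1 / (n : ℝ)) * ∑ i, A (z i) * Y (z i) - (1 / ((n : ℝ) * (n - 1))) *
    ∑ i, ∑ l, if i = l then 0 else A (z i) * (Y (z l) * κ (z l) (z i))

/-- The risk of the U-statistic has `k / n ^ 2` in the place of `(k / n) ^ 2`, so that higher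
resolutions are affordable. -/
lemma KernelBound.risk_uStat_le (hκ : KernelBound P κ B k) (hn : 2 ≤ n) (hA : BddMeas A)
    (hAB : ∀ x, |A x| ≤ B) (hY : BddMeas Y) (hYB : ∀ x, |Y x| ≤ B) (hB : 1 ≤ B) (hk : 1 ≤ k)
    (hδ : |∫ w, A w * (Y w - kernelMean P κ Y w) ∂P - ψ| ≤ δ) :
    ∫ z, (uStat κ A Y z - ψ) ^ 2 ∂sampleLaw P n ≤
      100 * B ^ 6 * (1 / n + k / n ^ 2 + δ ^ 2) := by
  have hn2 : (2 : ℝ) ≤ n := by exact_mod_cast hn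
  have hn' : (0 : ℝ) < n := by linarith
  have hn1 : (0 : ℝ) < (n : ℝ) - 1 := by linarith
  have hm := hκ.bdd_mean hY
  let f : Ω → ℝ := fun w => A w * (Y w - kernelMean P κ Y w)
  have hf : BddMeas f := hA.mul (hY.sub hm)
  have hfB : ∀ x, |f x| ≤ 2 * B ^ 3 := by
    intro x
    simp only [f, abs_mul]
    calc |A x| * |Y x - kernelMean P κ Y x| ≤ B * (B + B ^ 2) := by
          refine mul_le_mul (hAB x) ((abs_sub _ _).trans (add_le_add (hYB x)
            (hκ.abs_mean_le hY hYB x))) (abs_nonneg _) (by linarith)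
      _ ≤ 2 * B ^ 3 := by nlinarith [sq_nonneg B]
  let X : (Fin n → Ω) → ℝ := fun z => (1 / (n : ℝ)) * ∑ i, f (z i) - ∫ w, f w ∂P
  let O : (Fin n → Ω) → ℝ := fun z => ∑ i, ∑ l, if i = l then 0 else
      A (z i) * (Y (z l) * κ (z l) (z i) - kernelMean P κ Y (z i))
  let r : ℝ := 1 / ((n : ℝ) * (n - 1))
  have hX : BddMeas X := (hf.avg n).sub (BddMeas.const _)
  have hO : BddMeas O := by
    refine BddMeas.sum _ fun i _ => BddMeas.sum _ fun l _ => ?_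
    split_ifs
    · exact BddMeas.const 0
    · exact (hA.comp (measurable_pi_apply i)).mul (((hκ.bdd_mul hY).comp₂
        (F := fun w x => Y w * κ w x) (measurable_pi_apply l) (measurable_pi_apply i)).sub
        (hm.comp (measurable_pi_apply i)))
  have hX2 : ∫ z, X z ^ 2 ∂sampleLaw P n ≤ (2 * B ^ 3) ^ 2 / n :=
    integral_avg_sub_sq_le P (by omega) hf hfB
  have hO2 : ∫ z, O z ^ 2 ∂sampleLaw P n ≤
      n ^ 3 * (2 * B ^ 2 * B) ^ 2 + 2 * n ^ 2 * (B ^ 2 * (B ^ 4 * k)) :=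
    hκ.integral_offDiag_le hY hYB (by linarith) hA hAB
  have hr : r ^ 2 ≤ 4 / n ^ 4 := by
    simp only [r, div_pow, one_pow, mul_pow]
    rw [div_le_div_iff₀ (by positivity) (by positivity)]
    have : (n : ℝ) ^ 2 ≤ 4 * (n - 1) ^ 2 := by nlinarith
    nlinarith [mul_le_mul_of_nonneg_left this (sq_nonneg (n : ℝ))]
  set e := ∫ w, f w ∂P - ψ with he
  have hdec : ∀ z : Fin n → Ω, uStat κ A Y z - ψ = X z - r * O z + e := by
    intro z
    have h1 : O z = (∑ i, ∑ l, if i = l then 0 else A (z i) * (Y (z l) * κ (z l) (z i))) -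
        (n - 1) * ∑ i, A (z i) * kernelMean P κ Y (z i) := by
      simp only [O]
      rw [Finset.mul_sum, ← Finset.sum_sub_distrib]
      refine Finset.sum_congr rfl fun i _ => ?_
      have h2 : ((n : ℝ) - 1) * (A (z i) * kernelMean P κ Y (z i)) =
          ∑ l, if i = l then 0 else A (z i) * kernelMean P κ Y (z i) := by
        have h3 : ∀ l, (if i = l then 0 else A (z i) * kernelMean P κ Y (z i)) =
            A (z i) * kernelMean P κ Y (z i) -
              if i = l then A (z i) * kernelMean P κ Y (z i) else 0 := by
          intro l; split_ifs <;> ring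
        simp_rw [h3, Finset.sum_sub_distrib]
        simp
        ring
      rw [h2, ← Finset.sum_sub_distrib]
      refine Finset.sum_congr rfl fun l _ => ?_
      split_ifs <;> ring
    have h4 : r * ((n - 1) * ∑ i, A (z i) * kernelMean P κ Y (z i)) =
        1 / (n : ℝ) * ∑ i, A (z i) * kernelMean P κ Y (z i) := by
      simp only [r]; field_simp
    have h5 : ∑ i, f (z i) = ∑ i, A (z i) * Y (z i) - ∑ i, A (z i) * kernelMean P κ Y (z i) := by
      simp only [f, mul_sub, Finset.sum_sub_distrib]
    rw [h1, mul_sub r, h4]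
    simp only [uStat, X, he]
    rw [h5]
    ring
  simp_rw [hdec]
  have he2 : e ^ 2 ≤ δ ^ 2 := by rw [← sq_abs]; exact pow_le_pow_left₀ (abs_nonneg _) hδ 2
  calc ∫ z, (X z - r * O z + e) ^ 2 ∂sampleLaw P n
      ≤ ∫ z, (3 * X z ^ 2 + (3 * r ^ 2) * O z ^ 2 + 3 * e ^ 2) ∂sampleLaw P n := by
        refine integral_mono (((hX.sub (hO.const_mul r)).add (BddMeas.const _)).pow 2
          |>.integrable _) (((((hX.pow 2).const_mul 3).add ((hO.pow 2).const_mul _)).add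
            (BddMeas.const _)).integrable _) fun z => ?_
        simp only
        nlinarith [sq_nonneg (X z + r * O z), sq_nonneg (X z - e), sq_nonneg (r * O z + e)]
    _ = 3 * ∫ z, X z ^ 2 ∂sampleLaw P n + (3 * r ^ 2) * ∫ z, O z ^ 2 ∂sampleLaw P n +
          3 * e ^ 2 := by
        rw [integral_add ((((hX.pow 2).const_mul 3).add ((hO.pow 2).const_mul _)).integrable _)
          (integrable_const _), integral_add (((hX.pow 2).const_mul 3).integrable _)
          (((hO.pow 2).const_mul _).integrable _), integral_const_mul, integral_const_mul]
        simp
    _ ≤ 3 * ((2 * B ^ 3) ^ 2 / n) + (3 * (4 / n ^ 4)) *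
          (n ^ 3 * (2 * B ^ 2 * B) ^ 2 + 2 * n ^ 2 * (B ^ 2 * (B ^ 4 * k))) +
          3 * δ ^ 2 := by gcongr
    _ = B ^ 6 * (60 * (1 / n)) + B ^ 6 * (24 * (k / n ^ 2)) + 3 * δ ^ 2 := by
        field_simp
        ring
    _ ≤ _ := by
        have hB6 : 1 ≤ B ^ 6 := one_le_pow₀ hB
        have h2 : δ ^ 2 ≤ B ^ 6 * δ ^ 2 := le_mul_of_one_le_left (sq_nonneg _) hB6
        have h3 : 0 ≤ B ^ 6 * (1 / (n : ℝ)) := by positivity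
        have h4 : 0 ≤ B ^ 6 * (k / (n : ℝ) ^ 2) := by positivity
        nlinarith

end UpperRisk
end

/-! ### The projection kernels under the laws in the model -/

section

variable {d : ℕ} {W : CDVData} {S : ℕ}

lemma measurable_covX : Measurable (covX (d := d)) := measurable_fst

lemma measurable_varA : Measurable (varA (d := d)) := measurable_fst.comp measurable_snd

lemma measurable_varY : Measurable (varY (d := d)) := measurable_snd.comp measurable_snd

lemma sigmaX_le : sigmaX d ≤ (inferInstance : MeasurableSpace (Obs d)) := measurable_covX.comap_le

namespace CDVData

lemma IsCDV.bddMeas_kernelC (hW : W.IsCDV S) (j : ℕ) :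
    BddMeas fun q : (Fin d → ℝ) × (Fin d → ℝ) => W.kernelC j q.1 q.2 := by
  obtain ⟨C, -, hC⟩ := hW.exists_kernelC_le d
  exact ⟨(hW.continuous_kernelC j).measurable, C * 2 ^ (j * d), fun q => hC j q.1 q.2⟩

lemma IsCDV.bddMeas_kernelC_mul (hW : W.IsCDV S) (j : ℕ) {f : (Fin d → ℝ) → ℝ} (hf : BddMeas f) :
    BddMeas fun q : (Fin d → ℝ) × (Fin d → ℝ) => W.kernelC j q.1 q.2 * f q.2 :=
  (hW.bddMeas_kernelC j).mul (hf.comp measurable_snd)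

lemma IsCDV.bddMeas_proj (hW : W.IsCDV S) (j : ℕ) {f : (Fin d → ℝ) → ℝ} (hf : BddMeas f) :
    BddMeas (W.proj j f) :=
  BddMeas.integral_right (F := fun x y => W.kernelC j x y * f y) (hW.bddMeas_kernelC_mul j hf) _

/-- The projections are self-adjoint. -/
lemma IsCDV.integral_proj_mul (hW : W.IsCDV S) (j : ℕ) {f g : (Fin d → ℝ) → ℝ} (hf : BddMeas f)
    (hg : BddMeas g) : ∫ x, W.proj j f x * g x ∂cubeMeasure d =
      ∫ x, f x * W.proj j g x ∂cubeMeasure d := by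
  have h := BddMeas.integral_swap (F := fun x y => W.kernelC j x y * f y * g x)
    ((hW.bddMeas_kernelC_mul j hf).mul (hg.comp measurable_fst)) (cubeMeasure d) (cubeMeasure d)
  simp_rw [integral_mul_const] at h
  unfold proj
  rw [h]
  congr 1; ext y
  rw [← integral_const_mul]
  congr 1; ext x
  rw [kernelC_comm j x y]; ring

/-- The composition of two projections is the coarser one. -/
lemma IsCDV.proj_proj (hW : W.IsCDV S) {j l : ℕ} (hj : W.J₀ ≤ j) (hl : W.J₀ ≤ l)
    {f : (Fin d → ℝ) → ℝ} (hf : BddMeas f) (x : Fin d → ℝ) :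
    W.proj j (W.proj l f) x = W.proj (min j l) f x := by
  have h := BddMeas.integral_swap (F := fun y z => W.kernelC j x y * (W.kernelC l y z * f z))
    (((hW.bddMeas_kernelC j).comp₂ (F := fun y z => W.kernelC j y z) measurable_const
      measurable_fst).mul (hW.bddMeas_kernelC_mul l hf)) (cubeMeasure d) (cubeMeasure d)
  simp_rw [integral_const_mul, ← mul_assoc, integral_mul_const,
    hW.integral_kernelC_kernelC hj hl] at h
  exact h

end CDVData

/-- The variable `A`, moved to the nearest point of `[C₁, C₂]`. -/
def varAc (C₁ C₂ : ℝ) (o : Obs d) : ℝ := max C₁ (min C₂ (varA o))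

/-- The variable `Y`, moved to the nearest point of `[C₁, C₂]`. -/
def varYc (C₁ C₂ : ℝ) (o : Obs d) : ℝ := max C₁ (min C₂ (varY o))

lemma abs_clamp_le {C₁ C₂ B : ℝ} (h₁ : |C₁| ≤ B) (h₂ : |C₂| ≤ B) (a : ℝ) :
    |max C₁ (min C₂ a)| ≤ B := by
  rw [abs_le] at *
  constructor
  · exact h₁.1.trans (le_max_left _ _)
  · exact max_le h₁.2 ((min_le_left _ _).trans h₂.2)

lemma measurable_varAc (C₁ C₂ : ℝ) : Measurable (varAc (d := d) C₁ C₂) :=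
  measurable_const.max (measurable_const.min measurable_varA)

lemma measurable_varYc (C₁ C₂ : ℝ) : Measurable (varYc (d := d) C₁ C₂) :=
  measurable_const.max (measurable_const.min measurable_varY)

lemma bddMeas_varAc (C₁ C₂ : ℝ) : BddMeas (varAc (d := d) C₁ C₂) :=
  ⟨measurable_varAc _ _, max |C₁| |C₂|, fun _ =>
    abs_clamp_le (le_max_left _ _) (le_max_right _ _) _⟩

lemma bddMeas_varYc (C₁ C₂ : ℝ) : BddMeas (varYc (d := d) C₁ C₂) :=
  ⟨measurable_varYc _ _, max |C₁| |C₂|, fun _ =>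
    abs_clamp_le (le_max_left _ _) (le_max_right _ _) _⟩

section Law

variable {P : Measure (Obs d)}

lemma integral_comp_covX (hX : P.map covX = volume.restrict (Icc 0 1)) {f : (Fin d → ℝ) → ℝ}
    (hf : BddMeas f) : ∫ o, f (covX o) ∂P = ∫ x, f x ∂cubeMeasure d := by
  rw [cubeMeasure, ← hX, integral_map measurable_covX.aemeasurable hf.meas.aestronglyMeasurable]

variable [IsProbabilityMeasure P]

/-- If `E[V | X] = r(X)` then `E[V F(X)] = ∫ r F` for bounded weights `F`. -/
lemma integral_mul_comp_covX (hX : P.map covX = volume.restrict (Icc 0 1)) {V : Obs d → ℝ}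
    (hV : Integrable V P) {r F : (Fin d → ℝ) → ℝ} (hr : BddMeas r)
    (hVr : condExp (sigmaX d) P V =ᵐ[P] fun o => r (covX o)) (hF : BddMeas F) :
    ∫ o, V o * F (covX o) ∂P = ∫ x, r x * F x ∂cubeMeasure d := by
  have hFm : StronglyMeasurable[sigmaX d] fun o : Obs d => F (covX o) := by
    refine Measurable.stronglyMeasurable ?_
    exact hF.meas.comp (comap_measurable covX)
  have hVF : Integrable (V * fun o => F (covX o)) P := by
    obtain ⟨C, hC⟩ := hF.bdd
    exact hV.mul_bdd (c := C) (hF.meas.comp measurable_covX).aestronglyMeasurable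
      (ae_of_all _ fun o => hC _)
  have h1 := condExp_mul_of_stronglyMeasurable_right (μ := P) hFm hVF hV
  have h2 := integral_condExp (μ := P) (f := V * fun o => F (covX o)) (sigmaX_le (d := d))
  rw [← integral_comp_covX hX (hr.mul hF)]
  calc ∫ o, V o * F (covX o) ∂P = ∫ o, (condExp (sigmaX d) P (V * fun o => F (covX o))) o ∂P :=
        h2.symm
    _ = ∫ o, r (covX o) * F (covX o) ∂P := by
        refine integral_congr_ae ?_
        filter_upwards [h1, hVr] with o ho1 ho2
        rw [ho1, Pi.mul_apply, ho2]

/-- The functional is the covariance left after subtraction of the regression functions. -/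
lemma expCondCov_eq (hX : P.map covX = volume.restrict (Icc 0 1)) {A Y : Obs d → ℝ}
    (hA : BddMeas A) (hY : BddMeas Y) (hAe : varA =ᵐ[P] A) (hYe : varY =ᵐ[P] Y)
    {p b : (Fin d → ℝ) → ℝ} (hp : BddMeas p) (hb : BddMeas b)
    (hAp : condExp (sigmaX d) P varA =ᵐ[P] fun o => p (covX o))
    (hYb : condExp (sigmaX d) P varY =ᵐ[P] fun o => b (covX o)) :
    expCondCov P = ∫ o, A o * Y o ∂P - ∫ x, p x * b x ∂cubeMeasure d := by
  have hA' : condExp (sigmaX d) P A =ᵐ[P] fun o => p (covX o) :=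
    (condExp_congr_ae hAe.symm).trans hAp
  have hY' : condExp (sigmaX d) P Y =ᵐ[P] fun o => b (covX o) :=
    (condExp_congr_ae hYe.symm).trans hYb
  have hpX := hp.comp (measurable_covX (d := d))
  have hbX := hb.comp (measurable_covX (d := d))
  unfold expCondCov condCov
  rw [integral_condExp sigmaX_le]
  have h1 : ∫ o, (varA o - condExp (sigmaX d) P varA o) * (varY o - condExp (sigmaX d) P varY o) ∂P
      = ∫ o, (A o * Y o - A o * b (covX o) - Y o * p (covX o) + p (covX o) * b (covX o)) ∂P := by
    refine integral_congr_ae ?_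
    filter_upwards [hAe, hYe, hAp, hYb] with o h1 h2 h3 h4
    rw [h1, h2, h3, h4]; ring
  rw [h1, integral_add ((((hA.mul hY).sub (hA.mul hbX)).sub (hY.mul hpX)).integrable P)
    ((hpX.mul hbX).integrable P), integral_sub (((hA.mul hY).sub (hA.mul hbX)).integrable P)
    ((hY.mul hpX).integrable P), integral_sub ((hA.mul hY).integrable P)
    ((hA.mul hbX).integrable P), integral_mul_comp_covX hX (hA.integrable P) hp hA' hb,
    integral_mul_comp_covX hX (hY.integrable P) hb hY' hp, integral_comp_covX hX (hp.mul hb)]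
  simp_rw [mul_comm (b _)]
  ring

end Law

/-- What the estimation of the functional uses of a law in the model: bounded versions of the
variables with Hölder continuous regression functions. -/
lemma InModel.exists_regression {θ : ModelParams} {P : Measure (Obs d)} (hP : InModel W θ P) :
    ∃ p b : (Fin d → ℝ) → ℝ, W.HolderBall θ.α θ.M p ∧ W.HolderBall θ.β θ.M b ∧
      (∀ F, BddMeas F → ∫ o, varAc θ.C₁ θ.C₂ o * F (covX o) ∂P =
        ∫ x, p (cubeClamp x) * F x ∂cubeMeasure d) ∧
      (∀ F, BddMeas F → ∫ o, varYc θ.C₁ θ.C₂ o * F (covX o) ∂P =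
        ∫ x, b (cubeClamp x) * F x ∂cubeMeasure d) ∧
      BddMeas (fun x => p (cubeClamp x)) ∧ BddMeas (fun x => b (cubeClamp x)) ∧
      expCondCov P = ∫ o, varAc θ.C₁ θ.C₂ o * varYc θ.C₁ θ.C₂ o ∂P -
        ∫ x, p (cubeClamp x) * b (cubeClamp x) ∂cubeMeasure d := by
  have := hP.prob
  obtain ⟨p, hp, hAp⟩ := hP.regular_A
  obtain ⟨b, hb, hYb⟩ := hP.regular_Y
  have hcube : ∀ᵐ o ∂P, covX o ∈ Icc (0 : Fin d → ℝ) 1 := by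
    have h : ∀ᵐ x ∂(P.map covX), x ∈ Icc (0 : Fin d → ℝ) 1 := by
      rw [hP.uniform]; exact ae_mem_cube
    exact ae_of_ae_map measurable_covX.aemeasurable h
  have hbd : ∀ {α M : ℝ} {f : (Fin d → ℝ) → ℝ}, W.HolderBall α M f →
      BddMeas fun x => f (cubeClamp x) := by
    intro α M f hf
    obtain ⟨C, hC⟩ := isCompact_Icc.exists_bound_of_continuousOn hf.1.continuousOn
    exact ⟨hf.continuous_comp.measurable, C, fun x => hC _ (cubeClamp_mem x)⟩
  have hAp' : condExp (sigmaX d) P varA =ᵐ[P] fun o => p (cubeClamp (covX o)) := by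
    filter_upwards [hAp, hcube] with o h1 h2
    rw [h1, cubeClamp_of_mem h2]
  have hYb' : condExp (sigmaX d) P varY =ᵐ[P] fun o => b (cubeClamp (covX o)) := by
    filter_upwards [hYb, hcube] with o h1 h2
    rw [h1, cubeClamp_of_mem h2]
  have hAe : varA =ᵐ[P] varAc θ.C₁ θ.C₂ := by
    filter_upwards [hP.bound_A] with o ho
    rw [varAc, min_eq_right ho.2, max_eq_right ho.1]
  have hYe : varY =ᵐ[P] varYc θ.C₁ θ.C₂ := by
    filter_upwards [hP.bound_Y] with o ho
    rw [varYc, min_eq_right ho.2, max_eq_right ho.1]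
  have hA := bddMeas_varAc (d := d) θ.C₁ θ.C₂
  have hY := bddMeas_varYc (d := d) θ.C₁ θ.C₂
  exact ⟨p, b, hp, hb, fun F hF => integral_mul_comp_covX hP.uniform (hA.integrable P) (hbd hp)
      ((condExp_congr_ae hAe.symm).trans hAp') hF,
    fun F hF => integral_mul_comp_covX hP.uniform (hY.integrable P) (hbd hb)
      ((condExp_congr_ae hYe.symm).trans hYb') hF, hbd hp, hbd hb,
    expCondCov_eq hP.uniform hA hY hAe hYe (hbd hp) (hbd hb) hAp' hYb'⟩

/-- The projection kernel as a kernel on observations. -/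
def obsKernel (W : CDVData) (j : ℕ) (o o' : Obs d) : ℝ := W.kernelC j (covX o) (covX o')

lemma CDVData.IsCDV.exists_kernelBound (hW : W.IsCDV S) (d : ℕ) :
    ∃ C, 0 ≤ C ∧ ∀ B, C ≤ B → ∀ P : Measure (Obs d), IsProbabilityMeasure P →
      P.map covX = volume.restrict (Icc 0 1) → ∀ j,
        KernelBound P (obsKernel W j) B (2 ^ (j * d)) := by
  obtain ⟨C, hC0, hC⟩ := hW.exists_kernelC_le d
  obtain ⟨D, hD0, hD⟩ := hW.exists_integral_abs_kernelC_le d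
  refine ⟨max C D, hC0.trans (le_max_left _ _), fun B hB P _ hX j => ⟨?_, ?_, ?_, ?_⟩⟩
  · exact (hW.bddMeas_kernelC j).comp₂ (F := fun x y => W.kernelC j x y)
      (measurable_covX.comp measurable_fst) (measurable_covX.comp measurable_snd)
  · exact fun z w => CDVData.kernelC_comm j _ _
  · exact fun z w => (hC j _ _).trans (mul_le_mul_of_nonneg_right
      ((le_max_left _ _).trans hB) (by positivity))
  · intro z
    have := integral_comp_covX hX ((hW.bddMeas_kernelC j).mk_right
      (F := fun x y => W.kernelC j x y) (covX z)).abs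
    unfold obsKernel
    rw [this]
    exact (hD j _).trans ((le_max_right _ _).trans hB)

lemma CDVData.IsCDV.bddMeas_obsKernel (hW : W.IsCDV S) (j : ℕ) :
    BddMeas fun q : Obs d × Obs d => obsKernel W j q.1 q.2 :=
  (hW.bddMeas_kernelC j).comp₂ (F := fun x y => W.kernelC j x y)
      (measurable_covX.comp measurable_fst) (measurable_covX.comp measurable_snd)

section Formulas

variable {P : Measure (Obs d)} {V U : Obs d → ℝ}
  {p b : (Fin d → ℝ) → ℝ}

/-- The mean of the kernel estimator is the projection of the regression function. -/
lemma kernelMean_obsKernel (hW : W.IsCDV S)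
    (hV : ∀ F, BddMeas F → ∫ o, V o * F (covX o) ∂P = ∫ x, p x * F x ∂cubeMeasure d) (j : ℕ)
    (o : Obs d) : kernelMean P (obsKernel W j) V o = W.proj j p (covX o) := by
  unfold kernelMean obsKernel CDVData.proj
  rw [hV (fun x => W.kernelC j x (covX o)) ((hW.bddMeas_kernelC j).mk_left
    (F := fun x y => W.kernelC j x y) _)]
  congr 1; ext x
  rw [CDVData.kernelC_comm, mul_comm]

lemma integral_mul_kernelMean (hW : W.IsCDV S)
    (hV : ∀ F, BddMeas F → ∫ o, V o * F (covX o) ∂P = ∫ x, p x * F x ∂cubeMeasure d)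
    (hU : ∀ F, BddMeas F → ∫ o, U o * F (covX o) ∂P = ∫ x, b x * F x ∂cubeMeasure d)
    (hb : BddMeas b) (j : ℕ) :
    ∫ o, V o * kernelMean P (obsKernel W j) U o ∂P =
      ∫ x, p x * W.proj j b x ∂cubeMeasure d := by
  simp_rw [kernelMean_obsKernel hW hU]
  exact hV _ (hW.bddMeas_proj j hb)

lemma integral_kernelMean_mul_kernelMean (hW : W.IsCDV S)
    (hX : P.map covX = volume.restrict (Icc 0 1))
    (hV : ∀ F, BddMeas F → ∫ o, V o * F (covX o) ∂P = ∫ x, p x * F x ∂cubeMeasure d)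
    (hU : ∀ F, BddMeas F → ∫ o, U o * F (covX o) ∂P = ∫ x, b x * F x ∂cubeMeasure d)
    (hp : BddMeas p) (hb : BddMeas b) {j l : ℕ} (hj : W.J₀ ≤ j) (hl : W.J₀ ≤ l) :
    ∫ o, kernelMean P (obsKernel W j) V o * kernelMean P (obsKernel W l) U o ∂P =
      ∫ x, p x * W.proj (min j l) b x ∂cubeMeasure d := by
  simp_rw [kernelMean_obsKernel hW hU, kernelMean_obsKernel hW hV]
  rw [integral_comp_covX hX ((hW.bddMeas_proj j hp).mul (hW.bddMeas_proj l hb)),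
    hW.integral_proj_mul j hp (hW.bddMeas_proj l hb)]
  simp_rw [hW.proj_proj hj hl hb]

end Formulas

section Estimators

variable {n : ℕ}

/-- The integral-based estimator is a plug-in estimator with a single kernel estimator: integrating
the product of two projection kernels gives the kernel of the coarser level. -/
lemma psiINT_eq (hW : W.IsCDV S) {j₁ j₂ : ℕ} (h₁ : W.J₀ ≤ j₁) (h₂ : W.J₀ ≤ j₂)
    {o : Fin n → Obs d} (ho : ∀ i, covX (o i) ∈ Icc (0 : Fin d → ℝ) 1) :
    psiINT W j₁ j₂ n o = (1 / (n : ℝ)) * ∑ i, varA (o i) * varY (o i) -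
      (1 / (n : ℝ)) * ∑ i, varA (o i) *
        kernelEst (obsKernel W (min j₁ j₂)) varY o (o i) := by
  unfold psiINT
  congr 1
  have hK : ∀ j (x : Fin d → ℝ), Continuous fun y => W.kernelC j x y :=
    fun j x => hW.continuous_kernelC_right j x
  have h : ∫ x in Icc (0 : Fin d → ℝ) 1, pHat W j₁ n o x * bHat W j₂ n o x =
      ∫ x, ((1 / (n : ℝ)) * ∑ i, varA (o i) * W.kernelC j₁ (covX (o i)) x) *
        ((1 / (n : ℝ)) * ∑ l, varY (o l) * W.kernelC j₂ (covX (o l)) x) ∂cubeMeasure d := by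
    refine integral_cube_congr fun x hx => ?_
    unfold pHat bHat
    simp_rw [CDVData.kernelC_of_mem _ (ho _) hx]
  have e : ∀ x, ((1 / (n : ℝ)) * ∑ i, varA (o i) * W.kernelC j₁ (covX (o i)) x) *
        ((1 / (n : ℝ)) * ∑ l, varY (o l) * W.kernelC j₂ (covX (o l)) x) =
      ∑ i, ∑ l, ((1 / (n : ℝ)) * (1 / n) * varA (o i) * varY (o l)) *
        (W.kernelC j₁ (covX (o i)) x * W.kernelC j₂ x (covX (o l))) := by
    intro x
    rw [mul_mul_mul_comm, Finset.sum_mul_sum, Finset.mul_sum]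
    refine Finset.sum_congr rfl fun i _ => ?_
    rw [Finset.mul_sum]
    refine Finset.sum_congr rfl fun l _ => ?_
    rw [CDVData.kernelC_comm j₂ x]; ring
  have hc : ∀ i l, Continuous fun x => ((1 / (n : ℝ)) * (1 / n) * varA (o i) * varY (o l)) *
        (W.kernelC j₁ (covX (o i)) x * W.kernelC j₂ x (covX (o l))) := by
    intro i l
    simp_rw [CDVData.kernelC_comm j₂ _ (covX (o l))]
    exact continuous_const.mul ((hK _ _).mul (hK _ _))
  rw [h]
  simp_rw [e]
  rw [integral_finsetSum _ fun i _ => (continuous_finsetSum _ fun l _ => hc i l).integrable_cube,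
    Finset.mul_sum]
  refine Finset.sum_congr rfl fun i _ => ?_
  rw [integral_finsetSum _ fun l _ => (hc i l).integrable_cube]
  simp_rw [integral_const_mul, hW.integral_kernelC_kernelC h₁ h₂]
  unfold kernelEst obsKernel
  rw [Finset.mul_sum, Finset.mul_sum, Finset.mul_sum]
  refine Finset.sum_congr rfl fun l _ => ?_
  rw [CDVData.kernelC_comm _ (covX (o l))]; ring

lemma pHat_eq {j : ℕ} {o : Fin n → Obs d} (ho : ∀ i, covX (o i) ∈ Icc (0 : Fin d → ℝ) 1)
    (i : Fin n) : pHat W j n o (covX (o i)) = kernelEst (obsKernel W j) varA o (o i) := by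
  unfold pHat kernelEst obsKernel
  simp_rw [CDVData.kernelC_of_mem j (ho _) (ho i)]

lemma bHat_eq {j : ℕ} {o : Fin n → Obs d} (ho : ∀ i, covX (o i) ∈ Icc (0 : Fin d → ℝ) 1)
    (i : Fin n) : bHat W j n o (covX (o i)) = kernelEst (obsKernel W j) varY o (o i) := by
  unfold bHat kernelEst obsKernel
  simp_rw [CDVData.kernelC_of_mem j (ho _) (ho i)]

lemma psiMC_eq {j₁ j₂ : ℕ} {o : Fin n → Obs d} (ho : ∀ i, covX (o i) ∈ Icc (0 : Fin d → ℝ) 1) :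
    psiMC W j₁ j₂ n o = (1 / (n : ℝ)) * ∑ i, varA (o i) * varY (o i) -
      (1 / (n : ℝ)) * ∑ i, kernelEst (obsKernel W j₁) varA o (o i) *
        kernelEst (obsKernel W j₂) varY o (o i) := by
  unfold psiMC
  simp_rw [pHat_eq ho, bHat_eq ho]

lemma psiIF_eq {j₁ j₂ : ℕ} {o : Fin n → Obs d} (ho : ∀ i, covX (o i) ∈ Icc (0 : Fin d → ℝ) 1) :
    psiIF W j₁ j₂ n o = (1 / (n : ℝ)) * ∑ i, (varA (o i) -
      kernelEst (obsKernel W j₁) varA o (o i)) * (varY (o i) -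
        kernelEst (obsKernel W j₂) varY o (o i)) := by
  unfold psiIF
  simp_rw [pHat_eq ho, bHat_eq ho]

end Estimators

end

/-! ### Upper bounds for the worst-case risks -/

section

variable {d : ℕ} {W : CDVData} {S : ℕ} {θ : ModelParams} {n : ℕ}

/-- Under every law in the model, almost every sample has its covariates in the cube and its
variables in `[C₁, C₂]`. -/
lemma InModel.ae_sample {P : Measure (Obs d)} (hP : InModel W θ P) (n : ℕ) :
    ∀ᵐ o ∂(Measure.pi fun _ : Fin n => P), ∀ i, covX (o i) ∈ Icc (0 : Fin d → ℝ) 1 ∧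
      varA (o i) = varAc θ.C₁ θ.C₂ (o i) ∧ varY (o i) = varYc θ.C₁ θ.C₂ (o i) := by
  have := hP.prob
  have hcube : ∀ᵐ o ∂P, covX o ∈ Icc (0 : Fin d → ℝ) 1 := by
    have h : ∀ᵐ x ∂(P.map covX), x ∈ Icc (0 : Fin d → ℝ) 1 := by
      rw [hP.uniform]; exact ae_mem_cube
    exact ae_of_ae_map measurable_covX.aemeasurable h
  have h1 : ∀ᵐ o ∂P, covX o ∈ Icc (0 : Fin d → ℝ) 1 ∧ varA o = varAc θ.C₁ θ.C₂ o ∧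
      varY o = varYc θ.C₁ θ.C₂ o := by
    filter_upwards [hcube, hP.bound_A, hP.bound_Y] with o h1 h2 h3
    refine ⟨h1, ?_, ?_⟩
    · rw [varAc, min_eq_right h2.2, max_eq_right h2.1]
    · rw [varYc, min_eq_right h3.2, max_eq_right h3.1]
  rw [ae_all_iff]
  intro i
  exact (measurePreserving_eval (fun _ : Fin n => P) i).quasiMeasurePreserving.ae h1

lemma worstRisk_congr {T T' : (Fin n → Obs d) → ℝ}
    (h : ∀ P, InModel W θ P → T =ᵐ[Measure.pi fun _ : Fin n => P] T') :
    worstRisk W θ T = worstRisk W θ T' := by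
  unfold worstRisk
  refine iSup_congr fun P => iSup_congr fun hP => lintegral_congr_ae ?_
  filter_upwards [h P hP] with o ho
  rw [ho]

/-- The integral-based estimator as a bounded measurable function of the sample: the variables and
covariates are moved to `[C₁, C₂]` and the cube, which changes nothing under the laws in the
model. -/
def cleanINT (W : CDVData) (θ : ModelParams) (j₁ j₂ n : ℕ) (o : Fin n → Obs d) : ℝ :=
  (1 / (n : ℝ)) * ∑ i, varAc θ.C₁ θ.C₂ (o i) * varYc θ.C₁ θ.C₂ (o i) -
    (1 / (n : ℝ)) * ∑ i, varAc θ.C₁ θ.C₂ (o i) *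
      kernelEst (obsKernel W (min j₁ j₂)) (varYc θ.C₁ θ.C₂) o (o i)

/-- The Monte Carlo estimator as a bounded measurable function of the sample. -/
def cleanMC (W : CDVData) (θ : ModelParams) (j₁ j₂ n : ℕ) (o : Fin n → Obs d) : ℝ :=
  (1 / (n : ℝ)) * ∑ i, varAc θ.C₁ θ.C₂ (o i) * varYc θ.C₁ θ.C₂ (o i) -
    (1 / (n : ℝ)) * ∑ i, kernelEst (obsKernel W j₁) (varAc θ.C₁ θ.C₂) o (o i) *
      kernelEst (obsKernel W j₂) (varYc θ.C₁ θ.C₂) o (o i)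

/-- The influence function based estimator as a bounded measurable function of the sample. -/
def cleanIF (W : CDVData) (θ : ModelParams) (j₁ j₂ n : ℕ) (o : Fin n → Obs d) : ℝ :=
  (1 / (n : ℝ)) * ∑ i, (varAc θ.C₁ θ.C₂ (o i) -
      kernelEst (obsKernel W j₁) (varAc θ.C₁ θ.C₂) o (o i)) *
    (varYc θ.C₁ θ.C₂ (o i) - kernelEst (obsKernel W j₂) (varYc θ.C₁ θ.C₂) o (o i))

lemma kernelEst_congr {Ω : Type*} {κ : Ω → Ω → ℝ} {Y Y' : Ω → ℝ} {o : Fin n → Ω}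
    (h : ∀ i, Y (o i) = Y' (o i)) (x : Ω) : kernelEst κ Y o x = kernelEst κ Y' o x := by
  unfold kernelEst
  simp_rw [h]

lemma InModel.psiINT_ae_eq (hW : W.IsCDV S) {j₁ j₂ : ℕ} (h₁ : W.J₀ ≤ j₁) (h₂ : W.J₀ ≤ j₂)
    {P : Measure (Obs d)} (hP : InModel W θ P) :
    psiINT W j₁ j₂ n =ᵐ[Measure.pi fun _ : Fin n => P] cleanINT W θ j₁ j₂ n := by
  filter_upwards [hP.ae_sample n] with o ho
  rw [psiINT_eq hW h₁ h₂ fun i => (ho i).1]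
  unfold cleanINT
  simp_rw [kernelEst_congr fun i => (ho i).2.2, fun i => (ho i).2.1, fun i => (ho i).2.2]

lemma InModel.psiMC_ae_eq {j₁ j₂ : ℕ} {P : Measure (Obs d)} (hP : InModel W θ P) :
    psiMC W j₁ j₂ n =ᵐ[Measure.pi fun _ : Fin n => P] cleanMC W θ j₁ j₂ n := by
  filter_upwards [hP.ae_sample n] with o ho
  rw [psiMC_eq fun i => (ho i).1]
  unfold cleanMC
  simp_rw [kernelEst_congr fun i => (ho i).2.2, kernelEst_congr fun i => (ho i).2.1,
    fun i => (ho i).2.1, fun i => (ho i).2.2]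

lemma InModel.psiIF_ae_eq {j₁ j₂ : ℕ} {P : Measure (Obs d)} (hP : InModel W θ P) :
    psiIF W j₁ j₂ n =ᵐ[Measure.pi fun _ : Fin n => P] cleanIF W θ j₁ j₂ n := by
  filter_upwards [hP.ae_sample n] with o ho
  rw [psiIF_eq fun i => (ho i).1]
  unfold cleanIF
  simp_rw [kernelEst_congr fun i => (ho i).2.2, kernelEst_congr fun i => (ho i).2.1,
    fun i => (ho i).2.1, fun i => (ho i).2.2]

lemma bddMeas_kernelEst_eval (hW : W.IsCDV S) (j : ℕ) {Y : Obs d → ℝ} (hY : BddMeas Y)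
    (i : Fin n) : BddMeas fun o : Fin n → Obs d => kernelEst (obsKernel W j) Y o (o i) :=
  (BddMeas.sum _ fun l _ => (hY.comp (measurable_pi_apply l)).mul
    ((hW.bddMeas_obsKernel j).comp₂ (F := obsKernel W j) (measurable_pi_apply l)
      (measurable_pi_apply i))).const_mul _

lemma bddMeas_cleanINT (hW : W.IsCDV S) (j₁ j₂ : ℕ) :
    BddMeas (cleanINT (d := d) W θ j₁ j₂ n) :=
  (BddMeas.avg ((bddMeas_varAc _ _).mul (bddMeas_varYc _ _)) n).sub
    ((BddMeas.sum _ fun (i : Fin n) _ => ((bddMeas_varAc _ _).comp (measurable_pi_apply i)).mul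
      (bddMeas_kernelEst_eval hW _ (bddMeas_varYc _ _) i)).const_mul _)

lemma bddMeas_cleanMC (hW : W.IsCDV S) (j₁ j₂ : ℕ) :
    BddMeas (cleanMC (d := d) W θ j₁ j₂ n) :=
  (BddMeas.avg ((bddMeas_varAc _ _).mul (bddMeas_varYc _ _)) n).sub
    ((BddMeas.sum _ fun (i : Fin n) _ => (bddMeas_kernelEst_eval hW _ (bddMeas_varAc _ _) i).mul
      (bddMeas_kernelEst_eval hW _ (bddMeas_varYc _ _) i)).const_mul _)

lemma bddMeas_cleanIF (hW : W.IsCDV S) (j₁ j₂ : ℕ) :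
    BddMeas (cleanIF (d := d) W θ j₁ j₂ n) :=
  (BddMeas.sum _ fun (i : Fin n) _ => (((bddMeas_varAc _ _).comp (measurable_pi_apply i)).sub
    (bddMeas_kernelEst_eval hW _ (bddMeas_varAc _ _) i)).mul
      (((bddMeas_varYc _ _).comp (measurable_pi_apply i)).sub
        (bddMeas_kernelEst_eval hW _ (bddMeas_varYc _ _) i))).const_mul _

lemma worstRisk_le_of_integral_le {T : (Fin n → Obs d) → ℝ} (hT : BddMeas T) {r : ℝ}
    (h : ∀ P, InModel W θ P →
      ∫ o, (T o - expCondCov P) ^ 2 ∂(Measure.pi fun _ : Fin n => P) ≤ r) :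
    worstRisk W θ T ≤ ENNReal.ofReal r := by
  refine iSup_le fun P => iSup_le fun hP => ?_
  have := hP.prob
  rw [← ofReal_integral_eq_lintegral_ofReal (((hT.sub (BddMeas.const _)).pow 2).integrable _)
    (ae_of_all _ fun _ => sq_nonneg _)]
  exact ENNReal.ofReal_le_ofReal (h P hP)

/-- The quantities that the risk bounds depend on: a bound for the variables and the kernels, and
the bias of the projections of the regression functions. For the product of the two means the bias
is that of the coarser projection. For the product of the two residuals the linear terms cancel the
coarser projection, and the bias is that of the finer one. -/
lemma exists_model_constants (hW : W.IsCDV S) (hS : 0 < S) (d : ℕ) (hαβ : 0 < θ.α + θ.β)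
    (hM : 0 ≤ θ.M) :
    ∃ B D, 1 ≤ B ∧ 0 ≤ D ∧ (∀ o : Obs d, |varAc θ.C₁ θ.C₂ o| ≤ B) ∧
      (∀ o : Obs d, |varYc θ.C₁ θ.C₂ o| ≤ B) ∧
      ∀ P : Measure (Obs d), InModel W θ P →
        (∀ j, KernelBound P (obsKernel W j) B (2 ^ (j * d))) ∧
        (∀ j, W.J₀ ≤ j → |∫ o, varAc θ.C₁ θ.C₂ o * (varYc θ.C₁ θ.C₂ o -
          kernelMean P (obsKernel W j) (varYc θ.C₁ θ.C₂) o) ∂P - expCondCov P| ≤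
            D * 2 ^ (-((θ.α + θ.β) * j))) ∧
        (∀ j l, W.J₀ ≤ j → W.J₀ ≤ l → |∫ o, (varAc θ.C₁ θ.C₂ o * varYc θ.C₁ θ.C₂ o -
          kernelMean P (obsKernel W j) (varAc θ.C₁ θ.C₂) o *
          kernelMean P (obsKernel W l) (varYc θ.C₁ θ.C₂) o) ∂P - expCondCov P| ≤
            D * 2 ^ (-((θ.α + θ.β) * (min j l : ℕ)))) ∧
        (∀ j l, W.J₀ ≤ j → W.J₀ ≤ l → |∫ o, (varAc θ.C₁ θ.C₂ o -
          kernelMean P (obsKernel W j) (varAc θ.C₁ θ.C₂) o) * (varYc θ.C₁ θ.C₂ o -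
          kernelMean P (obsKernel W l) (varYc θ.C₁ θ.C₂) o) ∂P - expCondCov P| ≤
            D * 2 ^ (-((θ.α + θ.β) * (max j l : ℕ)))) := by
  obtain ⟨C, hC0, hC⟩ := hW.exists_kernelBound d
  obtain ⟨D, hD0, hD⟩ := hW.exists_bias_le hS d hαβ hM
  let B := max 1 (max C (max |θ.C₁| |θ.C₂|))
  have hBC : C ≤ B := (le_max_left _ _).trans (le_max_right _ _)
  have hB1 : |θ.C₁| ≤ B := (le_max_left _ _).trans ((le_max_right _ _).trans (le_max_right _ _))
  have hB2 : |θ.C₂| ≤ B := (le_max_right _ _).trans ((le_max_right _ _).trans (le_max_right _ _))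
  refine ⟨B, D, le_max_left _ _, hD0, fun o => abs_clamp_le hB1 hB2 _,
    fun o => abs_clamp_le hB1 hB2 _, fun P hP => ?_⟩
  have := hP.prob
  obtain ⟨p, b, hp, hb, hA, hY, hpb, hbb, hψ⟩ := hP.exists_regression
  have hκ := hC B hBC P hP.prob hP.uniform
  have hAb := bddMeas_varAc (d := d) θ.C₁ θ.C₂
  have hYb := bddMeas_varYc (d := d) θ.C₁ θ.C₂
  have hbias : ∀ j, W.J₀ ≤ j → |∫ x, p (cubeClamp x) * b (cubeClamp x) ∂cubeMeasure d -
      ∫ x, p (cubeClamp x) * W.proj j (fun y => b (cubeClamp y)) x ∂cubeMeasure d| ≤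
        D * 2 ^ (-((θ.α + θ.β) * j)) := by
    intro j hj
    rw [abs_sub_comm]
    exact hD p b hp hb j hj
  refine ⟨hκ, fun j hj => ?_, fun j l hj hl => ?_, fun j l hj hl => ?_⟩
  · have hm := (hκ j).bdd_mean hYb
    simp_rw [mul_sub]
    rw [integral_sub ((hAb.mul hYb).integrable P) ((hAb.mul hm).integrable P),
      integral_mul_kernelMean hW hA hY hbb, hψ]
    convert hbias j hj using 2
    ring
  · have hm := (hκ j).bdd_mean hAb
    have hm' := (hκ l).bdd_mean hYb
    rw [integral_sub ((hAb.mul hYb).integrable P) ((hm.mul hm').integrable P),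
      integral_kernelMean_mul_kernelMean hW hP.uniform hA hY hpb hbb hj hl, hψ]
    convert hbias (min j l) (le_min hj hl) using 2
    ring
  · have hm := (hκ j).bdd_mean hAb
    have hm' := (hκ l).bdd_mean hYb
    have e : ∀ o, (varAc θ.C₁ θ.C₂ o - kernelMean P (obsKernel W j) (varAc θ.C₁ θ.C₂) o) *
        (varYc θ.C₁ θ.C₂ o - kernelMean P (obsKernel W l) (varYc θ.C₁ θ.C₂) o) =
        varAc θ.C₁ θ.C₂ o * varYc θ.C₁ θ.C₂ o -
        varAc θ.C₁ θ.C₂ o * kernelMean P (obsKernel W l) (varYc θ.C₁ θ.C₂) o -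
        varYc θ.C₁ θ.C₂ o * kernelMean P (obsKernel W j) (varAc θ.C₁ θ.C₂) o +
        kernelMean P (obsKernel W j) (varAc θ.C₁ θ.C₂) o *
          kernelMean P (obsKernel W l) (varYc θ.C₁ θ.C₂) o := fun o => by ring
    simp_rw [e]
    rw [integral_add ((((hAb.mul hYb).sub (hAb.mul hm')).sub (hYb.mul hm)).integrable P)
      ((hm.mul hm').integrable P), integral_sub (((hAb.mul hYb).sub (hAb.mul hm')).integrable P)
      ((hYb.mul hm).integrable P), integral_sub ((hAb.mul hYb).integrable P)
      ((hAb.mul hm').integrable P), integral_mul_kernelMean hW hA hY hbb,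
      integral_mul_kernelMean hW hY hA hpb,
      integral_kernelMean_mul_kernelMean hW hP.uniform hA hY hpb hbb hj hl, hψ]
    have hsw : ∫ x, b (cubeClamp x) * W.proj j (fun y => p (cubeClamp y)) x ∂cubeMeasure d =
        ∫ x, p (cubeClamp x) * W.proj j (fun y => b (cubeClamp y)) x ∂cubeMeasure d := by
      rw [← hW.integral_proj_mul j hpb hbb]
      simp_rw [mul_comm]
    rw [hsw]
    rcases le_total j l with h | h
    · rw [min_eq_left h, max_eq_right h]
      convert hbias l hl using 2
      ring
    · rw [min_eq_right h, max_eq_left h]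
      convert hbias j hj using 2
      ring

lemma add_mul_sq_le {a x D u : ℝ} (ha : 0 ≤ a) (hx : 0 ≤ x) :
    a + x + (D * u) ^ 2 ≤ (1 + D ^ 2) * (a + x + u ^ 2) := by
  nlinarith [mul_nonneg (sq_nonneg D) ha, mul_nonneg (sq_nonneg D) hx, sq_nonneg u]

/-- The worst-case risk of the integral-based estimator. -/
lemma exists_worstRisk_INT_le (hW : W.IsCDV S) (hS : 0 < S) (d : ℕ) (hαβ : 0 < θ.α + θ.β)
    (hM : 0 ≤ θ.M) : ∃ C, 0 ≤ C ∧ ∀ n j₁ j₂ : ℕ, 0 < n → W.J₀ ≤ j₁ → W.J₀ ≤ j₂ →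
      worstRisk W θ (psiINT (d := d) W j₁ j₂ n) ≤ ENNReal.ofReal (C * (1 / n +
        (2 ^ (min j₁ j₂ * d) / n) ^ 2 + (2 ^ (-((θ.α + θ.β) * (min j₁ j₂ : ℕ)))) ^ 2)) := by
  obtain ⟨B, D, hB, hD, hAB, hYB, h⟩ := exists_model_constants (θ := θ) hW hS d hαβ hM
  refine ⟨100 * B ^ 6 * (1 + D ^ 2), by positivity, fun n j₁ j₂ hn h₁ h₂ => ?_⟩
  rw [worstRisk_congr fun P hP => hP.psiINT_ae_eq hW h₁ h₂]
  refine worstRisk_le_of_integral_le (bddMeas_cleanINT hW _ _) fun P hP => ?_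
  have := hP.prob
  obtain ⟨hκ, hb, -, -⟩ := h P hP
  refine ((hκ (min j₁ j₂)).risk_plugin_le hn (bddMeas_varAc _ _) hAB (bddMeas_varYc _ _) hYB hB
    (one_le_pow₀ one_le_two) (hb _ (le_min h₁ h₂))).trans ?_
  rw [mul_assoc (100 * B ^ 6)]
  exact mul_le_mul_of_nonneg_left (add_mul_sq_le (by positivity) (sq_nonneg _)) (by positivity)

/-- The worst-case risk of the Monte Carlo estimator. -/
lemma exists_worstRisk_MC_le (hW : W.IsCDV S) (hS : 0 < S) (d : ℕ) (hαβ : 0 < θ.α + θ.β)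
    (hM : 0 ≤ θ.M) {C₀ : ℝ} (hC₀ : 1 ≤ C₀) :
    ∃ C, 0 ≤ C ∧ ∀ n j₁ j₂ : ℕ, 0 < n → W.J₀ ≤ j₁ → W.J₀ ≤ j₂ →
      (2 : ℝ) ^ (max j₁ j₂ * d) ≤ C₀ * n →
      worstRisk W θ (psiMC (d := d) W j₁ j₂ n) ≤ ENNReal.ofReal (C * (1 / n +
        (2 ^ (max j₁ j₂ * d) / n) ^ 2 + (2 ^ (-((θ.α + θ.β) * (min j₁ j₂ : ℕ)))) ^ 2)) := by
  obtain ⟨B, D, hB, hD, hAB, hYB, h⟩ := exists_model_constants (θ := θ) hW hS d hαβ hM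
  refine ⟨110000 * B ^ 8 * C₀ ^ 2 * (1 + D ^ 2), by positivity, fun n j₁ j₂ hn h₁ h₂ hk => ?_⟩
  rw [worstRisk_congr fun P hP => hP.psiMC_ae_eq]
  refine worstRisk_le_of_integral_le (bddMeas_cleanMC hW _ _) fun P hP => ?_
  have := hP.prob
  obtain ⟨hκ, -, hb, -⟩ := h P hP
  have hk₁ := (hκ j₁).mono (by linarith) (pow_le_pow_right₀ one_le_two
    (Nat.mul_le_mul_right d (le_max_left j₁ j₂)))
  have hk₂ := (hκ j₂).mono (by linarith) (pow_le_pow_right₀ one_le_two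
    (Nat.mul_le_mul_right d (le_max_right j₁ j₂)))
  refine (hk₁.risk_monteCarlo_le hk₂ hn (bddMeas_varAc _ _) hAB (bddMeas_varYc _ _) hYB hB
    (one_le_pow₀ one_le_two) hC₀ hk (hb _ _ h₁ h₂)).trans ?_
  rw [mul_assoc (110000 * B ^ 8 * C₀ ^ 2)]
  exact mul_le_mul_of_nonneg_left (add_mul_sq_le (by positivity) (sq_nonneg _)) (by positivity)

/-- The worst-case risk of the influence function based estimator. -/
lemma exists_worstRisk_IF_le (hW : W.IsCDV S) (hS : 0 < S) (d : ℕ) (hαβ : 0 < θ.α + θ.β)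
    (hM : 0 ≤ θ.M) {C₀ : ℝ} (hC₀ : 1 ≤ C₀) :
    ∃ C, 0 ≤ C ∧ ∀ n j₁ j₂ : ℕ, 0 < n → W.J₀ ≤ j₁ → W.J₀ ≤ j₂ →
      (2 : ℝ) ^ (max j₁ j₂ * d) ≤ C₀ * n →
      worstRisk W θ (psiIF (d := d) W j₁ j₂ n) ≤ ENNReal.ofReal (C * (1 / n +
        (2 ^ (max j₁ j₂ * d) / n) ^ 2 + (2 ^ (-((θ.α + θ.β) * (max j₁ j₂ : ℕ)))) ^ 2)) := by
  obtain ⟨B, D, hB, hD, hAB, hYB, h⟩ := exists_model_constants (θ := θ) hW hS d hαβ hM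
  refine ⟨110000 * B ^ 8 * C₀ ^ 2 * (1 + D ^ 2), by positivity, fun n j₁ j₂ hn h₁ h₂ hk => ?_⟩
  rw [worstRisk_congr fun P hP => hP.psiIF_ae_eq]
  refine worstRisk_le_of_integral_le (bddMeas_cleanIF hW _ _) fun P hP => ?_
  have := hP.prob
  obtain ⟨hκ, -, -, hb⟩ := h P hP
  have hk₁ := (hκ j₁).mono (by linarith) (pow_le_pow_right₀ one_le_two
    (Nat.mul_le_mul_right d (le_max_left j₁ j₂)))
  have hk₂ := (hκ j₂).mono (by linarith) (pow_le_pow_right₀ one_le_two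
    (Nat.mul_le_mul_right d (le_max_right j₁ j₂)))
  refine (hk₁.risk_influence_le hk₂ hn (bddMeas_varAc _ _) hAB (bddMeas_varYc _ _) hYB hB
    (one_le_pow₀ one_le_two) hC₀ hk (hb _ _ h₁ h₂)).trans ?_
  rw [mul_assoc (110000 * B ^ 8 * C₀ ^ 2)]
  exact mul_le_mul_of_nonneg_left (add_mul_sq_le (by positivity) (sq_nonneg _)) (by positivity)

/-- The second-order U-statistic gives an upper bound for the minimax risk. -/
lemma exists_minimaxRisk_le (hW : W.IsCDV S) (hS : 0 < S) (d : ℕ) (hαβ : 0 < θ.α + θ.β)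
    (hM : 0 ≤ θ.M) : ∃ C, 0 ≤ C ∧ ∀ n j, 2 ≤ n → W.J₀ ≤ j →
      minimaxRisk W θ d n ≤ ENNReal.ofReal (C * (1 / n + 2 ^ (j * d) / n ^ 2 +
        (2 ^ (-((θ.α + θ.β) * j))) ^ 2)) := by
  obtain ⟨B, D, hB, hD, hAB, hYB, h⟩ := exists_model_constants (θ := θ) hW hS d hαβ hM
  refine ⟨100 * B ^ 6 * (1 + D ^ 2), by positivity, fun n j hn hj => ?_⟩
  let T : (Fin n → Obs d) → ℝ := uStat (obsKernel W j) (varAc θ.C₁ θ.C₂) (varYc θ.C₁ θ.C₂)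
  have hT : BddMeas T := by
    refine (BddMeas.avg ((bddMeas_varAc _ _).mul (bddMeas_varYc _ _)) n).sub
      ((BddMeas.sum _ fun (i : Fin n) _ => BddMeas.sum _ fun (l : Fin n) _ => ?_).const_mul _)
    split_ifs
    · exact BddMeas.const 0
    · exact ((bddMeas_varAc _ _).comp (measurable_pi_apply i)).mul
        (((bddMeas_varYc _ _).comp (measurable_pi_apply l)).mul
          ((hW.bddMeas_obsKernel j).comp₂ (F := obsKernel W j) (measurable_pi_apply l)
            (measurable_pi_apply i)))
  refine (iInf_le_of_le T (iInf_le _ hT.meas)).trans ?_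
  refine worstRisk_le_of_integral_le hT fun P hP => ?_
  have := hP.prob
  obtain ⟨hκ, hb, -, -⟩ := h P hP
  refine ((hκ j).risk_uStat_le hn (bddMeas_varAc _ _) hAB (bddMeas_varYc _ _) hYB hB
    (one_le_pow₀ one_le_two) (hb _ hj)).trans ?_
  rw [mul_assoc (100 * B ^ 6)]
  exact mul_le_mul_of_nonneg_left (add_mul_sq_le (by positivity) (by positivity)) (by positivity)

end

/-! ### Laws with perturbed regression functions -/

section

variable {d : ℕ} {W : CDVData} {S : ℕ} {θ : ModelParams} {n : ℕ}

/-- The uniform distribution on the two points `c - r` and `c + r`. -/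
def twoPointLaw (c r : ℝ) : Measure ℝ :=
  (2⁻¹ : ℝ≥0∞) • Measure.dirac (c - r) + (2⁻¹ : ℝ≥0∞) • Measure.dirac (c + r)

instance (c r : ℝ) : IsProbabilityMeasure (twoPointLaw c r) :=
  ⟨by simp [twoPointLaw, ENNReal.inv_two_add_inv_two]⟩

lemma integral_twoPointLaw (c r : ℝ) {f : ℝ → ℝ} (hf : BddMeas f) :
    ∫ a, f a ∂twoPointLaw c r = (f (c - r) + f (c + r)) / 2 := by
  have h : ∀ a : ℝ, Integrable f ((2⁻¹ : ℝ≥0∞) • Measure.dirac a) := fun a =>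
    (hf.integrable _).smul_measure (by simp)
  rw [twoPointLaw, integral_add_measure (h _) (h _), integral_smul_measure, integral_smul_measure,
    integral_dirac, integral_dirac]
  simp
  ring

/-- The law of `(X, A, Y)` with independent components, `X` uniform on the cube and `A` and `Y`
uniform on `{c - r, c + r}`. -/
def baseLaw (d : ℕ) (c r : ℝ) : Measure (Obs d) :=
  (cubeMeasure d).prod ((twoPointLaw c r).prod (twoPointLaw c r))

instance (c r : ℝ) : IsProbabilityMeasure (baseLaw d c r) := by
  unfold baseLaw; infer_instance

lemma integral_baseLaw (c r : ℝ) {G : Obs d → ℝ} (hG : BddMeas G) :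
    ∫ o, G o ∂baseLaw d c r = ∫ x, (G (x, c - r, c - r) + G (x, c - r, c + r) +
      G (x, c + r, c - r) + G (x, c + r, c + r)) / 4 ∂cubeMeasure d := by
  rw [baseLaw, integral_prod _ (hG.integrable _)]
  congr 1; ext x
  have h1 : BddMeas fun q : ℝ × ℝ => G (x, q) := hG.comp measurable_prodMk_left
  rw [integral_prod _ (h1.integrable _),
    integral_twoPointLaw (f := fun a => ∫ y, G (x, a, y) ∂_) _ _
    (BddMeas.integral_right (F := fun a y => G (x, a, y)) h1 _),
    integral_twoPointLaw _ _ (f := fun y => G (x, c - r, y)) (h1.comp measurable_prodMk_left),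
    integral_twoPointLaw _ _ (f := fun y => G (x, c + r, y)) (h1.comp measurable_prodMk_left)]
  ring

/-- The affine map that sends `c - r` and `c + r` to `-1` and `1`, truncated to `[-1, 1]`, which
makes it bounded. -/
def spin (c r a : ℝ) : ℝ := max (-1) (min 1 ((a - c) / r))

lemma abs_spin_le (c r a : ℝ) : |spin c r a| ≤ 1 := abs_clamp_le (by simp) (by simp) _

lemma measurable_spin (c r : ℝ) : Measurable (spin c r) :=
  measurable_const.max (measurable_const.min ((measurable_id.sub_const _).div_const _))

lemma bddMeas_spin (c r : ℝ) : BddMeas (spin c r) := ⟨measurable_spin c r, 1, abs_spin_le c r⟩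

lemma spin_sub {c r : ℝ} (hr : 0 < r) : spin c r (c - r) = -1 := by
  have : (c - r - c) / r = -1 := by field_simp; ring
  rw [spin, this]; norm_num

lemma spin_add {c r : ℝ} (hr : 0 < r) : spin c r (c + r) = 1 := by
  have : (c + r - c) / r = 1 := by field_simp; ring
  rw [spin, this]; norm_num

/-- The density with respect to `baseLaw d c r` that shifts `E[A | X]` by `g(X)`, `E[Y | X]` by
`h(X)` and turns `E[A Y | X]` into the constant `q`. -/
def tilt (c r : ℝ) (g h : (Fin d → ℝ) → ℝ) (q : ℝ) (o : Obs d) : ℝ :=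
  1 + spin c r (varA o) * (g (covX o) / r) + spin c r (varY o) * (h (covX o) / r) +
    spin c r (varA o) * spin c r (varY o) *
      ((q - c ^ 2 - c * (g (covX o) + h (covX o))) / r ^ 2)

/-- The law with density `tilt c r g h q` with respect to `baseLaw d c r`. -/
def tiltedLaw (c r : ℝ) (g h : (Fin d → ℝ) → ℝ) (q : ℝ) : Measure (Obs d) :=
  (baseLaw d c r).withDensity fun o => ENNReal.ofReal (tilt c r g h q o)

lemma bddMeas_tilt (c r : ℝ) {g h : (Fin d → ℝ) → ℝ} (hg : BddMeas g) (hh : BddMeas h) (q : ℝ) :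
    BddMeas (tilt c r g h q) := by
  have hA : BddMeas fun o : Obs d => spin c r (varA o) := (bddMeas_spin c r).comp measurable_varA
  have hY : BddMeas fun o : Obs d => spin c r (varY o) := (bddMeas_spin c r).comp measurable_varY
  have hgX : BddMeas fun o : Obs d => g (covX o) := hg.comp measurable_covX
  have hhX : BddMeas fun o : Obs d => h (covX o) := hh.comp measurable_covX
  have e : tilt c r g h q = fun o => 1 + spin c r (varA o) * (r⁻¹ * g (covX o)) +
      spin c r (varY o) * (r⁻¹ * h (covX o)) + spin c r (varA o) * spin c r (varY o) *
      ((r ^ 2)⁻¹ * ((q - c ^ 2) - c * (g (covX o) + h (covX o)))) := by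
    ext o; unfold tilt; ring
  rw [e]
  exact (((BddMeas.const 1).add (hA.mul (hgX.const_mul _))).add (hY.mul (hhX.const_mul _))).add
    ((hA.mul hY).mul (((BddMeas.const _).sub ((hgX.add hhX).const_mul c)).const_mul _))

lemma tilt_nonneg {c r δ q : ℝ} {g h : (Fin d → ℝ) → ℝ} (hr : 0 < r)
    (hδ : δ * (2 / r + (1 + 2 * |c|) / r ^ 2) ≤ 1) (hg : ∀ x, |g x| ≤ δ) (hh : ∀ x, |h x| ≤ δ)
    (hq : |q - c ^ 2| ≤ δ) (o : Obs d) : 0 ≤ tilt c r g h q o := by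
  have hδ0 : 0 ≤ δ := (abs_nonneg _).trans hq
  have key : ∀ s u D : ℝ, |s| ≤ 1 → |u| ≤ D → -D ≤ s * u := by
    intro s u D hs hu
    have : |s * u| ≤ D := by
      rw [abs_mul]
      nlinarith [abs_nonneg s, abs_nonneg u]
    exact neg_le_of_abs_le this
  have h1 := key _ (g (covX o) / r) (δ / r) (abs_spin_le c r (varA o)) (by
    rw [abs_div, abs_of_pos hr]; gcongr; exact hg _)
  have h2 := key _ (h (covX o) / r) (δ / r) (abs_spin_le c r (varY o)) (by
    rw [abs_div, abs_of_pos hr]; gcongr; exact hh _)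
  have h3 := key (spin c r (varA o) * spin c r (varY o))
    ((q - c ^ 2 - c * (g (covX o) + h (covX o))) / r ^ 2) ((δ + |c| * (δ + δ)) / r ^ 2) (by
      rw [abs_mul]
      exact mul_le_one₀ (abs_spin_le _ _ _) (abs_nonneg _) (abs_spin_le _ _ _)) (by
      rw [abs_div, abs_of_pos (by positivity : 0 < r ^ 2)]
      gcongr
      refine (abs_sub _ _).trans (add_le_add hq ?_)
      rw [abs_mul]
      gcongr
      exact (abs_add_le _ _).trans (add_le_add (hg _) (hh _)))
  have e : δ * (2 / r + (1 + 2 * |c|) / r ^ 2) = δ / r + δ / r + (δ + |c| * (δ + δ)) / r ^ 2 := by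
    field_simp; ring
  unfold tilt
  linarith

section Tilted

variable {c r q : ℝ} {g h : (Fin d → ℝ) → ℝ}

/-- The conditions under which `tiltedLaw c r g h q` is a probability law with values in
`[C₁, C₂]`. -/
structure IsTilt (C₁ C₂ c r : ℝ) (g h : (Fin d → ℝ) → ℝ) (q : ℝ) : Prop where
  pos : 0 < r
  bdd_g : BddMeas g
  bdd_h : BddMeas h
  nonneg : ∀ o, 0 ≤ tilt c r g h q o
  le_sub : C₁ ≤ c - r
  add_le : c + r ≤ C₂

lemma bddMeas_indicator_one {Ω : Type*} [MeasurableSpace Ω] {s : Set Ω} (hs : MeasurableSet s) :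
    BddMeas (s.indicator fun _ => (1 : ℝ)) :=
  BddMeas.of_le (C := 1) (measurable_const.indicator hs) fun x => by
    by_cases hx : x ∈ s
    · rw [Set.indicator_of_mem hx, abs_one]
    · rw [Set.indicator_of_notMem hx, abs_zero]; exact zero_le_one

lemma clamp_of_mem {C₁ C₂ a : ℝ} (ha : a ∈ Icc C₁ C₂) : max C₁ (min C₂ a) = a := by
  rw [min_eq_right ha.2, max_eq_right ha.1]

namespace IsTilt

variable {C₁ C₂ : ℝ}

lemma isProbabilityMeasure (H : IsTilt C₁ C₂ c r g h q) :
    IsProbabilityMeasure (tiltedLaw c r g h q) := by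
  refine ⟨?_⟩
  have hr := H.pos
  have ht := bddMeas_tilt c r H.bdd_g H.bdd_h q
  rw [tiltedLaw, withDensity_apply _ MeasurableSet.univ, Measure.restrict_univ,
    ← ofReal_integral_eq_lintegral_ofReal (ht.integrable _) (ae_of_all _ H.nonneg),
    integral_baseLaw c r ht]
  have e : ∀ x : Fin d → ℝ, (tilt c r g h q (x, c - r, c - r) + tilt c r g h q (x, c - r, c + r) +
      tilt c r g h q (x, c + r, c - r) + tilt c r g h q (x, c + r, c + r)) / 4 = 1 := by
    intro x
    simp only [tilt, varA, varY, covX, spin_sub hr, spin_add hr]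
    ring
  simp [e]

lemma integral_eq (H : IsTilt C₁ C₂ c r g h q) {G : Obs d → ℝ} (hG : BddMeas G) :
    ∫ o, G o ∂tiltedLaw c r g h q =
      ∫ x, (tilt c r g h q (x, c - r, c - r) * G (x, c - r, c - r) +
        tilt c r g h q (x, c - r, c + r) * G (x, c - r, c + r) +
        tilt c r g h q (x, c + r, c - r) * G (x, c + r, c - r) +
        tilt c r g h q (x, c + r, c + r) * G (x, c + r, c + r)) / 4 ∂cubeMeasure d := by
  have ht := bddMeas_tilt c r H.bdd_g H.bdd_h q
  rw [tiltedLaw, integral_withDensity_eq_integral_toReal_smul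
    ht.meas.ennreal_ofReal (ae_of_all _ fun _ => ENNReal.ofReal_lt_top)]
  simp_rw [ENNReal.toReal_ofReal (H.nonneg _), smul_eq_mul]
  exact integral_baseLaw c r (ht.mul hG)

lemma integral_covX (H : IsTilt C₁ C₂ c r g h q) {F : (Fin d → ℝ) → ℝ} (hF : BddMeas F) :
    ∫ o, F (covX o) ∂tiltedLaw c r g h q = ∫ x, F x ∂cubeMeasure d := by
  rw [H.integral_eq (hF.comp measurable_covX)]
  congr 1; ext x
  simp only [tilt, varA, varY, covX, spin_sub H.pos, spin_add H.pos]
  ring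

lemma map_covX (H : IsTilt C₁ C₂ c r g h q) :
    (tiltedLaw c r g h q).map covX = volume.restrict (Icc 0 1) := by
  have := H.isProbabilityMeasure
  change _ = cubeMeasure d
  ext s hs
  have h := H.integral_covX (bddMeas_indicator_one hs)
  rw [integral_indicator hs, setIntegral_const] at h
  rw [show (fun o : Obs d => s.indicator (fun _ => (1 : ℝ)) (covX o)) =
    (covX ⁻¹' s).indicator fun _ => (1 : ℝ) from rfl, integral_indicator (measurable_covX hs),
    setIntegral_const] at h
  simp only [smul_eq_mul, mul_one] at h
  rw [Measure.map_apply measurable_covX hs]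
  exact (measureReal_eq_measureReal_iff).1 h

lemma ae_mem (H : IsTilt C₁ C₂ c r g h q) {s : Set (Obs d)} (hs : MeasurableSet s)
    (hmem : ∀ x a y, a = c - r ∨ a = c + r → y = c - r ∨ y = c + r → (x, a, y) ∈ s) :
    ∀ᵐ o ∂tiltedLaw c r g h q, o ∈ s := by
  have := H.isProbabilityMeasure
  have h1 := H.integral_eq (bddMeas_indicator_one hs.compl)
  have h2 : ∀ x a y, a = c - r ∨ a = c + r → y = c - r ∨ y = c + r →
      sᶜ.indicator (fun _ => (1 : ℝ)) (x, a, y) = 0 := fun x a y ha hy =>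
    Set.indicator_of_notMem (Set.notMem_compl_iff.2 (hmem x a y ha hy)) _
  simp only [h2, true_or, or_true, mul_zero, add_zero, zero_div, integral_zero] at h1
  rw [integral_indicator hs.compl, setIntegral_const] at h1
  simp only [smul_eq_mul, mul_one] at h1
  exact (measureReal_eq_zero_iff).1 h1

lemma mem_Icc (H : IsTilt C₁ C₂ c r g h q) {a : ℝ} (ha : a = c - r ∨ a = c + r) :
    a ∈ Icc C₁ C₂ := by
  have h1 := H.pos
  have h2 := H.le_sub
  have h3 := H.add_le
  rcases ha with rfl | rfl <;> constructor <;> linarith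

lemma ae_varA (H : IsTilt C₁ C₂ c r g h q) :
    ∀ᵐ o ∂tiltedLaw c r g h q, varA o ∈ Icc C₁ C₂ :=
  H.ae_mem (measurable_varA measurableSet_Icc) fun _ _ _ ha _ => H.mem_Icc ha

lemma ae_varY (H : IsTilt C₁ C₂ c r g h q) :
    ∀ᵐ o ∂tiltedLaw c r g h q, varY o ∈ Icc C₁ C₂ :=
  H.ae_mem (measurable_varY measurableSet_Icc) fun _ _ _ _ hy => H.mem_Icc hy

lemma integral_varA (H : IsTilt C₁ C₂ c r g h q) {F : (Fin d → ℝ) → ℝ} (hF : BddMeas F) :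
    ∫ o, varAc C₁ C₂ o * F (covX o) ∂tiltedLaw c r g h q =
      ∫ x, (c + g x) * F x ∂cubeMeasure d := by
  rw [H.integral_eq ((bddMeas_varAc C₁ C₂).mul (hF.comp measurable_covX))]
  congr 1; ext x
  have hr := H.pos
  have e1 := clamp_of_mem (H.mem_Icc (Or.inl rfl))
  have e2 := clamp_of_mem (H.mem_Icc (Or.inr rfl))
  simp only [tilt, varAc, varA, varY, covX, spin_sub hr, spin_add hr, e1, e2]
  field_simp
  ring

lemma integral_varY (H : IsTilt C₁ C₂ c r g h q) {F : (Fin d → ℝ) → ℝ} (hF : BddMeas F) :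
    ∫ o, varYc C₁ C₂ o * F (covX o) ∂tiltedLaw c r g h q =
      ∫ x, (c + h x) * F x ∂cubeMeasure d := by
  rw [H.integral_eq ((bddMeas_varYc C₁ C₂).mul (hF.comp measurable_covX))]
  congr 1; ext x
  have hr := H.pos
  have e1 := clamp_of_mem (H.mem_Icc (Or.inl rfl))
  have e2 := clamp_of_mem (H.mem_Icc (Or.inr rfl))
  simp only [tilt, varYc, varA, varY, covX, spin_sub hr, spin_add hr, e1, e2]
  field_simp
  ring

lemma integral_mul (H : IsTilt C₁ C₂ c r g h q) {F : (Fin d → ℝ) → ℝ} (hF : BddMeas F) :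
    ∫ o, varAc C₁ C₂ o * varYc C₁ C₂ o * F (covX o) ∂tiltedLaw c r g h q =
      q * ∫ x, F x ∂cubeMeasure d := by
  rw [H.integral_eq (((bddMeas_varAc C₁ C₂).mul (bddMeas_varYc C₁ C₂)).mul
    (hF.comp measurable_covX)), ← integral_const_mul]
  congr 1; ext x
  have hr := H.pos
  have e1 := clamp_of_mem (H.mem_Icc (Or.inl rfl))
  have e2 := clamp_of_mem (H.mem_Icc (Or.inr rfl))
  simp only [tilt, varAc, varYc, varA, varY, covX, spin_sub hr, spin_add hr, e1, e2]
  field_simp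
  ring

end IsTilt

end Tilted

/-- A conditional expectation given `X` is determined by the integrals against bounded functions
of `X`. -/
lemma condExp_ae_eq_of_integral_mul {P : Measure (Obs d)} [IsProbabilityMeasure P]
    (hX : P.map covX = volume.restrict (Icc 0 1)) {V : Obs d → ℝ} (hV : BddMeas V)
    {p : (Fin d → ℝ) → ℝ} (hp : BddMeas p)
    (h : ∀ F, BddMeas F → ∫ o, V o * F (covX o) ∂P = ∫ x, p x * F x ∂cubeMeasure d) :
    condExp (sigmaX d) P V =ᵐ[P] fun o => p (covX o) := by
  have hpX : BddMeas fun o : Obs d => p (covX o) := hp.comp measurable_covX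
  refine (ae_eq_condExp_of_forall_setIntegral_eq sigmaX_le (hV.integrable P)
    (fun s _ _ => (hpX.integrable P).integrableOn) ?_ ?_).symm
  · rintro s ⟨t, ht, rfl⟩ -
    have hF : BddMeas (t.indicator fun _ : Fin d → ℝ => (1 : ℝ)) :=
      BddMeas.of_le (C := 1) (measurable_const.indicator ht) fun x => by
        by_cases hx : x ∈ t <;> simp [hx]
    have h1 := h _ hF
    have h2 := integral_comp_covX hX (hp.mul hF)
    have e : ∀ f : Obs d → ℝ, ∫ o in covX ⁻¹' t, f o ∂P =
        ∫ o, f o * t.indicator (fun _ => (1 : ℝ)) (covX o) ∂P := fun f => by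
      rw [← integral_indicator (measurable_covX ht)]
      congr 1; ext o
      by_cases ho : covX o ∈ t
      · rw [Set.indicator_of_mem (show o ∈ covX ⁻¹' t from ho), Set.indicator_of_mem ho, mul_one]
      · rw [Set.indicator_of_notMem (show o ∉ covX ⁻¹' t from ho), Set.indicator_of_notMem ho,
          mul_zero]
    rw [e, e, h1, h2]
  · exact (Measurable.stronglyMeasurable
      (hp.meas.comp (comap_measurable covX))).aestronglyMeasurable

/-- The moments that determine the expectation of the estimators, for a law under which
`E[A Y | X]` is constant. -/
structure HasMoments (θ : ModelParams) (P : Measure (Obs d)) (p b : (Fin d → ℝ) → ℝ) (q : ℝ) :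
    Prop where
  bdd_p : BddMeas p
  bdd_b : BddMeas b
  uniform : P.map covX = volume.restrict (Icc 0 1)
  mom_A : ∀ F, BddMeas F → ∫ o, varAc θ.C₁ θ.C₂ o * F (covX o) ∂P =
    ∫ x, p x * F x ∂cubeMeasure d
  mom_Y : ∀ F, BddMeas F → ∫ o, varYc θ.C₁ θ.C₂ o * F (covX o) ∂P =
    ∫ x, b x * F x ∂cubeMeasure d
  mom_AY : ∀ F, BddMeas F → ∫ o, varAc θ.C₁ θ.C₂ o * varYc θ.C₁ θ.C₂ o * F (covX o) ∂P =
    q * ∫ x, F x ∂cubeMeasure d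
  psi : expCondCov P = q - ∫ x, p x * b x ∂cubeMeasure d

/-- Tilted laws with Hölder continuous regression functions belong to the model. -/
lemma IsTilt.inModel {c r q : ℝ} {g h : (Fin d → ℝ) → ℝ} (H : IsTilt θ.C₁ θ.C₂ c r g h q)
    (hp : W.HolderBall θ.α θ.M fun x => c + g x) (hb : W.HolderBall θ.β θ.M fun x => c + h x) :
    InModel W θ (tiltedLaw c r g h q) ∧
      HasMoments θ (tiltedLaw c r g h q) (fun x => c + g x) (fun x => c + h x) q := by
  have hP := H.isProbabilityMeasure
  have hX := H.map_covX
  have hA := H.ae_varA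
  have hY := H.ae_varY
  have hp' : BddMeas fun x => c + g x := (BddMeas.const c).add H.bdd_g
  have hb' : BddMeas fun x => c + h x := (BddMeas.const c).add H.bdd_h
  have mA := fun F (hF : BddMeas F) => H.integral_varA hF
  have mY := fun F (hF : BddMeas F) => H.integral_varY hF
  have mAY := fun F (hF : BddMeas F) => H.integral_mul hF
  have eA : varA =ᵐ[tiltedLaw c r g h q] varAc θ.C₁ θ.C₂ := by
    filter_upwards [hA] with o ho using (clamp_of_mem ho).symm
  have eY : varY =ᵐ[tiltedLaw c r g h q] varYc θ.C₁ θ.C₂ := by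
    filter_upwards [hY] with o ho using (clamp_of_mem ho).symm
  have cA := (condExp_congr_ae eA).trans
    (condExp_ae_eq_of_integral_mul hX (bddMeas_varAc _ _) hp' mA)
  have cY := (condExp_congr_ae eY).trans
    (condExp_ae_eq_of_integral_mul hX (bddMeas_varYc _ _) hb' mY)
  refine ⟨⟨hP, hX, hA, hY, ⟨_, hp, cA⟩, ⟨_, hb, cY⟩⟩, ⟨hp', hb', hX, mA, mY, mAY, ?_⟩⟩
  rw [expCondCov_eq hX (bddMeas_varAc _ _) (bddMeas_varYc _ _) eA eY hp' hb' cA cY]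
  have := mAY (fun _ => 1) (BddMeas.const 1)
  simp only [mul_one, integral_const, probReal_univ, smul_eq_mul] at this
  rw [this]

lemma CDVData.IsCDV.bddMeas_bump (hW : W.IsCDV S) (l : ℕ) : BddMeas (W.bump (d := d) l) := by
  obtain ⟨C, -, hC⟩ := hW.exists_bump_le d
  exact ⟨(hW.continuous_bump l).measurable, _, hC l⟩

/-- A nonzero constant in the interior of the model. It supplies the bias of the diagonal terms,
which contain the factors `c ^ 2` and `E[A Y | X] = c ^ 2 ± ε`. -/
lemma exists_nonzero_const (hW : W.IsCDV S) (hS : 0 < S)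
    (hc : ∃ c ∈ Set.Ioo θ.C₁ θ.C₂, ∃ M' < θ.M,
      W.HolderBall θ.α M' (fun _ : Fin d → ℝ => c) ∧
      W.HolderBall θ.β M' (fun _ : Fin d → ℝ => c)) :
    ∃ c ∈ Set.Ioo θ.C₁ θ.C₂, c ≠ 0 ∧ ∃ M' < θ.M,
      W.HolderBall θ.α M' (fun _ : Fin d → ℝ => c) ∧
      W.HolderBall θ.β M' (fun _ : Fin d → ℝ => c) := by
  obtain ⟨c, hcI, M', hM', hcα, hcβ⟩ := hc
  by_cases h : c = 0
  · obtain ⟨D, hD0, hD⟩ := hW.exists_holderBall_const hS d θ.α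
    obtain ⟨D', hD0', hD'⟩ := hW.exists_holderBall_const hS d θ.β
    set η := min ((θ.C₂ - c) / 2) ((θ.M - M') / (2 * (D + D' + 1))) with hη
    have hη0 : 0 < η := lt_min (by linarith [hcI.2]) (div_pos (by linarith) (by positivity))
    have hη1 : η * (2 * (D + D' + 1)) ≤ θ.M - M' :=
      (le_div_iff₀ (by positivity)).1 (min_le_right _ _)
    have hη2 : η ≤ (θ.C₂ - c) / 2 := min_le_left _ _
    have e : |c + η - c| = η := by rw [add_sub_cancel_left, abs_of_pos hη0]
    have hmono : ∀ {α M₁ M₂ : ℝ} {f : (Fin d → ℝ) → ℝ}, M₁ ≤ M₂ → W.HolderBall α M₁ f →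
        W.HolderBall α M₂ f := fun h hf => ⟨hf.1, fun m₀ l m ι hl hι =>
      (hf.2 m₀ l m ι hl hι).trans h⟩
    refine ⟨c + η, ⟨by linarith [hcI.1], by linarith [hcI.2]⟩, by rw [h]; linarith,
      M' + (D + D') * η, by nlinarith [mul_nonneg hD0 hη0.le, mul_nonneg hD0' hη0.le], ?_, ?_⟩
    · refine hmono ?_ (hD M' c (c + η) hcα)
      rw [e]; nlinarith [mul_nonneg hD0' hη0.le]
    · refine hmono ?_ (hD' M' c (c + η) hcβ)
      rw [e]; nlinarith [mul_nonneg hD0 hη0.le]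
  · exact ⟨c, hcI, h, M', hM', hcα, hcβ⟩

/-- The laws used for the lower bounds: the regression functions are perturbed in the direction of
the sum of all wavelets of one level, and `E[A Y | X]` is a constant near `c ^ 2`. -/
lemma exists_tilted_family (hW : W.IsCDV S) (hS : 0 < S) (hd : 0 < d) (hα : 0 < θ.α)
    (hβ : 0 < θ.β)
    (hc : ∃ c ∈ Set.Ioo θ.C₁ θ.C₂, ∃ M' < θ.M,
      W.HolderBall θ.α M' (fun _ : Fin d → ℝ => c) ∧
      W.HolderBall θ.β M' (fun _ : Fin d → ℝ => c)) :
    ∃ c r ε : ℝ, 0 < ε ∧ ε ≤ c ^ 2 ∧ ∀ l, W.J₀ ≤ l → ∀ σ τ e : ℝ, |σ| ≤ 1 → |τ| ≤ 1 →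
      |e| ≤ ε → ∀ g h : (Fin d → ℝ) → ℝ,
      (g = fun x => σ * ε * 2 ^ (-((l : ℝ) * (θ.α + d / 2))) * W.bump l x) →
      (h = fun x => τ * ε * 2 ^ (-((l : ℝ) * (θ.β + d / 2))) * W.bump l x) →
      IsTilt θ.C₁ θ.C₂ c r g h (c ^ 2 + e) ∧ InModel W θ (tiltedLaw c r g h (c ^ 2 + e)) ∧
      HasMoments θ (tiltedLaw c r g h (c ^ 2 + e)) (fun x => c + g x) (fun x => c + h x)
        (c ^ 2 + e) := by
  obtain ⟨c, hcI, hc0, M', hM', hcα, hcβ⟩ := exists_nonzero_const hW hS hc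
  obtain ⟨C, hC0, hC⟩ := hW.exists_bump_le d
  obtain ⟨r, hr0, hr1, hr2⟩ : ∃ r, 0 < r ∧ θ.C₁ ≤ c - r ∧ c + r ≤ θ.C₂ :=
    ⟨min (c - θ.C₁) (θ.C₂ - c), lt_min (by linarith [hcI.1]) (by linarith [hcI.2]),
      by linarith [min_le_left (c - θ.C₁) (θ.C₂ - c)],
      by linarith [min_le_right (c - θ.C₁) (θ.C₂ - c)]⟩
  -- The constraints on `ε`: nonnegativity of `E[A Y | X]`, the radius of the Hölder balls, and
  -- nonnegativity of the density.
  set Q := 2 / r + (1 + 2 * |c|) / r ^ 2 with hQ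
  have hQ0 : 0 < Q := by positivity
  obtain ⟨ε, hε0, hε1, hε2, hε3⟩ : ∃ ε, 0 < ε ∧ ε ≤ c ^ 2 ∧ M' + ε ≤ θ.M ∧
      ε * (C + 1) * Q ≤ 1 := by
    refine ⟨min (c ^ 2) (min (θ.M - M') (1 / ((C + 1) * Q))), ?_, min_le_left _ _, ?_, ?_⟩
    · exact lt_min (by positivity) (lt_min (by linarith) (by positivity))
    · linarith [(min_le_right (c ^ 2) (min (θ.M - M') (1 / ((C + 1) * Q)))).trans
        (min_le_left _ _)]
    · rw [mul_assoc]
      exact (le_div_iff₀ (by positivity)).1 ((min_le_right _ _).trans (min_le_right _ _))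
  refine ⟨c, r, ε, hε0, hε1, fun l hl σ τ e hσ hτ he g h hg hh => ?_⟩
  have habs : ∀ (σ γ : ℝ), |σ| ≤ 1 → |σ * ε * 2 ^ (-((l : ℝ) * (γ + d / 2)))| ≤
      ε * 2 ^ (-((l : ℝ) * (γ + d / 2))) := fun σ γ hσ => by
    rw [abs_mul, abs_mul, abs_of_pos hε0, abs_of_nonneg (Real.rpow_nonneg two_pos.le _)]
    exact mul_le_mul_of_nonneg_right (mul_le_of_le_one_left hε0.le hσ) (by positivity)
  have hbd : ∀ (σ γ : ℝ) (x : Fin d → ℝ), |σ| ≤ 1 → 0 < γ →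
      |σ * ε * 2 ^ (-((l : ℝ) * (γ + d / 2))) * W.bump l x| ≤ ε * (C + 1) := by
    intro σ γ x hσ hγ
    rw [abs_mul]
    refine (mul_le_mul (habs σ γ hσ) (hC l x) (abs_nonneg _) (by positivity)).trans ?_
    have e1 : ε * (2 : ℝ) ^ (-((l : ℝ) * (γ + d / 2))) * (C * 2 ^ ((l : ℝ) * (d / 2))) =
        ε * C * (2 ^ (-((l : ℝ) * (γ + d / 2))) * 2 ^ ((l : ℝ) * (d / 2))) := by ring
    rw [e1, ← Real.rpow_add two_pos]
    have : (2 : ℝ) ^ (-((l : ℝ) * (γ + d / 2)) + (l : ℝ) * (d / 2)) ≤ 1 := by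
      apply Real.rpow_le_one_of_one_le_of_nonpos one_le_two
      have : 0 ≤ (l : ℝ) * γ := by positivity
      linarith
    nlinarith [mul_nonneg hε0.le hC0]
  have h0 : ∀ o, 0 ≤ tilt c r g h (c ^ 2 + e) o := by
    refine tilt_nonneg (δ := ε * (C + 1)) hr0 hε3 (fun x => ?_) (fun x => ?_) ?_
    · rw [hg]; exact hbd σ _ x hσ hα
    · rw [hh]; exact hbd τ _ x hτ hβ
    · rw [add_sub_cancel_left]; nlinarith [mul_nonneg hε0.le hC0]
  have H : IsTilt θ.C₁ θ.C₂ c r g h (c ^ 2 + e) := by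
    refine ⟨hr0, ?_, ?_, h0, hr1, hr2⟩
    · rw [hg]; exact (hW.bddMeas_bump l).const_mul _
    · rw [hh]; exact (hW.bddMeas_bump l).const_mul _
  refine ⟨H, H.inModel ?_ ?_⟩
  · rw [hg]; exact hW.holderBall_add_bump hd hl hcα hε2 (habs σ _ hσ)
  · rw [hh]; exact hW.holderBall_add_bump hd hl hcβ hε2 (habs τ _ hτ)

end

/-! ### Expectations of the estimators -/

section

section TripleSums

variable {Ω : Type*} [MeasurableSpace Ω] (P : Measure Ω) [IsProbabilityMeasure P] {n : ℕ}

lemma integral_eval_triple {i l m : Fin n} (hil : i ≠ l) (him : i ≠ m) (hlm : l ≠ m)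
    {f : Ω → Ω → Ω → ℝ} (hf : BddMeas fun q : Ω × Ω × Ω => f q.1 q.2.1 q.2.2) :
    ∫ z, f (z i) (z l) (z m) ∂sampleLaw P n = ∫ x, ∫ y, ∫ w, f x y w ∂P ∂P ∂P := by
  have h1 : BddMeas fun q : (Ω × Ω) × Ω => f q.1.1 q.1.2 q.2 :=
    hf.comp (u := fun q : (Ω × Ω) × Ω => (q.1.1, q.1.2, q.2)) (by fun_prop)
  rw [integral_resample P m (f := fun z => f (z i) (z l) (z m))
    (hf.comp (u := fun z : Fin n → Ω => (z i, z l, z m)) (by fun_prop))]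
  simp only [Function.update_self, Function.update_of_ne him, Function.update_of_ne hlm]
  exact integral_eval_pair P hil (F := fun x y => ∫ w, f x y w ∂P)
    (BddMeas.integral_right (F := fun (q : Ω × Ω) w => f q.1 q.2 w) h1 P)

lemma sum_pair_pattern (n : ℕ) (D E : ℝ) :
    ∑ i : Fin n, ∑ l : Fin n, (if i = l then E else D) = n * (n - 1) * D + n * E := by
  have e : ∀ i l : Fin n, (if i = l then E else D) = D + if i = l then E - D else 0 := by
    intro i l; split_ifs <;> ring
  simp_rw [e, Finset.sum_add_distrib]
  simp
  ring

/-- A sum over triples of indices, sorted by the coincidences between the indices. -/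
lemma sum_triple_pattern (n : ℕ) (D E₁ E₂ E₃ F : ℝ) :
    ∑ i : Fin n, ∑ l : Fin n, ∑ m : Fin n,
      (if i = l then (if l = m then F else E₁) else if i = m then E₂ else if l = m then E₃ else D) =
      n * (n - 1) * (n - 2) * D + n * (n - 1) * (E₁ + E₂ + E₃) + n * F := by
  have e : ∀ i l m : Fin n,
      (if i = l then (if l = m then F else E₁) else if i = m then E₂ else if l = m then E₃ else D) =
      D + (if i = l then E₁ - D else 0) + (if i = m then E₂ - D else 0) +
        (if l = m then E₃ - D else 0) +
        (if i = l then if l = m then F - E₁ - E₂ - E₃ + 2 * D else 0 else 0) := by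
    intro i l m
    by_cases h1 : i = l
    · subst h1
      by_cases h2 : i = m <;> simp [h2]; ring
    · by_cases h2 : i = m
      · subst h2
        simp [h1, Ne.symm h1]
      · simp [h1, h2]
        split_ifs <;> ring
  simp_rw [e, Finset.sum_add_distrib]
  have e2 : ∀ i l : Fin n, ∑ m : Fin n,
      (if i = l then if l = m then F - E₁ - E₂ - E₃ + 2 * D else 0 else 0) =
      if i = l then F - E₁ - E₂ - E₃ + 2 * D else 0 := by
    intro i l; split_ifs <;> simp
  simp_rw [e2]
  simp
  ring

/-- The expectation of a double sum over the sample. -/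
lemma integral_double_sum {f : Ω → Ω → ℝ} (hf : BddMeas fun q : Ω × Ω => f q.1 q.2) :
    ∫ z, ∑ i, ∑ l, f (z i) (z l) ∂sampleLaw P n =
      n * (n - 1) * (∫ x, ∫ y, f x y ∂P ∂P) + n * ∫ x, f x x ∂P := by
  have hb : ∀ i l : Fin n, BddMeas fun z : Fin n → Ω => f (z i) (z l) := fun i l =>
    hf.comp₂ (measurable_pi_apply i) (measurable_pi_apply l)
  rw [integral_finsetSum _ fun i _ => (BddMeas.sum _ fun l _ => hb i l).integrable _]
  simp_rw [fun i => integral_finsetSum (μ := sampleLaw P n) Finset.univ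
    fun (l : Fin n) _ => (hb i l).integrable _]
  rw [← sum_pair_pattern]
  refine Finset.sum_congr rfl fun i _ => Finset.sum_congr rfl fun l _ => ?_
  split_ifs with h
  · subst h
    exact integral_eval P i (f := fun x => f x x) (hf.comp₂ measurable_id measurable_id)
  · exact integral_eval_pair P h hf

/-- The expectation of a triple sum over the sample. -/
lemma integral_triple_sum {f : Ω → Ω → Ω → ℝ}
    (hf : BddMeas fun q : Ω × Ω × Ω => f q.1 q.2.1 q.2.2) :
    ∫ z, ∑ i, ∑ l, ∑ m, f (z i) (z l) (z m) ∂sampleLaw P n =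
      n * (n - 1) * (n - 2) * (∫ x, ∫ y, ∫ w, f x y w ∂P ∂P ∂P) +
        n * (n - 1) * ((∫ x, ∫ w, f x x w ∂P ∂P) + (∫ x, ∫ y, f x y x ∂P ∂P) +
          ∫ x, ∫ y, f x y y ∂P ∂P) + n * ∫ x, f x x x ∂P := by
  have hb : ∀ i l m : Fin n, BddMeas fun z : Fin n → Ω => f (z i) (z l) (z m) := fun i l m =>
    hf.comp (u := fun z : Fin n → Ω => (z i, z l, z m)) (by fun_prop)
  rw [integral_finsetSum _ fun i _ => (BddMeas.sum _ fun l _ => BddMeas.sum _ fun m _ =>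
    hb i l m).integrable _]
  rw [← sum_triple_pattern]
  refine Finset.sum_congr rfl fun i _ => ?_
  rw [integral_finsetSum _ fun l _ => (BddMeas.sum _ fun m _ => hb i l m).integrable _]
  refine Finset.sum_congr rfl fun l _ => ?_
  rw [integral_finsetSum _ fun m _ => (hb i l m).integrable _]
  refine Finset.sum_congr rfl fun m _ => ?_
  split_ifs with h1 h2 h3 h4
  · subst h1; subst h2
    exact integral_eval P i (f := fun x => f x x x)
      (hf.comp (u := fun x => (x, x, x)) (by fun_prop))
  · subst h1
    exact integral_eval_pair P h2 (F := fun x w => f x x w)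
      (hf.comp (u := fun q : Ω × Ω => (q.1, q.1, q.2)) (by fun_prop))
  · subst h3
    exact integral_eval_pair P h1 (F := fun x y => f x y x)
      (hf.comp (u := fun q : Ω × Ω => (q.1, q.2, q.1)) (by fun_prop))
  · subst h4
    exact integral_eval_pair P h1 (F := fun x y => f x y y)
      (hf.comp (u := fun q : Ω × Ω => (q.1, q.2, q.2)) (by fun_prop))
  · exact integral_eval_triple P h1 h3 h4 hf

end TripleSums

variable {d : ℕ} {W : CDVData} {S : ℕ} {θ : ModelParams} {n : ℕ} {P : Measure (Obs d)}
  {p b : (Fin d → ℝ) → ℝ} {q : ℝ}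

lemma CDVData.IsCDV.bddMeas_kernelC_self (hW : W.IsCDV S) (j : ℕ) :
    BddMeas fun x : Fin d → ℝ => W.kernelC j x x :=
  (hW.bddMeas_kernelC j).comp₂ (F := fun x y => W.kernelC j x y) measurable_id measurable_id

lemma HasMoments.integral_mul (H : HasMoments θ P p b q) :
    ∫ o, varAc θ.C₁ θ.C₂ o * varYc θ.C₁ θ.C₂ o ∂P = q := by
  simpa using H.mom_AY (fun _ => 1) (BddMeas.const 1)

variable [IsProbabilityMeasure P]

lemma integral_avg (hn : 0 < n) {f : Obs d → ℝ} (hf : BddMeas f) :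
    ∫ z, (1 / (n : ℝ)) * ∑ i, f (z i) ∂sampleLaw P n = ∫ w, f w ∂P := by
  have hn' : (0 : ℝ) < n := by exact_mod_cast hn
  rw [integral_const_mul, integral_finsetSum _ fun i _ =>
    (hf.comp (measurable_pi_apply i)).integrable _]
  simp [integral_eval P _ hf, hn'.ne']

/-- The expectation of the average over the sample of a variable times a kernel estimator: the
diagonal terms contribute the resolution divided by the sample size. -/
lemma integral_avg_mul_kernelEst (hW : W.IsCDV S) {j : ℕ} (hj : W.J₀ ≤ j) (hn : 0 < n)
    {V U : Obs d → ℝ} (hV : BddMeas V) (hU : BddMeas U) (hb : BddMeas b)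
    (mV : ∀ F, BddMeas F → ∫ o, V o * F (covX o) ∂P = ∫ x, p x * F x ∂cubeMeasure d)
    (mU : ∀ F, BddMeas F → ∫ o, U o * F (covX o) ∂P = ∫ x, b x * F x ∂cubeMeasure d)
    (mVU : ∀ F, BddMeas F → ∫ o, V o * U o * F (covX o) ∂P = q * ∫ x, F x ∂cubeMeasure d) :
    ∫ z, (1 / (n : ℝ)) * ∑ i, V (z i) * kernelEst (obsKernel W j) U z (z i) ∂sampleLaw P n =
      (1 - 1 / n) * (∫ x, p x * W.proj j b x ∂cubeMeasure d) + q * 2 ^ (j * d) / n := by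
  have hn' : (0 : ℝ) < n := by exact_mod_cast hn
  have hf : BddMeas fun o : Obs d × Obs d => V o.1 * (U o.2 * obsKernel W j o.2 o.1) :=
    (hV.comp measurable_fst).mul ((hU.comp measurable_snd).mul
      ((hW.bddMeas_obsKernel j).comp₂ (F := obsKernel W j) measurable_snd measurable_fst))
  have e : ∀ z : Fin n → Obs d,
      (1 / (n : ℝ)) * ∑ i, V (z i) * kernelEst (obsKernel W j) U z (z i) =
      (1 / (n : ℝ) ^ 2) * ∑ i, ∑ l, V (z i) * (U (z l) * obsKernel W j (z l) (z i)) := by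
    intro z
    unfold kernelEst
    simp_rw [Finset.mul_sum]
    refine Finset.sum_congr rfl fun i _ => Finset.sum_congr rfl fun l _ => ?_
    field_simp
  simp_rw [e]
  rw [integral_const_mul, integral_double_sum P
    (f := fun x y => V x * (U y * obsKernel W j y x)) hf]
  have e1 : ∫ x, ∫ y, V x * (U y * obsKernel W j y x) ∂P ∂P =
      ∫ x, p x * W.proj j b x ∂cubeMeasure d := by
    rw [← integral_mul_kernelMean hW mV mU hb j]
    simp_rw [integral_const_mul]
    rfl
  have e2 : ∫ x, V x * (U x * obsKernel W j x x) ∂P = q * 2 ^ (j * d) := by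
    rw [← hW.integral_kernelC_self hj, ← mVU _ (hW.bddMeas_kernelC_self j)]
    simp_rw [← mul_assoc]
    rfl
  rw [e1, e2]
  field_simp

/-- The expectation of the average over the sample of the product of the two kernel estimators,
sorted by coincidences between the three observations that enter each term. -/
lemma integral_avg_kernelEst_mul (hW : W.IsCDV S) {j₁ j₂ : ℕ} (h₁ : W.J₀ ≤ j₁) (h₂ : W.J₀ ≤ j₂)
    (hn : 0 < n) (H : HasMoments θ P p b q) :
    ∫ z, (1 / (n : ℝ)) * ∑ i, kernelEst (obsKernel W j₁) (varAc θ.C₁ θ.C₂) z (z i) *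
        kernelEst (obsKernel W j₂) (varYc θ.C₁ θ.C₂) z (z i) ∂sampleLaw P n =
      (1 - 1 / n) * (1 - 2 / n) * (∫ x, p x * W.proj (min j₁ j₂) b x ∂cubeMeasure d) +
      (1 / n) * (1 - 1 / n) * ((∫ x, p x * (W.kernelC j₁ x x * W.proj j₂ b x) ∂cubeMeasure d) +
        (∫ x, b x * (W.proj j₁ p x * W.kernelC j₂ x x) ∂cubeMeasure d) +
        q * 2 ^ (min j₁ j₂ * d)) +
      (1 / n ^ 2) * (q * ∫ x, W.kernelC j₁ x x * W.kernelC j₂ x x ∂cubeMeasure d) := by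
  have hn' : (0 : ℝ) < n := by exact_mod_cast hn
  set A : Obs d → ℝ := varAc θ.C₁ θ.C₂ with hA
  set Y : Obs d → ℝ := varYc θ.C₁ θ.C₂ with hY
  have bA : BddMeas A := bddMeas_varAc _ _
  have bY : BddMeas Y := bddMeas_varYc _ _
  let f : Obs d → Obs d → Obs d → ℝ := fun x y w =>
    (A y * obsKernel W j₁ y x) * (Y w * obsKernel W j₂ w x)
  have hf : BddMeas fun o : Obs d × Obs d × Obs d => f o.1 o.2.1 o.2.2 :=
    ((bA.comp (u := fun o : Obs d × Obs d × Obs d => o.2.1) (by fun_prop)).mul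
      ((hW.bddMeas_obsKernel j₁).comp₂ (F := obsKernel W j₁)
        (u := fun o : Obs d × Obs d × Obs d => o.2.1) (v := fun o => o.1)
        (by fun_prop) (by fun_prop))).mul
    ((bY.comp (u := fun o : Obs d × Obs d × Obs d => o.2.2) (by fun_prop)).mul
      ((hW.bddMeas_obsKernel j₂).comp₂ (F := obsKernel W j₂)
        (u := fun o : Obs d × Obs d × Obs d => o.2.2) (v := fun o => o.1)
        (by fun_prop) (by fun_prop)))
  have e : ∀ z : Fin n → Obs d, (1 / (n : ℝ)) * ∑ i, kernelEst (obsKernel W j₁) A z (z i) *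
        kernelEst (obsKernel W j₂) Y z (z i) =
      (1 / (n : ℝ) ^ 3) * ∑ i, ∑ l, ∑ m, f (z i) (z l) (z m) := by
    intro z
    unfold kernelEst
    rw [Finset.mul_sum, Finset.mul_sum]
    refine Finset.sum_congr rfl fun i _ => ?_
    rw [mul_mul_mul_comm, Finset.sum_mul_sum, Finset.mul_sum, Finset.mul_sum, Finset.mul_sum]
    refine Finset.sum_congr rfl fun l _ => ?_
    simp only [f]
    rw [← mul_assoc]
    congr 1
    field_simp
  simp_rw [e]
  rw [integral_const_mul, integral_triple_sum P hf]
  -- All three observations are distinct, two of them coincide, or all of them coincide.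
  have eD : ∫ x, ∫ y, ∫ w, f x y w ∂P ∂P ∂P =
      ∫ x, p x * W.proj (min j₁ j₂) b x ∂cubeMeasure d := by
    rw [← integral_kernelMean_mul_kernelMean hW H.uniform H.mom_A H.mom_Y H.bdd_p H.bdd_b h₁ h₂]
    simp only [f]
    simp_rw [integral_const_mul, integral_mul_const]
    rfl
  have e1 : ∫ x, ∫ w, f x x w ∂P ∂P =
      ∫ x, p x * (W.kernelC j₁ x x * W.proj j₂ b x) ∂cubeMeasure d := by
    rw [← H.mom_A _ ((hW.bddMeas_kernelC_self j₁).mul (hW.bddMeas_proj j₂ H.bdd_b))]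
    simp only [f]
    simp_rw [integral_const_mul, mul_assoc]
    congr 1; ext x
    rw [← kernelMean_obsKernel hW H.mom_Y]
    rfl
  have e2 : ∫ x, ∫ y, f x y x ∂P ∂P =
      ∫ x, b x * (W.proj j₁ p x * W.kernelC j₂ x x) ∂cubeMeasure d := by
    rw [← H.mom_Y _ ((hW.bddMeas_proj j₁ H.bdd_p).mul (hW.bddMeas_kernelC_self j₂))]
    simp only [f]
    simp_rw [integral_mul_const]
    congr 1; ext x
    rw [← kernelMean_obsKernel hW H.mom_A]
    change kernelMean P (obsKernel W j₁) A x * (Y x * W.kernelC j₂ (covX x) (covX x)) = _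
    ring
  have e3 : ∫ x, ∫ y, f x y y ∂P ∂P = q * 2 ^ (min j₁ j₂ * d) := by
    have h : ∀ x, ∫ y, f x y y ∂P = q * W.kernelC (min j₁ j₂) (covX x) (covX x) := by
      intro x
      have hF : BddMeas fun y => W.kernelC j₁ (covX x) y * W.kernelC j₂ y (covX x) :=
        ((hW.bddMeas_kernelC j₁).mk_right (F := fun x y => W.kernelC j₁ x y) _).mul
          ((hW.bddMeas_kernelC j₂).mk_left (F := fun x y => W.kernelC j₂ x y) _)
      rw [← hW.integral_kernelC_kernelC h₁ h₂, ← H.mom_AY _ hF]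
      congr 1; ext y
      simp only [f, obsKernel]
      rw [CDVData.kernelC_comm j₁ (covX y)]
      ring
    simp_rw [h]
    rw [integral_const_mul, integral_comp_covX H.uniform (hW.bddMeas_kernelC_self _),
      hW.integral_kernelC_self (le_min h₁ h₂)]
  have e4 : ∫ x, f x x x ∂P = q * ∫ x, W.kernelC j₁ x x * W.kernelC j₂ x x ∂cubeMeasure d := by
    rw [← H.mom_AY _ ((hW.bddMeas_kernelC_self j₁).mul (hW.bddMeas_kernelC_self j₂))]
    congr 1; ext x
    simp only [f, obsKernel]
    ring
  rw [eD, e1, e2, e3, e4]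
  field_simp

/-- The expectation of the integral-based estimator. -/
lemma HasMoments.integral_cleanINT (H : HasMoments θ P p b q) (hW : W.IsCDV S) {j₁ j₂ : ℕ}
    (h₁ : W.J₀ ≤ j₁) (h₂ : W.J₀ ≤ j₂) (hn : 0 < n) :
    ∫ z, cleanINT W θ j₁ j₂ n z ∂sampleLaw P n =
      q - ((1 - 1 / n) * (∫ x, p x * W.proj (min j₁ j₂) b x ∂cubeMeasure d) +
        q * 2 ^ (min j₁ j₂ * d) / n) := by
  have bA : BddMeas (varAc (d := d) θ.C₁ θ.C₂) := bddMeas_varAc _ _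
  have bY : BddMeas (varYc (d := d) θ.C₁ θ.C₂) := bddMeas_varYc _ _
  unfold cleanINT
  rw [integral_sub ((BddMeas.avg (bA.mul bY) n).integrable _)
    (((BddMeas.sum _ fun (i : Fin n) _ => (bA.comp (measurable_pi_apply i)).mul
      (bddMeas_kernelEst_eval hW _ bY i)).const_mul _).integrable _),
    integral_avg hn (bA.mul bY), H.integral_mul,
    integral_avg_mul_kernelEst hW (le_min h₁ h₂) hn bA bY H.bdd_b H.mom_A H.mom_Y H.mom_AY]

/-- The expectation of the Monte Carlo estimator. -/
lemma HasMoments.integral_cleanMC (H : HasMoments θ P p b q) (hW : W.IsCDV S) {j₁ j₂ : ℕ}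
    (h₁ : W.J₀ ≤ j₁) (h₂ : W.J₀ ≤ j₂) (hn : 0 < n) :
    ∫ z, cleanMC W θ j₁ j₂ n z ∂sampleLaw P n = q -
      ((1 - 1 / n) * (1 - 2 / n) * (∫ x, p x * W.proj (min j₁ j₂) b x ∂cubeMeasure d) +
      (1 / n) * (1 - 1 / n) * ((∫ x, p x * (W.kernelC j₁ x x * W.proj j₂ b x) ∂cubeMeasure d) +
        (∫ x, b x * (W.proj j₁ p x * W.kernelC j₂ x x) ∂cubeMeasure d) +
        q * 2 ^ (min j₁ j₂ * d)) +
      (1 / n ^ 2) * (q * ∫ x, W.kernelC j₁ x x * W.kernelC j₂ x x ∂cubeMeasure d)) := by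
  have bA : BddMeas (varAc (d := d) θ.C₁ θ.C₂) := bddMeas_varAc _ _
  have bY : BddMeas (varYc (d := d) θ.C₁ θ.C₂) := bddMeas_varYc _ _
  unfold cleanMC
  rw [integral_sub ((BddMeas.avg (bA.mul bY) n).integrable _)
    (((BddMeas.sum _ fun (i : Fin n) _ => (bddMeas_kernelEst_eval hW _ bA i).mul
      (bddMeas_kernelEst_eval hW _ bY i)).const_mul _).integrable _),
    integral_avg hn (bA.mul bY), H.integral_mul, integral_avg_kernelEst_mul hW h₁ h₂ hn H]

/-- The expectation of the influence function based estimator. -/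
lemma HasMoments.integral_cleanIF (H : HasMoments θ P p b q) (hW : W.IsCDV S) {j₁ j₂ : ℕ}
    (h₁ : W.J₀ ≤ j₁) (h₂ : W.J₀ ≤ j₂) (hn : 0 < n) :
    ∫ z, cleanIF W θ j₁ j₂ n z ∂sampleLaw P n = q -
      ((1 - 1 / n) * (∫ x, p x * W.proj j₂ b x ∂cubeMeasure d) + q * 2 ^ (j₂ * d) / n) -
      ((1 - 1 / n) * (∫ x, b x * W.proj j₁ p x ∂cubeMeasure d) + q * 2 ^ (j₁ * d) / n) +
      ((1 - 1 / n) * (1 - 2 / n) * (∫ x, p x * W.proj (min j₁ j₂) b x ∂cubeMeasure d) +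
      (1 / n) * (1 - 1 / n) * ((∫ x, p x * (W.kernelC j₁ x x * W.proj j₂ b x) ∂cubeMeasure d) +
        (∫ x, b x * (W.proj j₁ p x * W.kernelC j₂ x x) ∂cubeMeasure d) +
        q * 2 ^ (min j₁ j₂ * d)) +
      (1 / n ^ 2) * (q * ∫ x, W.kernelC j₁ x x * W.kernelC j₂ x x ∂cubeMeasure d)) := by
  have bA : BddMeas (varAc (d := d) θ.C₁ θ.C₂) := bddMeas_varAc _ _
  have bY : BddMeas (varYc (d := d) θ.C₁ θ.C₂) := bddMeas_varYc _ _
  have e : ∀ z : Fin n → Obs d, cleanIF W θ j₁ j₂ n z =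
      (1 / (n : ℝ)) * ∑ i, varAc θ.C₁ θ.C₂ (z i) * varYc θ.C₁ θ.C₂ (z i) -
      (1 / (n : ℝ)) * ∑ i, varAc θ.C₁ θ.C₂ (z i) *
        kernelEst (obsKernel W j₂) (varYc θ.C₁ θ.C₂) z (z i) -
      (1 / (n : ℝ)) * ∑ i, varYc θ.C₁ θ.C₂ (z i) *
        kernelEst (obsKernel W j₁) (varAc θ.C₁ θ.C₂) z (z i) +
      (1 / (n : ℝ)) * ∑ i, kernelEst (obsKernel W j₁) (varAc θ.C₁ θ.C₂) z (z i) *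
        kernelEst (obsKernel W j₂) (varYc θ.C₁ θ.C₂) z (z i) := by
    intro z
    unfold cleanIF
    rw [← mul_sub, ← mul_sub, ← mul_add, ← Finset.sum_sub_distrib, ← Finset.sum_sub_distrib,
      ← Finset.sum_add_distrib]
    congr 1
    refine Finset.sum_congr rfl fun i _ => ?_
    ring
  simp_rw [e]
  have b1 := BddMeas.avg (bA.mul bY) n
  have b2 := ((BddMeas.sum Finset.univ fun (i : Fin n) _ => (bA.comp (measurable_pi_apply i)).mul
      (bddMeas_kernelEst_eval hW j₂ bY i)).const_mul (1 / (n : ℝ)))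
  have b3 := ((BddMeas.sum Finset.univ fun (i : Fin n) _ => (bY.comp (measurable_pi_apply i)).mul
      (bddMeas_kernelEst_eval hW j₁ bA i)).const_mul (1 / (n : ℝ)))
  have b4 := ((BddMeas.sum Finset.univ fun (i : Fin n) _ => (bddMeas_kernelEst_eval hW j₁ bA i).mul
      (bddMeas_kernelEst_eval hW j₂ bY i)).const_mul (1 / (n : ℝ)))
  have mYA : ∀ F, BddMeas F → ∫ o, varYc θ.C₁ θ.C₂ o * varAc θ.C₁ θ.C₂ o * F (covX o) ∂P =
      q * ∫ x, F x ∂cubeMeasure d := fun F hF => by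
    rw [← H.mom_AY F hF]
    simp_rw [mul_comm (varYc θ.C₁ θ.C₂ _)]
  rw [integral_add (((b1.sub b2).sub b3).integrable _) (b4.integrable _),
    integral_sub ((b1.sub b2).integrable _) (b3.integrable _),
    integral_sub (b1.integrable _) (b2.integrable _),
    integral_avg hn (bA.mul bY), H.integral_mul,
    integral_avg_mul_kernelEst hW h₂ hn bA bY H.bdd_b H.mom_A H.mom_Y H.mom_AY,
    integral_avg_mul_kernelEst hW h₁ hn bY bA H.bdd_p H.mom_Y H.mom_A mYA,
    integral_avg_kernelEst_mul hW h₁ h₂ hn H]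

end

/-! ### Lower bounds for the worst-case risks -/

section

variable {d : ℕ} {W : CDVData} {S : ℕ} {θ : ModelParams} {n : ℕ}

/-- The worst-case risk is at least the squared bias under any law in the model. -/
lemma InModel.ofReal_bias_sq_le {P : Measure (Obs d)} (hP : InModel W θ P)
    {T : (Fin n → Obs d) → ℝ} (hT : BddMeas T) :
    ENNReal.ofReal ((∫ o, T o ∂(Measure.pi fun _ : Fin n => P) - expCondCov P) ^ 2) ≤
      worstRisk W θ T := by
  have := hP.prob
  refine le_trans ?_ (le_iSup₂_of_le P hP le_rfl)
  rw [← ofReal_integral_eq_lintegral_ofReal (((hT.sub (BddMeas.const _)).pow 2).integrable _)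
    (ae_of_all _ fun _ => sq_nonneg _)]
  refine ENNReal.ofReal_le_ofReal ?_
  set m := ∫ o, T o ∂(Measure.pi fun _ : Fin n => P) with hm
  set ψ := expCondCov P
  have h1 : ∀ o, (m - ψ) ^ 2 + 2 * (m - ψ) * (T o - m) ≤ (T o - ψ) ^ 2 := fun o => by
    nlinarith [sq_nonneg (T o - m)]
  have hb : BddMeas fun o => 2 * (m - ψ) * (T o - m) := (hT.sub (BddMeas.const _)).const_mul _
  have h2 := integral_mono (((BddMeas.const ((m - ψ) ^ 2)).add hb).integrable
    (Measure.pi fun _ : Fin n => P)) (((hT.sub (BddMeas.const ψ)).pow 2).integrable _) h1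
  rw [integral_add ((BddMeas.const _).integrable _) (hb.integrable _), integral_const_mul,
    integral_sub (hT.integrable _) ((BddMeas.const _).integrable _)] at h2
  simpa [← hm] using h2

section BumpMoments

variable {c u v : ℝ} {l : ℕ}

/-- The projections up to level `l` see only the constant part of the perturbed function. -/
lemma proj_add_bump (hW : W.IsCDV S) (hS : 0 < S) (hd : 0 < d) {j : ℕ} (hj : W.J₀ ≤ j)
    (hjl : j ≤ l) (x : Fin d → ℝ) : W.proj j (fun y => c + u * W.bump l y) x = c := by
  have hK : BddMeas fun y => W.kernelC j x y :=
    (hW.bddMeas_kernelC j).mk_right (F := fun x y => W.kernelC j x y) x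
  have h := hW.proj_bump hd hj hjl x
  unfold CDVData.proj at h ⊢
  have e : ∀ y, W.kernelC j x y * (c + u * W.bump l y) =
      W.kernelC j x y * c + u * (W.kernelC j x y * W.bump l y) := fun y => by ring
  simp_rw [e]
  rw [integral_add ((hK.mul (BddMeas.const c)).integrable _)
    ((hK.mul (hW.bddMeas_bump l)).const_mul u |>.integrable _), integral_mul_const,
    integral_const_mul, h, hW.integral_kernelC hS hj]
  ring

lemma integral_add_bump_mul (hW : W.IsCDV S) {F : (Fin d → ℝ) → ℝ} (hF : BddMeas F) :
    ∫ x, (c + u * W.bump l x) * (F x * c) ∂cubeMeasure d =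
      c ^ 2 * (∫ x, F x ∂cubeMeasure d) + c * u * ∫ x, W.bump l x * F x ∂cubeMeasure d := by
  have e : ∀ x, (c + u * W.bump l x) * (F x * c) =
      c ^ 2 * F x + c * u * (W.bump l x * F x) := fun x => by ring
  simp_rw [e]
  rw [integral_add (hF.const_mul _ |>.integrable _)
    (((hW.bddMeas_bump l).mul hF).const_mul _ |>.integrable _), integral_const_mul,
    integral_const_mul]

lemma integral_add_bump_mul_const (hW : W.IsCDV S) (hS : 0 < S) (hd : 0 < d) (hl : W.J₀ ≤ l) :
    ∫ x, (c + u * W.bump l x) * c ∂cubeMeasure d = c ^ 2 := by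
  have h := integral_add_bump_mul (c := c) (u := u) (l := l) hW (d := d) (BddMeas.const 1)
  simp only [one_mul, mul_one, hW.integral_bump hS hd hl] at h
  simpa using h

lemma integral_add_bump_mul_add_bump (hW : W.IsCDV S) (hS : 0 < S) (hd : 0 < d)
    (hl : W.J₀ ≤ l) :
    ∫ x, (c + u * W.bump l x) * (c + v * W.bump l x) ∂cubeMeasure d =
      c ^ 2 + u * v * 2 ^ (l * d) := by
  have hb : BddMeas (W.bump (d := d) l) := hW.bddMeas_bump l
  have e : ∀ x : Fin d → ℝ, (c + u * W.bump l x) * (c + v * W.bump l x) =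
      c ^ 2 + c * (u + v) * W.bump l x + u * v * (W.bump l x * W.bump l x) := fun x => by ring
  simp_rw [e]
  rw [integral_add (((BddMeas.const _).add (hb.const_mul _)).integrable _)
    ((hb.mul hb).const_mul _ |>.integrable _), integral_add ((BddMeas.const _).integrable _)
    (hb.const_mul _ |>.integrable _), integral_const_mul, integral_const_mul,
    hW.integral_bump hS hd hl, hW.integral_bump_sq hl]
  simp

end BumpMoments

/-- The inner product of the two scaled bumps: the loss of covariance that the projections miss. -/
lemma two_rpow_bump (α β ε σ τ : ℝ) (d l : ℕ) :
    (σ * ε * 2 ^ (-((l : ℝ) * (α + d / 2)))) * (τ * ε * 2 ^ (-((l : ℝ) * (β + d / 2)))) *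
      (2 : ℝ) ^ (l * d) = σ * τ * (ε ^ 2 * 2 ^ (-((α + β) * l))) := by
  have e : (2 : ℝ) ^ (l * d) = 2 ^ ((l : ℝ) * d) := by
    rw [← Nat.cast_mul, Real.rpow_natCast]
  have e2 : (2 : ℝ) ^ (-((l : ℝ) * (α + d / 2))) * 2 ^ (-((l : ℝ) * (β + d / 2))) *
      2 ^ ((l : ℝ) * d) = 2 ^ (-((α + β) * l)) := by
    rw [← Real.rpow_add two_pos, ← Real.rpow_add two_pos]
    congr 1; ring
  rw [e, ← e2]
  ring

lemma two_pow_add_two_pow (j₁ j₂ d : ℕ) :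
    (2 : ℝ) ^ (j₁ * d) + 2 ^ (j₂ * d) = 2 ^ (max j₁ j₂ * d) + 2 ^ (min j₁ j₂ * d) := by
  rcases le_total j₁ j₂ with h | h
  · rw [max_eq_right h, min_eq_left h, add_comm]
  · rw [max_eq_left h, min_eq_right h]

/-- The terms of the bias that are odd in the perturbation cannot be controlled, but the sign of the
perturbation can be chosen such that they do no harm. -/
lemma exists_sign (x : ℝ) : ∃ σ : ℝ, |σ| ≤ 1 ∧ σ * σ = 1 ∧ 0 ≤ σ * x := by
  rcases le_total 0 x with h | h
  · exact ⟨1, by simp, by simp, by simpa using h⟩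
  · exact ⟨-1, by simp, by simp, by simpa using h⟩

lemma min_mul_add_le {a b x y : ℝ} (hx : 0 ≤ x) (hy : 0 ≤ y) :
    min a b * (x + y) ≤ a * x + b * y := by
  nlinarith [mul_le_mul_of_nonneg_right (min_le_left a b) hx,
    mul_le_mul_of_nonneg_right (min_le_right a b) hy]

/-- A lower bound for the risk from a lower bound for the bias. -/
lemma InModel.ofReal_sq_le_worstRisk {P : Measure (Obs d)} (hP : InModel W θ P)
    {T T' : (Fin n → Obs d) → ℝ} (hT : BddMeas T')
    (hTT' : ∀ P, InModel W θ P → T =ᵐ[Measure.pi fun _ : Fin n => P] T') {x : ℝ} (hx : 0 ≤ x)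
    (h : x ≤ |∫ o, T' o ∂(Measure.pi fun _ : Fin n => P) - expCondCov P|) :
    ENNReal.ofReal (x ^ 2) ≤ worstRisk W θ T := by
  rw [worstRisk_congr hTT']
  refine le_trans (ENNReal.ofReal_le_ofReal ?_) (hP.ofReal_bias_sq_le hT)
  rw [← sq_abs (_ - _)]
  exact pow_le_pow_left₀ hx h 2

/-- The bias of the Monte Carlo estimator, in terms of `t = 1 / n` and the resolutions `k₁`, `k₂`
with minimum `k` and maximum `K`. -/
lemma monteCarlo_bias_le {c ε t k K k₁ k₂ G I a b : ℝ} (ht : 0 < t) (ht2 : t ≤ 1 / 2)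
    (htε : 4 * c ^ 2 * t ≤ ε) (hεc : ε ≤ c ^ 2) (hε : 0 < ε) (hk : 1 ≤ k) (hK : 1 ≤ K)
    (hkK : k₁ + k₂ = K + k) (hG : 0 ≤ G) (hab : 0 ≤ a + b) :
    I + ε / 4 * (K * t) ≤ -(c ^ 2 + ε - ((1 - t) * (1 - 2 * t) * c ^ 2 + t * (1 - t) *
      (c ^ 2 * k₁ + a + (c ^ 2 * k₂ + b) + (c ^ 2 + ε) * k) +
      t ^ 2 * ((c ^ 2 + ε) * G)) - (c ^ 2 + ε - (c ^ 2 + -1 * I))) := by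
  -- `X` collects the contributions of pairs of coinciding observations.
  obtain ⟨X, hX⟩ : ∃ X, X = c ^ 2 * (K - 1) + (c ^ 2 * (k - 1) + ((c ^ 2 + ε) * k - c ^ 2)) +
    (a + b) := ⟨_, rfl⟩
  have hKX : ε * K ≤ X := by
    have h1 : ε * (K - 1) ≤ c ^ 2 * (K - 1) :=
      mul_le_mul_of_nonneg_right hεc (sub_nonneg.2 hK)
    have h2 : 0 ≤ c ^ 2 * (k - 1) := mul_nonneg (sq_nonneg c) (sub_nonneg.2 hk)
    have h3 : 0 ≤ ε * (k - 1) := mul_nonneg hε.le (sub_nonneg.2 hk)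
    linarith
  have h1 : t / 2 * (ε * K) ≤ t * (1 - t) * X := by
    have hX0 : 0 ≤ X := le_trans (by positivity) hKX
    calc t / 2 * (ε * K) ≤ t / 2 * X := by gcongr
      _ ≤ t * (1 - t) * X := mul_le_mul_of_nonneg_right (by nlinarith) hX0
  have h2 : 0 ≤ t ^ 2 * ((c ^ 2 + ε) * G) := by positivity
  have h3 : c ^ 2 * t ^ 2 ≤ t * ε / 4 * K := by
    have h4 : c ^ 2 * t ^ 2 ≤ t * ε / 4 := by nlinarith
    exact h4.trans (le_mul_of_one_le_right (by positivity) hK)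
  have e : -(c ^ 2 + ε - ((1 - t) * (1 - 2 * t) * c ^ 2 + t * (1 - t) *
      (c ^ 2 * k₁ + a + (c ^ 2 * k₂ + b) + (c ^ 2 + ε) * k) +
      t ^ 2 * ((c ^ 2 + ε) * G)) - (c ^ 2 + ε - (c ^ 2 + -1 * I))) =
      I - c ^ 2 * t ^ 2 + t * (1 - t) * X + t ^ 2 * ((c ^ 2 + ε) * G) := by
    rw [hX]
    linear_combination t * (1 - t) * c ^ 2 * hkK
  rw [e]
  linarith

/-- The bias of the influence function based estimator, in terms of `t = 1 / n` and the resolutions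
`k₁`, `k₂` with minimum `k` and maximum `K`. -/
lemma influence_bias_ge {c ε t k K k₁ k₂ G I a b : ℝ} (ht : 0 < t) (ht2 : t ≤ 1 / 2)
    (htε : 4 * c ^ 2 * t ≤ ε) (hεc : ε ≤ c ^ 2) (hε : 0 < ε) (hk : 1 ≤ k) (hK : k ≤ K)
    (hkK : k₁ + k₂ = K + k) (hG : 0 ≤ G) (hab : 0 ≤ a + b) :
    I + ε / 4 * (K * t) ≤ c ^ 2 + -ε - ((1 - t) * c ^ 2 + (c ^ 2 + -ε) * k₂ * t) -
      ((1 - t) * c ^ 2 + (c ^ 2 + -ε) * k₁ * t) + ((1 - t) * (1 - 2 * t) * c ^ 2 + t * (1 - t) *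
      (c ^ 2 * k₁ + a + (c ^ 2 * k₂ + b) + (c ^ 2 + -ε) * k) +
      t ^ 2 * ((c ^ 2 + -ε) * G)) - (c ^ 2 + -ε - (c ^ 2 + 1 * I)) := by
  obtain ⟨q, hq⟩ : ∃ q, q = c ^ 2 + -ε := ⟨_, rfl⟩
  have hq0 : 0 ≤ q := by linarith
  have hqc : q ≤ c ^ 2 := by linarith
  have h2 : 0 ≤ t ^ 2 * (q * G) := by positivity
  have h3 : 0 ≤ t * (1 - t) * (a + b) :=
    mul_nonneg (mul_nonneg ht.le (by linarith)) hab
  have h4 : t * q - t ^ 2 * c ^ 2 ≤ t * (1 - t) * (q * k) := by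
    have h5 : t * (1 - t) * q ≤ t * (1 - t) * (q * k) :=
      mul_le_mul_of_nonneg_left (le_mul_of_one_le_right hq0 hk)
        (mul_nonneg ht.le (by linarith))
    have h6 : t ^ 2 * q ≤ t ^ 2 * c ^ 2 := mul_le_mul_of_nonneg_left hqc (sq_nonneg t)
    linarith
  have h5 : t ^ 2 * (c ^ 2 * (K + k)) ≤ 1 / 2 * (t * ε * K) := by
    have h6 : t ^ 2 * (c ^ 2 * (K + k)) ≤ t ^ 2 * (c ^ 2 * (2 * K)) := by
      gcongr; linarith
    have h7 : t * (4 * c ^ 2 * t) * K ≤ t * ε * K := by gcongr; linarith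
    linarith
  have h8 : 0 ≤ t * ε * (k - 1) := mul_nonneg (by positivity) (sub_nonneg.2 hk)
  have h9 : 0 ≤ t ^ 2 * c ^ 2 := by positivity
  have h10 : t * q = t * c ^ 2 - t * ε := by rw [hq]; ring
  have h11 : 0 ≤ t * ε * K := by
    have : 0 ≤ K := by linarith
    positivity
  rw [← hq]
  have e : q - ((1 - t) * c ^ 2 + q * k₂ * t) - ((1 - t) * c ^ 2 + q * k₁ * t) +
      ((1 - t) * (1 - 2 * t) * c ^ 2 + t * (1 - t) *
      (c ^ 2 * k₁ + a + (c ^ 2 * k₂ + b) + q * k) + t ^ 2 * (q * G)) -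
      (q - (c ^ 2 + 1 * I)) =
      I + t * ε * (K + k) - t * c ^ 2 + 2 * t ^ 2 * c ^ 2 - t ^ 2 * (c ^ 2 * (K + k)) +
        t * (1 - t) * (q * k) + t * (1 - t) * (a + b) + t ^ 2 * (q * G) := by
    rw [hq]
    linear_combination (t * ε - t ^ 2 * c ^ 2) * hkK
  rw [e]
  linarith

section LowerBounds

/-- The bias of the integral-based estimator: approximation error and the diagonal terms have the
same sign for a suitable law. -/
lemma exists_worstRisk_INT_ge (hW : W.IsCDV S) (hS : 0 < S) (hd : 0 < d) (hα : 0 < θ.α)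
    (hβ : 0 < θ.β) (hc : ∃ c ∈ Set.Ioo θ.C₁ θ.C₂, ∃ M' < θ.M,
      W.HolderBall θ.α M' (fun _ : Fin d → ℝ => c) ∧
      W.HolderBall θ.β M' (fun _ : Fin d → ℝ => c)) :
    ∃ c₀ : ℝ, 0 < c₀ ∧ ∃ n₀ : ℕ, ∀ n j₁ j₂ : ℕ, n₀ ≤ n → W.J₀ ≤ j₁ → W.J₀ ≤ j₂ →
      ENNReal.ofReal ((c₀ * (2 ^ (-((θ.α + θ.β) * (min j₁ j₂ : ℕ))) +
        2 ^ (min j₁ j₂ * d) / n)) ^ 2) ≤ worstRisk W θ (psiINT (d := d) W j₁ j₂ n) := by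
  obtain ⟨c, r, ε, hε, hεc, h⟩ := exists_tilted_family hW hS hd hα hβ hc
  refine ⟨min (ε ^ 2) ε, by positivity, 1, fun n j₁ j₂ hn h₁ h₂ => ?_⟩
  have hn' : (0 : ℝ) < n := by exact_mod_cast hn
  set l := min j₁ j₂ with hl
  have hl0 : W.J₀ ≤ l := le_min h₁ h₂
  -- Perturbations of opposite signs and an increase of `E[A Y | X]`: both parts of the bias are
  -- negative.
  obtain ⟨-, hP, H⟩ := h l hl0 1 (-1) ε (by simp) (by simp) (abs_of_pos hε).le _ _ rfl rfl
  have := hP.prob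
  refine hP.ofReal_sq_le_worstRisk (bddMeas_cleanINT hW j₁ j₂)
    (fun P hP => hP.psiINT_ae_eq hW h₁ h₂) (by positivity) ?_
  refine (min_mul_add_le (by positivity) (by positivity)).trans ?_
  rw [H.integral_cleanINT hW h₁ h₂ hn, H.psi, integral_add_bump_mul_add_bump hW hS hd hl0,
    two_rpow_bump, ← hl]
  simp_rw [proj_add_bump hW hS hd hl0 le_rfl]
  rw [integral_add_bump_mul_const hW hS hd hl0]
  have hk : (1 : ℝ) ≤ 2 ^ (l * d) := one_le_pow₀ one_le_two
  set k : ℝ := 2 ^ (l * d)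
  set t : ℝ := 1 / n with ht
  have ht0 : 0 < t := by positivity
  have hdiv : ∀ x : ℝ, x / n = x * t := fun x => by rw [ht]; ring
  simp only [hdiv]
  refine le_trans ?_ (neg_le_abs _)
  nlinarith [mul_nonneg ht0.le (mul_nonneg (sq_nonneg c) (sub_nonneg.2 hk))]

/-- The bias of the Monte Carlo estimator: approximation error and the diagonal terms have the same
sign for a suitable law. -/
lemma exists_worstRisk_MC_ge (hW : W.IsCDV S) (hS : 0 < S) (hd : 0 < d) (hα : 0 < θ.α)
    (hβ : 0 < θ.β) (hc : ∃ c ∈ Set.Ioo θ.C₁ θ.C₂, ∃ M' < θ.M,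
      W.HolderBall θ.α M' (fun _ : Fin d → ℝ => c) ∧
      W.HolderBall θ.β M' (fun _ : Fin d → ℝ => c)) :
    ∃ c₀ : ℝ, 0 < c₀ ∧ ∃ n₀ : ℕ, ∀ n j₁ j₂ : ℕ, n₀ ≤ n → W.J₀ ≤ j₁ → W.J₀ ≤ j₂ →
      ENNReal.ofReal ((c₀ * (2 ^ (-((θ.α + θ.β) * (max j₁ j₂ : ℕ))) +
        2 ^ (max j₁ j₂ * d) / n)) ^ 2) ≤ worstRisk W θ (psiMC (d := d) W j₁ j₂ n) := by
  obtain ⟨c, r, ε, hε, hεc, h⟩ := exists_tilted_family hW hS hd hα hβ hc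
  obtain ⟨n₀, hn₀⟩ := exists_nat_ge (4 * c ^ 2 / ε)
  refine ⟨min (ε ^ 2) (ε / 4), by positivity, max 2 n₀, fun n j₁ j₂ hn h₁ h₂ => ?_⟩
  have hn2 : (2 : ℝ) ≤ n := by exact_mod_cast (le_max_left _ _).trans hn
  have hn' : (0 : ℝ) < n := by linarith
  have hnε : 4 * c ^ 2 / ε ≤ n := hn₀.trans (by exact_mod_cast (le_max_right _ _).trans hn)
  set l := max j₁ j₂ with hl
  have hl0 : W.J₀ ≤ l := h₁.trans (le_max_left _ _)
  set R₁ := ∫ x : Fin d → ℝ, W.bump l x * W.kernelC j₁ x x ∂cubeMeasure d with hR₁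
  set R₂ := ∫ x : Fin d → ℝ, W.bump l x * W.kernelC j₂ x x ∂cubeMeasure d with hR₂
  obtain ⟨σ, hσ, hσσ, hσR⟩ := exists_sign
    (c * (ε * 2 ^ (-((l : ℝ) * (θ.α + d / 2)))) * R₁ -
      c * (ε * 2 ^ (-((l : ℝ) * (θ.β + d / 2)))) * R₂)
  -- Perturbations of opposite signs and an increase of `E[A Y | X]`: both parts of the bias are
  -- negative.
  obtain ⟨-, hP, H⟩ := h l hl0 σ (-σ) ε hσ (by simpa using hσ) (abs_of_pos hε).le _ _ rfl rfl
  have := hP.prob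
  refine hP.ofReal_sq_le_worstRisk (bddMeas_cleanMC hW j₁ j₂)
    (fun P hP => hP.psiMC_ae_eq) (by positivity) ?_
  refine (min_mul_add_le (by positivity) (by positivity)).trans ?_
  rw [H.integral_cleanMC hW h₁ h₂ (by exact_mod_cast hn'), H.psi,
    integral_add_bump_mul_add_bump hW hS hd hl0, two_rpow_bump]
  simp_rw [proj_add_bump hW hS hd h₁ (show j₁ ≤ l from le_max_left j₁ j₂),
    proj_add_bump hW hS hd h₂ (show j₂ ≤ l from le_max_right j₁ j₂),
    proj_add_bump hW hS hd (le_min h₁ h₂) (show min j₁ j₂ ≤ l from min_le_max),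
    mul_comm c (W.kernelC j₂ _ _)]
  rw [integral_add_bump_mul_const hW hS hd hl0,
    integral_add_bump_mul hW (hW.bddMeas_kernelC_self j₁),
    integral_add_bump_mul hW (hW.bddMeas_kernelC_self j₂), ← hR₁, ← hR₂,
    hW.integral_kernelC_self h₁, hW.integral_kernelC_self h₂]
  have hG : 0 ≤ ∫ x : Fin d → ℝ, W.kernelC j₁ x x * W.kernelC j₂ x x ∂cubeMeasure d :=
    integral_nonneg fun x =>
      mul_nonneg (CDVData.kernelC_self_nonneg _ _) (CDVData.kernelC_self_nonneg _ _)
  have hkk := two_pow_add_two_pow j₁ j₂ d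
  have hk : (1 : ℝ) ≤ 2 ^ (min j₁ j₂ * d) := one_le_pow₀ one_le_two
  have hK : (1 : ℝ) ≤ 2 ^ (max j₁ j₂ * d) := one_le_pow₀ one_le_two
  set G := ∫ x : Fin d → ℝ, W.kernelC j₁ x x * W.kernelC j₂ x x ∂cubeMeasure d
  set k : ℝ := 2 ^ (min j₁ j₂ * d)
  set K : ℝ := 2 ^ (max j₁ j₂ * d)
  set t : ℝ := 1 / n with ht
  have ht0 : 0 < t := by positivity
  have ht2 : t ≤ 1 / 2 := one_div_le_one_div_of_le two_pos hn2
  have htε : 4 * c ^ 2 * t ≤ ε := by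
    rw [div_le_iff₀ hε] at hnε
    rw [ht, mul_one_div, div_le_iff₀ hn']
    linarith
  have hdiv : ∀ x : ℝ, x / n = x * t := fun x => by rw [ht]; ring
  have hdiv2 : (1 : ℝ) / n ^ 2 = t ^ 2 := by rw [ht]; ring
  rw [hdiv2]
  simp only [hdiv]
  set ua := c * (ε * 2 ^ (-((l : ℝ) * (θ.α + d / 2)))) * R₁
  set ub := c * (ε * 2 ^ (-((l : ℝ) * (θ.β + d / 2)))) * R₂
  set I := ε ^ 2 * (2 : ℝ) ^ (-((θ.α + θ.β) * l))
  have e1 : c * (σ * ε * 2 ^ (-((l : ℝ) * (θ.α + d / 2)))) * R₁ = σ * ua := by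
    simp only [ua]; ring
  have e2 : c * (-σ * ε * 2 ^ (-((l : ℝ) * (θ.β + d / 2)))) * R₂ = - (σ * ub) := by
    simp only [ub]; ring
  have e3 : σ * -σ = -1 := by linarith
  rw [e1, e2, e3]
  exact le_trans (monteCarlo_bias_le ht0 ht2 htε hεc hε hk hK hkk hG (by linarith)) (neg_le_abs _)

/-- The bias of the influence function based estimator: approximation error and the diagonal terms
have the same sign for a suitable law. -/
lemma exists_worstRisk_IF_ge (hW : W.IsCDV S) (hS : 0 < S) (hd : 0 < d) (hα : 0 < θ.α)
    (hβ : 0 < θ.β) (hc : ∃ c ∈ Set.Ioo θ.C₁ θ.C₂, ∃ M' < θ.M,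
      W.HolderBall θ.α M' (fun _ : Fin d → ℝ => c) ∧
      W.HolderBall θ.β M' (fun _ : Fin d → ℝ => c)) :
    ∃ c₀ : ℝ, 0 < c₀ ∧ ∃ n₀ : ℕ, ∀ n j₁ j₂ : ℕ, n₀ ≤ n → W.J₀ ≤ j₁ → W.J₀ ≤ j₂ →
      ENNReal.ofReal ((c₀ * (2 ^ (-((θ.α + θ.β) * (max j₁ j₂ : ℕ))) +
        2 ^ (max j₁ j₂ * d) / n)) ^ 2) ≤ worstRisk W θ (psiIF (d := d) W j₁ j₂ n) := by
  obtain ⟨c, r, ε, hε, hεc, h⟩ := exists_tilted_family hW hS hd hα hβ hc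
  obtain ⟨n₀, hn₀⟩ := exists_nat_ge (4 * c ^ 2 / ε)
  refine ⟨min (ε ^ 2) (ε / 4), by positivity, max 2 n₀, fun n j₁ j₂ hn h₁ h₂ => ?_⟩
  have hn2 : (2 : ℝ) ≤ n := by exact_mod_cast (le_max_left _ _).trans hn
  have hn' : (0 : ℝ) < n := by linarith
  have hnε : 4 * c ^ 2 / ε ≤ n := hn₀.trans (by exact_mod_cast (le_max_right _ _).trans hn)
  set l := max j₁ j₂ with hl
  have hl0 : W.J₀ ≤ l := h₁.trans (le_max_left _ _)
  set R₁ := ∫ x : Fin d → ℝ, W.bump l x * W.kernelC j₁ x x ∂cubeMeasure d with hR₁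
  set R₂ := ∫ x : Fin d → ℝ, W.bump l x * W.kernelC j₂ x x ∂cubeMeasure d with hR₂
  obtain ⟨σ, hσ, hσσ, hσR⟩ := exists_sign
    (c * (ε * 2 ^ (-((l : ℝ) * (θ.α + d / 2)))) * R₁ +
      c * (ε * 2 ^ (-((l : ℝ) * (θ.β + d / 2)))) * R₂)
  -- Perturbations of equal signs and a decrease of `E[A Y | X]`: both parts of the bias are
  -- positive.
  obtain ⟨-, hP, H⟩ := h l hl0 σ σ (-ε) hσ hσ (by rw [abs_neg, abs_of_pos hε]) _ _ rfl rfl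
  have := hP.prob
  refine hP.ofReal_sq_le_worstRisk (bddMeas_cleanIF hW j₁ j₂)
    (fun P hP => hP.psiIF_ae_eq) (by positivity) ?_
  refine (min_mul_add_le (by positivity) (by positivity)).trans ?_
  rw [H.integral_cleanIF hW h₁ h₂ (by exact_mod_cast hn'), H.psi,
    integral_add_bump_mul_add_bump hW hS hd hl0, two_rpow_bump]
  simp_rw [proj_add_bump hW hS hd h₁ (show j₁ ≤ l from le_max_left j₁ j₂),
    proj_add_bump hW hS hd h₂ (show j₂ ≤ l from le_max_right j₁ j₂),
    proj_add_bump hW hS hd (le_min h₁ h₂) (show min j₁ j₂ ≤ l from min_le_max),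
    mul_comm c (W.kernelC j₂ _ _)]
  rw [integral_add_bump_mul_const hW hS hd hl0, integral_add_bump_mul_const hW hS hd hl0,
    integral_add_bump_mul hW (hW.bddMeas_kernelC_self j₁),
    integral_add_bump_mul hW (hW.bddMeas_kernelC_self j₂), ← hR₁, ← hR₂,
    hW.integral_kernelC_self h₁, hW.integral_kernelC_self h₂]
  have hG : 0 ≤ ∫ x : Fin d → ℝ, W.kernelC j₁ x x * W.kernelC j₂ x x ∂cubeMeasure d :=
    integral_nonneg fun x =>
      mul_nonneg (CDVData.kernelC_self_nonneg _ _) (CDVData.kernelC_self_nonneg _ _)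
  have hkk := two_pow_add_two_pow j₁ j₂ d
  have hk : (1 : ℝ) ≤ 2 ^ (min j₁ j₂ * d) := one_le_pow₀ one_le_two
  have hkK : (2 : ℝ) ^ (min j₁ j₂ * d) ≤ 2 ^ (max j₁ j₂ * d) :=
    pow_le_pow_right₀ one_le_two (Nat.mul_le_mul_right d min_le_max)
  set G := ∫ x : Fin d → ℝ, W.kernelC j₁ x x * W.kernelC j₂ x x ∂cubeMeasure d
  set k : ℝ := 2 ^ (min j₁ j₂ * d)
  set K : ℝ := 2 ^ (max j₁ j₂ * d)
  set t : ℝ := 1 / n with ht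
  have ht0 : 0 < t := by positivity
  have ht2 : t ≤ 1 / 2 := one_div_le_one_div_of_le two_pos hn2
  have htε : 4 * c ^ 2 * t ≤ ε := by
    rw [div_le_iff₀ hε] at hnε
    rw [ht, mul_one_div, div_le_iff₀ hn']
    linarith
  have hdiv : ∀ x : ℝ, x / n = x * t := fun x => by rw [ht]; ring
  have hdiv2 : (1 : ℝ) / n ^ 2 = t ^ 2 := by rw [ht]; ring
  rw [hdiv2]
  simp only [hdiv]
  set ua := c * (ε * 2 ^ (-((l : ℝ) * (θ.α + d / 2)))) * R₁
  set ub := c * (ε * 2 ^ (-((l : ℝ) * (θ.β + d / 2)))) * R₂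
  set I := ε ^ 2 * (2 : ℝ) ^ (-((θ.α + θ.β) * l))
  have e1 : c * (σ * ε * 2 ^ (-((l : ℝ) * (θ.α + d / 2)))) * R₁ = σ * ua := by
    simp only [ua]; ring
  have e2 : c * (σ * ε * 2 ^ (-((l : ℝ) * (θ.β + d / 2)))) * R₂ = σ * ub := by
    simp only [ub]; ring
  rw [e1, e2, hσσ]
  exact le_trans (influence_bias_ge ht0 ht2 htε hεc hε hk hkK hkk hG (by linarith)) (le_abs_self _)

end LowerBounds

end

/-! ### The two-point lower bound for the minimax risk -/

section

/-- The product of measures with a density has the product density. -/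
lemma pi_withDensity {Ω : Type*} [MeasurableSpace Ω] (μ : Measure Ω) [IsProbabilityMeasure μ]
    (n : ℕ) {f : Ω → ℝ} (hf : BddMeas f) (h0 : ∀ x, 0 ≤ f x)
    [IsProbabilityMeasure (μ.withDensity fun x => ENNReal.ofReal (f x))] :
    (Measure.pi fun _ : Fin n => μ.withDensity fun x => ENNReal.ofReal (f x)) =
      (Measure.pi fun _ : Fin n => μ).withDensity fun z => ENNReal.ofReal (∏ i, f (z i)) := by
  refine Measure.pi_eq fun s hs => ?_
  have hsf : ∀ i, BddMeas ((s i).indicator f) := fun i => by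
    obtain ⟨C, hC⟩ := hf.bdd
    refine ⟨hf.meas.indicator (hs i), C, fun x => ?_⟩
    by_cases hx : x ∈ s i
    · rw [Set.indicator_of_mem hx]; exact hC x
    · rw [Set.indicator_of_notMem hx, abs_zero]; exact (abs_nonneg _).trans (hC x)
  have hind : ∀ i, μ.withDensity (fun x => ENNReal.ofReal (f x)) (s i) =
      ENNReal.ofReal (∫ x, (s i).indicator f x ∂μ) := fun i => by
    rw [withDensity_apply _ (hs i), integral_indicator (hs i),
      ofReal_integral_eq_lintegral_ofReal (hf.integrable _).integrableOn (ae_of_all _ h0)]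
  simp_rw [hind]
  rw [← ENNReal.ofReal_prod_of_nonneg fun i _ =>
    integral_nonneg fun x => Set.indicator_nonneg (fun y _ => h0 y) x,
    ← integral_fintype_prod_eq_prod, withDensity_apply _ (MeasurableSet.univ_pi hs),
    ← lintegral_indicator (MeasurableSet.univ_pi hs)]
  rw [ofReal_integral_eq_lintegral_ofReal]
  · congr 1; ext z
    by_cases hz : z ∈ Set.univ.pi s
    · rw [Set.indicator_of_mem hz]
      congr 1
      exact Finset.prod_congr rfl fun i _ => (Set.indicator_of_mem (hz i (Set.mem_univ i)) f).symm
    · rw [Set.indicator_of_notMem hz]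
      obtain ⟨i, hi⟩ : ∃ i, z i ∉ s i := by simpa [Set.mem_pi] using hz
      rw [Finset.prod_eq_zero (Finset.mem_univ i) (Set.indicator_of_notMem hi f),
        ENNReal.ofReal_zero]
  · refine Integrable.fintype_prod fun i => (hsf i).integrable _
  · exact ae_of_all _ fun z => Finset.prod_nonneg fun i _ =>
      Set.indicator_nonneg (fun y _ => h0 y) _

lemma BddMeas.prod_eval {Ω : Type*} [MeasurableSpace Ω] {f : Ω → ℝ} (hf : BddMeas f) (n : ℕ) :
    BddMeas fun z : Fin n → Ω => ∏ i, f (z i) := by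
  obtain ⟨C, hC⟩ := hf.bdd
  refine ⟨Finset.measurable_prod _ fun i _ => hf.meas.comp (measurable_pi_apply i), C ^ n,
    fun z => ?_⟩
  rw [Finset.abs_prod]
  refine (Finset.prod_le_prod (fun _ _ => abs_nonneg _) fun i _ => hC (z i)).trans_eq ?_
  simp

/-- The two-point method: if the likelihood ratio `D` of `n` observations has second moment at most
`2`, then no estimator can have small mean squared error under both laws. -/
lemma two_point_bound {Ω : Type*} [MeasurableSpace Ω] (μ : Measure Ω) [IsProbabilityMeasure μ]
    (n : ℕ) {f : Ω → ℝ} (hf : BddMeas f) (h0 : ∀ x, 0 ≤ f x)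
    [IsProbabilityMeasure (μ.withDensity fun x => ENNReal.ofReal (f x))]
    (h1 : ∫ x, f x ∂μ = 1) (h2 : (∫ x, f x ^ 2 ∂μ) ^ n ≤ 2) {T : (Fin n → Ω) → ℝ}
    (hT : Measurable T) (a b : ℝ) :
    ENNReal.ofReal ((a - b) ^ 2 / 4) ≤
      (∫⁻ z, ENNReal.ofReal ((T z - a) ^ 2) ∂(Measure.pi fun _ : Fin n => μ)) +
      ∫⁻ z, ENNReal.ofReal ((T z - b) ^ 2)
        ∂(Measure.pi fun _ : Fin n => μ.withDensity fun x => ENNReal.ofReal (f x)) := by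
  set D : (Fin n → Ω) → ℝ := fun z => ∏ i, f (z i) with hD
  have bD : BddMeas D := hf.prod_eval n
  have hD0 : ∀ z, 0 ≤ D z := fun z => Finset.prod_nonneg fun i _ => h0 _
  have mD : ∫ z, D z ∂(Measure.pi fun _ : Fin n => μ) = 1 := by
    rw [hD, integral_fintype_prod_eq_prod]; simp [h1]
  have mD2 : ∫ z, D z ^ 2 ∂(Measure.pi fun _ : Fin n => μ) ≤ 2 := by
    simp_rw [hD, ← Finset.prod_pow]
    rw [integral_fintype_prod_eq_prod (fun _ x => f x ^ 2)]
    simpa using h2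
  have mT : ∀ c, Measurable fun z => ENNReal.ofReal ((T z - c) ^ 2) := fun c =>
    ((hT.sub_const c).pow_const 2).ennreal_ofReal
  rw [pi_withDensity μ n hf h0, lintegral_withDensity_eq_lintegral_mul _
    bD.meas.ennreal_ofReal (mT b), ← lintegral_add_left (mT a)]
  -- `min 1 D ≥ D - D ^ 2 / 4`, and the right side has mean at least `1 / 2`.
  have bm : BddMeas fun z => min 1 (D z) := by
    refine BddMeas.of_le (C := 1) (measurable_const.min bD.meas) fun z => ?_
    rw [abs_of_nonneg (le_min zero_le_one (hD0 z))]
    exact min_le_left _ _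
  have hmin : 1 / 2 ≤ ∫ z, min 1 (D z) ∂(Measure.pi fun _ : Fin n => μ) := by
    have h3 : ∫ z, (D z - 1 / 4 * D z ^ 2) ∂(Measure.pi fun _ : Fin n => μ) ≤
        ∫ z, min 1 (D z) ∂(Measure.pi fun _ : Fin n => μ) := by
      refine integral_mono ((bD.sub ((bD.pow 2).const_mul _)).integrable _) (bm.integrable _) ?_
      intro z
      refine le_min ?_ ?_ <;> nlinarith [sq_nonneg (D z - 2), sq_nonneg (D z)]
    rw [integral_sub (bD.integrable _) (((bD.pow 2).const_mul _).integrable _),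
      integral_const_mul, mD] at h3
    linarith
  calc ENNReal.ofReal ((a - b) ^ 2 / 4)
      ≤ ENNReal.ofReal (∫ z, (a - b) ^ 2 / 2 * min 1 (D z) ∂(Measure.pi fun _ : Fin n => μ)) := by
        refine ENNReal.ofReal_le_ofReal ?_
        rw [integral_const_mul]
        nlinarith [sq_nonneg (a - b)]
    _ = ∫⁻ z, ENNReal.ofReal ((a - b) ^ 2 / 2 * min 1 (D z)) ∂(Measure.pi fun _ : Fin n => μ) :=
        ofReal_integral_eq_lintegral_ofReal ((bm.const_mul _).integrable _)
          (ae_of_all _ fun z => mul_nonneg (by positivity) (le_min zero_le_one (hD0 z)))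
    _ ≤ _ := by
        refine lintegral_mono fun z => ?_
        rw [Pi.mul_apply, ← ENNReal.ofReal_mul (hD0 z),
          ← ENNReal.ofReal_add (sq_nonneg _) (mul_nonneg (hD0 z) (sq_nonneg _))]
        refine ENNReal.ofReal_le_ofReal ?_
        have h4 : (a - b) ^ 2 / 2 ≤ (T z - a) ^ 2 + (T z - b) ^ 2 := by
          nlinarith [sq_nonneg (2 * T z - a - b)]
        have h5 : 0 ≤ min 1 (D z) := le_min zero_le_one (hD0 z)
        nlinarith [mul_le_mul_of_nonneg_right h4 h5,
          mul_le_mul_of_nonneg_right (min_le_left 1 (D z)) (sq_nonneg (T z - a)),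
          mul_le_mul_of_nonneg_right (min_le_right 1 (D z)) (sq_nonneg (T z - b))]

variable {d : ℕ} {W : CDVData} {S : ℕ} {θ : ModelParams} {n : ℕ}

/-- The parametric lower bound for the minimax risk, from two laws for which `E[A Y | X]` differs by
a multiple of `n ^ (-1/2)`. -/
lemma exists_minimaxRisk_ge (hW : W.IsCDV S) (hS : 0 < S) (hd : 0 < d) (hα : 0 < θ.α)
    (hβ : 0 < θ.β) (hc : ∃ c ∈ Set.Ioo θ.C₁ θ.C₂, ∃ M' < θ.M,
      W.HolderBall θ.α M' (fun _ : Fin d → ℝ => c) ∧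
      W.HolderBall θ.β M' (fun _ : Fin d → ℝ => c)) :
    ∃ c₀ : ℝ, 0 < c₀ ∧ ∀ n : ℕ, 0 < n → ENNReal.ofReal (c₀ / n) ≤ minimaxRisk W θ d n := by
  obtain ⟨c, r, ε, hε, hεc, h⟩ := exists_tilted_family hW hS hd hα hβ hc
  have hr : 0 < r := (h W.J₀ le_rfl 0 0 0 (by simp) (by simp) (by simpa using hε.le) _ _
    rfl rfl).1.pos
  obtain ⟨δ, hδ, hδε, hδr⟩ : ∃ δ, 0 < δ ∧ δ ≤ ε ∧ δ ≤ r ^ 2 / 2 :=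
    ⟨min ε (r ^ 2 / 2), by positivity, min_le_left _ _, min_le_right _ _⟩
  refine ⟨δ ^ 2 / 8, by positivity, fun n hn => le_iInf₂ fun T hT => ?_⟩
  have hn' : (1 : ℝ) ≤ n := by exact_mod_cast hn
  have hsq : (1 : ℝ) ≤ √n := Real.one_le_sqrt.2 hn'
  set e := δ / √n with he
  have he0 : 0 < e := by positivity
  have heδ : e ≤ δ := div_le_self hδ.le hsq
  have he2 : e ^ 2 = δ ^ 2 / n := by rw [he, div_pow, Real.sq_sqrt (by linarith)]
  obtain ⟨H0, hP0, M0⟩ := h W.J₀ le_rfl 0 0 0 (by simp) (by simp) (by simpa using hε.le) _ _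
    rfl rfl
  obtain ⟨H1, hP1, M1⟩ := h W.J₀ le_rfl 0 0 e (by simp) (by simp)
    (by rw [abs_of_pos he0]; linarith) _ _ rfl rfl
  simp only [zero_mul, add_zero] at H0 hP0 M0 H1 hP1 M1
  have t0 : ∀ o : Obs d, tilt c r (fun _ => 0) (fun _ => 0) (c ^ 2) o = 1 := fun o => by
    simp [tilt]
  have t1 : ∀ o : Obs d, tilt c r (fun _ => 0) (fun _ => 0) (c ^ 2 + e) o =
      1 + spin c r (varA o) * spin c r (varY o) * (e / r ^ 2) := fun o => by
    simp [tilt]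
  have e0 : tiltedLaw (d := d) c r (fun _ => 0) (fun _ => 0) (c ^ 2) = baseLaw d c r := by
    unfold tiltedLaw
    simp_rw [t0, ENNReal.ofReal_one]
    exact withDensity_one
  have b1 := bddMeas_tilt (d := d) c r (BddMeas.const 0) (BddMeas.const 0) (c ^ 2 + e)
  have hprob := H1.isProbabilityMeasure
  rw [e0] at hP0 M0
  rw [tiltedLaw] at hprob
  have m1 : ∫ o, tilt c r (fun _ => 0) (fun _ => 0) (c ^ 2 + e) o ∂baseLaw d c r = 1 := by
    rw [integral_baseLaw c r b1]
    simp_rw [t1]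
    simp only [varA, varY, spin_sub hr, spin_add hr]
    ring_nf
    simp
  have m2 : ∫ o, tilt c r (fun _ => 0) (fun _ => 0) (c ^ 2 + e) o ^ 2 ∂baseLaw d c r =
      1 + (e / r ^ 2) ^ 2 := by
    rw [integral_baseLaw c r (b1.pow 2)]
    simp_rw [t1]
    simp only [varA, varY, spin_sub hr, spin_add hr]
    ring_nf
    simp
  -- The condition `δ ≤ r ^ 2 / 2` bounds the second moment of the likelihood ratio by
  -- `exp (1 / 4)`.
  have m3 : (1 + (e / r ^ 2) ^ 2) ^ n ≤ 2 := by
    have h3 : (e / r ^ 2) ^ 2 ≤ 1 / (4 * n) := by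
      rw [div_pow, he2, div_div, div_le_div_iff₀ (by positivity) (by positivity)]
      have : δ ^ 2 ≤ (r ^ 2 / 2) ^ 2 := pow_le_pow_left₀ hδ.le hδr 2
      nlinarith
    have h4 : 1 + (e / r ^ 2) ^ 2 ≤ Real.exp (1 / (4 * n)) := by
      linarith [Real.add_one_le_exp (1 / (4 * (n : ℝ)))]
    refine (pow_le_pow_left₀ (by positivity) h4 n).trans ?_
    rw [← Real.exp_nat_mul]
    have h5 : (n : ℝ) * (1 / (4 * n)) = 1 / 4 := by field_simp
    rw [h5]
    have := Real.exp_bound_div_one_sub_of_interval (x := 1 / 4) (by norm_num) (by norm_num)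
    exact this.trans (by norm_num)
  have key := two_point_bound (baseLaw d c r) n b1 H1.nonneg m1 (by rw [m2]; exact m3) hT
    (expCondCov (baseLaw d c r))
    (expCondCov (tiltedLaw (d := d) c r (fun _ => 0) (fun _ => 0) (c ^ 2 + e)))
  have hψ : (expCondCov (baseLaw d c r) -
      expCondCov (tiltedLaw (d := d) c r (fun _ => 0) (fun _ => 0) (c ^ 2 + e))) ^ 2 / 4 =
      δ ^ 2 / 8 / n + δ ^ 2 / 8 / n := by
    rw [M0.psi, M1.psi, add_sub_right_comm, sub_add_cancel_left, neg_sq, he2]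
    ring
  rw [hψ, ENNReal.ofReal_add (by positivity) (by positivity)] at key
  have k0 : ∫⁻ z, ENNReal.ofReal ((T z - expCondCov (baseLaw d c r)) ^ 2)
      ∂(Measure.pi fun _ : Fin n => baseLaw d c r) ≤ worstRisk W θ T :=
    le_iSup₂_of_le (baseLaw d c r) hP0 le_rfl
  have k1 := le_iSup₂_of_le (f := fun (P : Measure (Obs d)) (_ : InModel W θ P) =>
    ∫⁻ o, ENNReal.ofReal ((T o - expCondCov P) ^ 2) ∂(Measure.pi fun _ : Fin n => P)) _ hP1 le_rfl
  have k2 := key.trans (add_le_add k0 k1)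
  change _ ≤ worstRisk W θ T + worstRisk W θ T at k2
  by_contra hlt
  rw [not_le] at hlt
  exact absurd k2 (not_le.2 (ENNReal.add_lt_add hlt hlt))

lemma minimaxRisk_le_worstRisk {T T' : (Fin n → Obs d) → ℝ} (hT : BddMeas T')
    (h : ∀ P, InModel W θ P → T =ᵐ[Measure.pi fun _ : Fin n => P] T') :
    minimaxRisk W θ d n ≤ worstRisk W θ T := by
  rw [worstRisk_congr h]
  exact iInf₂_le T' hT.meas

end

/-! ### Rates of convergence -/

section

lemma RateLE.trans {a b c : ℕ → ℝ≥0∞} (h₁ : RateLE a b) (h₂ : RateLE b c) : RateLE a c := by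
  obtain ⟨C, hC, hab⟩ := h₁
  obtain ⟨D, hD, hbc⟩ := h₂
  refine ⟨C * D, mul_pos hC hD, ?_⟩
  filter_upwards [hab, hbc] with n h1 h2
  rw [ENNReal.coe_mul, mul_assoc]
  exact h1.trans (by gcongr)

lemma rateLE_of_le_ofReal {a : ℕ → ℝ≥0∞} {C r : ℝ}
    (h : ∀ᶠ n : ℕ in atTop, a n ≤ ENNReal.ofReal (C * (n : ℝ) ^ r)) : RateLE a (powRate r) := by
  refine ⟨Real.toNNReal (max C 1), by simp, ?_⟩
  filter_upwards [h] with n hn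
  refine hn.trans ?_
  rw [powRate, ← ENNReal.ofReal, ← ENNReal.ofReal_mul (by positivity)]
  exact ENNReal.ofReal_le_ofReal (mul_le_mul_of_nonneg_right (le_max_left _ _) (by positivity))

lemma rateLE_of_ofReal_le {a : ℕ → ℝ≥0∞} {c r : ℝ} (hc : 0 < c)
    (h : ∀ᶠ n : ℕ in atTop, ENNReal.ofReal (c * (n : ℝ) ^ r) ≤ a n) : RateLE (powRate r) a := by
  refine ⟨Real.toNNReal (1 / c), by simpa using hc, ?_⟩
  filter_upwards [h] with n hn
  refine le_trans ?_ (mul_le_mul_right hn _)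
  rw [powRate, ← ENNReal.ofReal, ← ENNReal.ofReal_mul (by positivity)]
  refine ENNReal.ofReal_le_ofReal (le_of_eq ?_)
  field_simp

/-- A comparison of rates, in terms of real numbers. -/
lemma RateLE.exists_real {a b : ℕ → ℝ≥0∞} {x y : ℕ → ℝ} (h : RateLE a b)
    (ha : ∀ n, a n = ENNReal.ofReal (x n)) (hb : ∀ n, b n = ENNReal.ofReal (y n))
    (hy : ∀ n, 0 ≤ y n) : ∃ C, 1 ≤ C ∧ ∀ᶠ n in atTop, x n ≤ C * y n := by
  obtain ⟨C, hC, h⟩ := h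
  refine ⟨max C 1, le_max_right _ _, ?_⟩
  filter_upwards [h] with n hn
  rw [ha, hb, ← ENNReal.ofReal_coe_nnreal, ← ENNReal.ofReal_mul C.coe_nonneg,
    ENNReal.ofReal_le_ofReal_iff (mul_nonneg C.coe_nonneg (hy n))] at hn
  exact hn.trans (mul_le_mul_of_nonneg_right (le_max_left _ _) (hy n))

lemma ofReal_two_pow (k : ℕ) : ENNReal.ofReal (2 ^ k) = 2 ^ k := by
  rw [ENNReal.ofReal_pow two_pos.le]; simp

lemma kMin_eq (d : ℕ) (j₁ j₂ : ℕ → ℕ) (n : ℕ) :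
    kMin d j₁ j₂ n = ENNReal.ofReal (2 ^ (min (j₁ n) (j₂ n) * d)) := by
  have hmono : Monotone fun j : ℕ => (2 : ℝ≥0∞) ^ (j * d) := fun j l h =>
    pow_le_pow_right₀ one_le_two (Nat.mul_le_mul_right d h)
  rw [ofReal_two_pow]
  exact (hmono.map_min).symm

lemma kMax_eq (d : ℕ) (j₁ j₂ : ℕ → ℕ) (n : ℕ) :
    kMax d j₁ j₂ n = ENNReal.ofReal (2 ^ (max (j₁ n) (j₂ n) * d)) := by
  have hmono : Monotone fun j : ℕ => (2 : ℝ≥0∞) ^ (j * d) := fun j l h =>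
    pow_le_pow_right₀ one_le_two (Nat.mul_le_mul_right d h)
  rw [ofReal_two_pow]
  exact (hmono.map_max).symm

section RealRates

variable {s x C κ ρ : ℝ} {d l n : ℕ}

lemma inv_le_rpow (hn : 0 < n) (hρ : ρ ≤ 1) : 1 / (n : ℝ) ≤ (n : ℝ) ^ (-ρ) := by
  have hn' : (1 : ℝ) ≤ n := by exact_mod_cast hn
  rw [one_div, ← Real.rpow_neg_one]
  exact Real.rpow_le_rpow_of_exponent_le hn' (by linarith)

/-- A lower bound for the resolution gives an upper bound for the squared approximation error. -/
lemma two_rpow_sq_le (hs : 0 < s) (hd : 0 < d) (hn : 0 < n) (hC : 1 ≤ C)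
    (h : (n : ℝ) ^ κ ≤ C * 2 ^ (l * d)) (hρ : ρ ≤ 2 * s * κ / d) :
    ((2 : ℝ) ^ (-(s * l))) ^ 2 ≤ C ^ (2 * s / d) * (n : ℝ) ^ (-ρ) := by
  have hn' : (1 : ℝ) ≤ n := by exact_mod_cast hn
  have hd' : (0 : ℝ) < d := by exact_mod_cast hd
  have e : ((2 : ℝ) ^ (-(s * l))) ^ 2 = ((2 : ℝ) ^ (l * d)) ^ (-(2 * s / d)) := by
    rw [← Real.rpow_natCast, ← Real.rpow_natCast, ← Real.rpow_mul two_pos.le,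
      ← Real.rpow_mul two_pos.le]
    congr 1
    push_cast
    field_simp
  have h1 : (n : ℝ) ^ κ / C ≤ 2 ^ (l * d) := by
    rw [div_le_iff₀ (by linarith)]; linarith
  have h2 : (0 : ℝ) < (n : ℝ) ^ κ / C := by positivity
  have h3 : 0 < 2 * s / d := by positivity
  rw [e]
  refine (Real.rpow_le_rpow_of_nonpos h2 h1 (by linarith)).trans ?_
  rw [Real.rpow_neg h2.le, Real.div_rpow (by positivity) (by linarith), inv_div, div_eq_mul_inv,
    ← Real.rpow_mul (by positivity), ← Real.rpow_neg (by positivity)]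
  refine mul_le_mul_of_nonneg_left (Real.rpow_le_rpow_of_exponent_le hn' ?_) (by positivity)
  have : κ * (2 * s / d) = 2 * s * κ / d := by ring
  linarith

lemma resolution_div_sq_le (hn : 0 < n) (hC : 1 ≤ C) (h : (2 : ℝ) ^ (l * d) ≤ C * (n : ℝ) ^ κ)
    (hρ : ρ ≤ 2 - 2 * κ) : ((2 : ℝ) ^ (l * d) / n) ^ 2 ≤ C ^ 2 * (n : ℝ) ^ (-ρ) := by
  have hn' : (1 : ℝ) ≤ n := by exact_mod_cast hn
  have hn0 : (0 : ℝ) < n := by linarith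
  have e : (C * (n : ℝ) ^ κ / n) ^ 2 = C ^ 2 * (n : ℝ) ^ (2 * κ - 2) := by
    rw [Real.rpow_sub hn0, div_pow, mul_pow, mul_comm 2 κ, Real.rpow_mul hn0.le]
    norm_cast
    rw [mul_div_assoc]
  calc ((2 : ℝ) ^ (l * d) / n) ^ 2 ≤ (C * (n : ℝ) ^ κ / n) ^ 2 := by gcongr
    _ = C ^ 2 * (n : ℝ) ^ (2 * κ - 2) := e
    _ ≤ C ^ 2 * (n : ℝ) ^ (-ρ) := by
      refine mul_le_mul_of_nonneg_left (Real.rpow_le_rpow_of_exponent_le hn' ?_) (by positivity)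
      linarith

lemma resolution_div_le (hn : 0 < n) (hC : 1 ≤ C) (h : (2 : ℝ) ^ (l * d) ≤ C * (n : ℝ) ^ κ)
    (hρ : ρ ≤ 2 - κ) : (2 : ℝ) ^ (l * d) / (n : ℝ) ^ 2 ≤ C * (n : ℝ) ^ (-ρ) := by
  have hn' : (1 : ℝ) ≤ n := by exact_mod_cast hn
  have hn0 : (0 : ℝ) < n := by linarith
  have e : C * (n : ℝ) ^ κ / (n : ℝ) ^ 2 = C * (n : ℝ) ^ (κ - 2) := by
    rw [Real.rpow_sub hn0]
    norm_cast
    rw [mul_div_assoc]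
  calc (2 : ℝ) ^ (l * d) / (n : ℝ) ^ 2 ≤ C * (n : ℝ) ^ κ / (n : ℝ) ^ 2 := by gcongr
    _ = C * (n : ℝ) ^ (κ - 2) := e
    _ ≤ C * (n : ℝ) ^ (-ρ) := by
      refine mul_le_mul_of_nonneg_left (Real.rpow_le_rpow_of_exponent_le hn' ?_) (by linarith)
      linarith

/-- No level makes both the approximation error and the bias of the diagonal terms small. -/
lemma rpow_le_add_resolution (hs : 0 < s) (hd : 0 < d) (hn : 0 < n) (l : ℕ) :
    (n : ℝ) ^ (-(s / (s + d))) ≤ 2 ^ (-(s * l)) + 2 ^ (l * d) / n := by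
  have hn' : (1 : ℝ) ≤ n := by exact_mod_cast hn
  have hn0 : (0 : ℝ) < n := by linarith
  have hd' : (0 : ℝ) < d := by exact_mod_cast hd
  set x : ℝ := 2 ^ (l : ℝ) with hx
  have hx0 : 0 < x := by positivity
  have e1 : (2 : ℝ) ^ (-(s * l)) = x ^ (-s) := by
    rw [hx, ← Real.rpow_mul two_pos.le]; congr 1; ring
  have e2 : (2 : ℝ) ^ (l * d) = x ^ (d : ℝ) := by
    rw [hx, ← Real.rpow_mul two_pos.le]; norm_cast
  rw [e1, e2]
  -- The level `x = 2 ^ l` is compared with the one at which the two terms balance.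
  rcases le_total x ((n : ℝ) ^ (1 / (s + d))) with h | h
  · have h1 := Real.rpow_le_rpow_of_nonpos hx0 h (by linarith : -s ≤ 0)
    rw [← Real.rpow_mul hn0.le] at h1
    have e : 1 / (s + d) * -s = -(s / (s + d)) := by ring
    rw [e] at h1
    have : 0 ≤ x ^ (d : ℝ) / n := by positivity
    linarith
  · have h1 := Real.rpow_le_rpow (by positivity) h hd'.le
    rw [← Real.rpow_mul hn0.le] at h1
    have e : (n : ℝ) ^ (-(s / (s + d))) = (n : ℝ) ^ (1 / (s + d) * (d : ℝ)) / n := by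
      conv_rhs => rw [← Real.rpow_one (n : ℝ), ← Real.rpow_mul hn0.le, ← Real.rpow_sub hn0]
      congr 1
      field_simp
      ring
    rw [e]
    have h2 : 0 ≤ x ^ (-s) := by positivity
    have h3 : (n : ℝ) ^ (1 / (s + d) * (d : ℝ)) / n ≤ x ^ (d : ℝ) / n := by gcongr
    linarith

/-- Levels whose resolution is of a given polynomial order. -/
lemma exists_levels (J d : ℕ) {γ : ℝ} (hγ : 0 < γ) : ∃ (j : ℕ → ℕ) (C : ℝ), 1 ≤ C ∧
    (∀ n, J ≤ j n) ∧ ∀ n : ℕ, 0 < n → (n : ℝ) ^ (γ * d) ≤ C * 2 ^ (j n * d) ∧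
      (2 : ℝ) ^ (j n * d) ≤ C * (n : ℝ) ^ (γ * d) := by
  refine ⟨fun n => max J (Nat.log 2 ⌊(n : ℝ) ^ γ⌋₊), max (2 ^ d) ((2 ^ J) ^ d),
    (one_le_pow₀ one_le_two).trans (le_max_left _ _), fun n => le_max_left _ _, fun n hn => ?_⟩
  have hn' : (1 : ℝ) ≤ n := by exact_mod_cast hn
  have h1 : (1 : ℝ) ≤ (n : ℝ) ^ γ := Real.one_le_rpow hn' hγ.le
  set m := ⌊(n : ℝ) ^ γ⌋₊ with hm
  have hm1 : 1 ≤ m := (Nat.one_le_floor_iff _).2 h1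
  set j := max J (Nat.log 2 m) with hj
  have hlo : (n : ℝ) ^ γ ≤ 2 * 2 ^ j := by
    have h2 : m + 1 ≤ 2 ^ (Nat.log 2 m + 1) := Nat.lt_pow_succ_log_self one_lt_two m
    have h3 : (m : ℝ) + 1 ≤ 2 ^ (Nat.log 2 m + 1) := by exact_mod_cast h2
    have h4 : (2 : ℝ) ^ Nat.log 2 m ≤ 2 ^ j := pow_le_pow_right₀ one_le_two (le_max_right _ _)
    have h5 := Nat.lt_floor_add_one ((n : ℝ) ^ γ)
    rw [pow_succ] at h3
    linarith
  have hhi : (2 : ℝ) ^ j ≤ 2 ^ J * (n : ℝ) ^ γ := by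
    have h2 : 2 ^ Nat.log 2 m ≤ m := Nat.pow_log_le_self 2 (by omega)
    have h3 : (2 : ℝ) ^ Nat.log 2 m ≤ m := by exact_mod_cast h2
    have h4 : (m : ℝ) ≤ (n : ℝ) ^ γ := Nat.floor_le (by linarith)
    have h5 : (2 : ℝ) ^ j ≤ 2 ^ (J + Nat.log 2 m) := pow_le_pow_right₀ one_le_two (by omega)
    refine h5.trans ?_
    rw [pow_add]
    gcongr
    exact h3.trans h4
  have e : (n : ℝ) ^ (γ * d) = ((n : ℝ) ^ γ) ^ d := by
    rw [Real.rpow_mul (by linarith), Real.rpow_natCast]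
  rw [e, pow_mul]
  constructor
  · refine (pow_le_pow_left₀ (by linarith) hlo d).trans ?_
    rw [mul_pow]
    gcongr
    exact le_max_left _ _
  · refine (pow_le_pow_left₀ (by positivity) hhi d).trans ?_
    rw [mul_pow]
    gcongr
    exact le_max_right _ _

end RealRates

/-- The rate of a risk that is bounded by a parametric term, a term of the order of the squared
higher resolution divided by the squared sample size, and a squared approximation error at the lower
resolution. -/
lemma rateLE_of_risk_le {a : ℕ → ℝ≥0∞} {lo hi : ℕ → ℕ} {d : ℕ} {s κ κ' ρ C C₁ C₂ : ℝ}
    (hs : 0 < s) (hd : 0 < d) (hC : 0 ≤ C) (hC₁ : 1 ≤ C₁) (hC₂ : 1 ≤ C₂)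
    (h : ∀ᶠ n : ℕ in atTop, a n ≤ ENNReal.ofReal (C * (1 / n +
        (2 ^ (hi n * d) / n) ^ 2 + (2 ^ (-(s * lo n))) ^ 2)))
    (hlo : ∀ᶠ n : ℕ in atTop, (n : ℝ) ^ κ ≤ C₁ * 2 ^ (lo n * d))
    (hhi : ∀ᶠ n : ℕ in atTop, (2 : ℝ) ^ (hi n * d) ≤ C₂ * (n : ℝ) ^ κ')
    (hρ : ρ ≤ 1) (hρ' : ρ ≤ 2 - 2 * κ') (hρ'' : ρ ≤ 2 * s * κ / d) :
    RateLE a (powRate (-ρ)) := by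
  refine rateLE_of_le_ofReal (C := C * (1 + C₂ ^ 2 + C₁ ^ (2 * s / d))) ?_
  filter_upwards [h, hlo, hhi, eventually_gt_atTop 0] with n h1 h2 h3 hn
  refine h1.trans (ENNReal.ofReal_le_ofReal ?_)
  rw [mul_assoc]
  refine mul_le_mul_of_nonneg_left ?_ hC
  have e1 := inv_le_rpow hn hρ
  have e2 := resolution_div_sq_le hn hC₂ h3 hρ'
  have e3 := two_rpow_sq_le hs hd hn hC₁ h2 hρ''
  linarith

/-- The lower bound on the rate that holds for every choice of the level. -/
lemma rateLE_of_le_risk {a : ℕ → ℝ≥0∞} {lev : ℕ → ℕ} {d n₀ : ℕ} {s c₀ : ℝ} (hs : 0 < s)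
    (hd : 0 < d) (hc₀ : 0 < c₀)
    (h : ∀ n, n₀ ≤ n →
      ENNReal.ofReal ((c₀ * (2 ^ (-(s * lev n)) + 2 ^ (lev n * d) / n)) ^ 2) ≤ a n) :
    RateLE (powRate (-(2 * s / (s + d)))) a := by
  refine rateLE_of_ofReal_le (c := c₀ ^ 2) (by positivity) ?_
  filter_upwards [eventually_ge_atTop n₀, eventually_gt_atTop 0] with n h1 hn
  refine le_trans (ENNReal.ofReal_le_ofReal ?_) (h n h1)
  rw [mul_pow]
  refine mul_le_mul_of_nonneg_left ?_ (by positivity)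
  have h2 := pow_le_pow_left₀ (by positivity) (rpow_le_add_resolution hs hd hn (lev n)) 2
  refine le_trans (le_of_eq ?_) h2
  rw [← Real.rpow_natCast, ← Real.rpow_mul (by positivity)]
  congr 1
  push_cast
  ring

lemma not_rateLE_powRate {r r' : ℝ} (h : r' < r) : ¬ RateLE (powRate r) (powRate r') := by
  intro hr
  obtain ⟨C, -, hC⟩ := hr.exists_real (fun _ => rfl) (fun _ => rfl) fun _ => by positivity
  have ht := (tendsto_rpow_atTop (sub_pos.2 h)).comp (tendsto_natCast_atTop_atTop (R := ℝ))
  obtain ⟨n, h1, h2, hn⟩ := (hC.and ((ht.eventually_gt_atTop C).and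
    (eventually_gt_atTop 0))).exists
  have hn' : (0 : ℝ) < n := by exact_mod_cast hn
  simp only [Function.comp_apply] at h2
  rw [Real.rpow_sub hn', lt_div_iff₀ (by positivity)] at h2
  linarith

end

/-! ### Rates of the estimators and of the minimax risk -/

section

variable {d : ℕ} {W : CDVData} {S : ℕ} {θ : ModelParams}

/-- If the regularity is too low for the parametric rate, then the second-order U-statistic at a
higher resolution converges faster than the best plug-in and one-step estimators. -/
lemma exists_rateLE_minimaxRisk (hW : W.IsCDV S) (hS : 0 < S) (hd : 0 < d)
    (hαβ : 0 < θ.α + θ.β) (hM : 0 ≤ θ.M) (hsd : θ.α + θ.β < d) :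
    ∃ ρ, 2 * (θ.α + θ.β) / (θ.α + θ.β + d) < ρ ∧ RateLE (minimaxRisk W θ d) (powRate (-ρ)) := by
  obtain ⟨C, hC0, hC⟩ := exists_minimaxRisk_le (θ := θ) hW hS d hαβ hM
  set s := θ.α + θ.β
  have hd' : (0 : ℝ) < d := by exact_mod_cast hd
  have hsd0 : 0 < s + d := by positivity
  -- The resolution `n ^ (3 * d / (2 * (s + d)))` exceeds the best one for the plug-in estimators,
  -- `n ^ (d / (s + d))`, by a power of `n`, and stays below the one at which the variance of the
  -- U-statistic is as large as their risk, `n ^ (2 * d / (s + d))`.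
  have hγ : 0 < 3 / (2 * (s + d)) := by positivity
  obtain ⟨j, D, hD, hJ, hj⟩ := exists_levels W.J₀ d hγ
  set κ := 3 / (2 * (s + d)) * d with hκ
  refine ⟨min 1 (min (2 - κ) (2 * s * κ / d)), lt_min ?_ (lt_min ?_ ?_),
    rateLE_of_le_ofReal (C := C * (1 + D + D ^ (2 * s / d))) ?_⟩
  · rw [div_lt_one hsd0]; linarith
  · have e : 2 - κ = (4 * s + d) / (2 * (s + d)) := by rw [hκ]; field_simp; ring
    rw [e, div_lt_div_iff₀ hsd0 (by positivity)]
    nlinarith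
  · have e : 2 * s * κ / d = 3 * s / (s + d) := by rw [hκ]; field_simp
    rw [e]
    gcongr
    norm_num
  · filter_upwards [eventually_ge_atTop 2] with n hn
    have hn0 : 0 < n := by omega
    refine (hC n (j n) hn (hJ n)).trans (ENNReal.ofReal_le_ofReal ?_)
    rw [mul_assoc]
    refine mul_le_mul_of_nonneg_left ?_ hC0
    have e1 := inv_le_rpow hn0 (min_le_left 1 (min (2 - κ) (2 * s * κ / d)))
    have e2 := resolution_div_le hn0 hD (hj n hn0).2
      ((min_le_right 1 (min (2 - κ) (2 * s * κ / d))).trans (min_le_left _ _))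
    have e3 := two_rpow_sq_le hαβ hd hn0 hD (hj n hn0).1
      ((min_le_right 1 (min (2 - κ) (2 * s * κ / d))).trans (min_le_right _ _))
    linarith

lemma RateLE.exists_le_mul_rpow {k : ℕ → ℝ≥0∞} {x : ℕ → ℝ} {κ : ℝ}
    (h : RateLE k (powRate κ)) (hκ : κ ≤ 1) (hk : ∀ n, k n = ENNReal.ofReal (x n)) :
    ∃ C, 1 ≤ C ∧ (∀ᶠ n : ℕ in atTop, x n ≤ C * (n : ℝ) ^ κ) ∧ ∀ᶠ n : ℕ in atTop, x n ≤ C * n := by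
  obtain ⟨C, hC, h⟩ := h.exists_real hk (fun _ => rfl) fun _ => by positivity
  refine ⟨C, hC, h, ?_⟩
  filter_upwards [h, eventually_gt_atTop 0] with n hn h0
  have hn' : (1 : ℝ) ≤ n := by exact_mod_cast h0
  refine hn.trans (mul_le_mul_of_nonneg_left ?_ (by linarith))
  simpa using Real.rpow_le_rpow_of_exponent_le hn' hκ

section Upper

variable {j₁ j₂ : ℕ → ℕ} {κ κ' ρ : ℝ}

/-- The rate of the integral-based estimator. -/
lemma rateLE_tunedRisk_INT (hW : W.IsCDV S) (hS : 0 < S) (hd : 0 < d)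
    (hαβ : 0 < θ.α + θ.β) (hM : 0 ≤ θ.M) (hj : Admissible W j₁ j₂)
    (hlo : RateLE (powRate κ) (kMin d j₁ j₂)) (hhi : RateLE (kMin d j₁ j₂) (powRate κ'))
    (hκ' : κ' ≤ 1) (hρ : ρ ≤ 1) (hρ' : ρ ≤ 2 - 2 * κ') (hρ'' : ρ ≤ 2 * (θ.α + θ.β) * κ / d) :
    RateLE (tunedRisk (d := d) W θ (psiINT W) j₁ j₂) (powRate (-ρ)) := by
  obtain ⟨C, hC0, hC⟩ := exists_worstRisk_INT_le (θ := θ) hW hS d hαβ hM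
  obtain ⟨C₁, hC₁, h₁⟩ := hlo.exists_real (fun _ => rfl) (kMin_eq d j₁ j₂) fun _ => by positivity
  obtain ⟨C₂, hC₂, h₂, -⟩ := hhi.exists_le_mul_rpow hκ' (kMin_eq d j₁ j₂)
  refine rateLE_of_risk_le hαβ hd hC0 hC₁ hC₂ ?_ h₁ h₂ hρ hρ' hρ''
  filter_upwards [eventually_gt_atTop 0] with n hn
  exact hC n _ _ hn (hj n).1 (hj n).2

/-- The rate of the Monte Carlo estimator. -/
lemma rateLE_tunedRisk_MC (hW : W.IsCDV S) (hS : 0 < S) (hd : 0 < d)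
    (hαβ : 0 < θ.α + θ.β) (hM : 0 ≤ θ.M) (hj : Admissible W j₁ j₂)
    (hlo : RateLE (powRate κ) (kMin d j₁ j₂)) (hhi : RateLE (kMax d j₁ j₂) (powRate κ'))
    (hκ' : κ' ≤ 1) (hρ : ρ ≤ 1) (hρ' : ρ ≤ 2 - 2 * κ') (hρ'' : ρ ≤ 2 * (θ.α + θ.β) * κ / d) :
    RateLE (tunedRisk (d := d) W θ (psiMC W) j₁ j₂) (powRate (-ρ)) := by
  obtain ⟨C₁, hC₁, h₁⟩ := hlo.exists_real (fun _ => rfl) (kMin_eq d j₁ j₂) fun _ => by positivity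
  obtain ⟨C₂, hC₂, h₂, h₃⟩ := hhi.exists_le_mul_rpow hκ' (kMax_eq d j₁ j₂)
  obtain ⟨C, hC0, hC⟩ := exists_worstRisk_MC_le (θ := θ) hW hS d hαβ hM hC₂
  refine rateLE_of_risk_le hαβ hd hC0 hC₁ hC₂ ?_ h₁ h₂ hρ hρ' hρ''
  filter_upwards [eventually_gt_atTop 0, h₃] with n hn hk
  exact hC n _ _ hn (hj n).1 (hj n).2 hk

/-- The rate of the influence function based estimator. -/
lemma rateLE_tunedRisk_IF (hW : W.IsCDV S) (hS : 0 < S) (hd : 0 < d)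
    (hαβ : 0 < θ.α + θ.β) (hM : 0 ≤ θ.M) (hj : Admissible W j₁ j₂)
    (hlo : RateLE (powRate κ) (kMax d j₁ j₂)) (hhi : RateLE (kMax d j₁ j₂) (powRate κ'))
    (hκ' : κ' ≤ 1) (hρ : ρ ≤ 1) (hρ' : ρ ≤ 2 - 2 * κ') (hρ'' : ρ ≤ 2 * (θ.α + θ.β) * κ / d) :
    RateLE (tunedRisk (d := d) W θ (psiIF W) j₁ j₂) (powRate (-ρ)) := by
  obtain ⟨C₁, hC₁, h₁⟩ := hlo.exists_real (fun _ => rfl) (kMax_eq d j₁ j₂) fun _ => by positivity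
  obtain ⟨C₂, hC₂, h₂, h₃⟩ := hhi.exists_le_mul_rpow hκ' (kMax_eq d j₁ j₂)
  obtain ⟨C, hC0, hC⟩ := exists_worstRisk_IF_le (θ := θ) hW hS d hαβ hM hC₂
  refine rateLE_of_risk_le hαβ hd hC0 hC₁ hC₂ ?_ h₁ h₂ hρ hρ' hρ''
  filter_upwards [eventually_gt_atTop 0, h₃] with n hn hk
  exact hC n _ _ hn (hj n).1 (hj n).2 hk

end Upper

/-- The minimax risk is a lower bound for the risks of the three estimators, although these are
measurable only up to null sets of the model. -/
lemma rateLE_minimaxRisk_tunedRisk (hW : W.IsCDV S) {E : EstimatorFamily d}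
    (hE : E ∈ ({psiINT W, psiMC W, psiIF W} : Set (EstimatorFamily d))) {j₁ j₂ : ℕ → ℕ}
    (hj : Admissible W j₁ j₂) : RateLE (minimaxRisk W θ d) (tunedRisk W θ E j₁ j₂) := by
  refine ⟨1, one_pos, Eventually.of_forall fun n => ?_⟩
  rw [ENNReal.coe_one, one_mul]
  rcases hE with rfl | rfl | rfl
  · exact minimaxRisk_le_worstRisk (bddMeas_cleanINT hW _ _)
      fun P hP => hP.psiINT_ae_eq hW (hj n).1 (hj n).2
  · exact minimaxRisk_le_worstRisk (bddMeas_cleanMC hW _ _) fun P hP => hP.psiMC_ae_eq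
  · exact minimaxRisk_le_worstRisk (bddMeas_cleanIF hW _ _) fun P hP => hP.psiIF_ae_eq

/-- No choice of the levels gives a faster rate than the one that balances the approximation error
and the bias of the diagonal terms. -/
lemma rateLE_powRate_tunedRisk (hW : W.IsCDV S) (hS : 0 < S) (hd : 0 < d) (hα : 0 < θ.α)
    (hβ : 0 < θ.β) (hc : ∃ c ∈ Set.Ioo θ.C₁ θ.C₂, ∃ M' < θ.M,
      W.HolderBall θ.α M' (fun _ : Fin d → ℝ => c) ∧
      W.HolderBall θ.β M' (fun _ : Fin d → ℝ => c)) {E : EstimatorFamily d}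
    (hE : E ∈ ({psiINT W, psiMC W, psiIF W} : Set (EstimatorFamily d))) {j₁ j₂ : ℕ → ℕ}
    (hj : Admissible W j₁ j₂) :
    RateLE (powRate (-(2 * (θ.α + θ.β) / (θ.α + θ.β + d)))) (tunedRisk W θ E j₁ j₂) := by
  have hαβ : 0 < θ.α + θ.β := add_pos hα hβ
  rcases hE with rfl | rfl | rfl
  · obtain ⟨c₀, hc₀, n₀, h⟩ := exists_worstRisk_INT_ge hW hS hd hα hβ hc
    exact rateLE_of_le_risk hαβ hd hc₀ fun n hn => h n _ _ hn (hj n).1 (hj n).2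
  · obtain ⟨c₀, hc₀, n₀, h⟩ := exists_worstRisk_MC_ge hW hS hd hα hβ hc
    exact rateLE_of_le_risk hαβ hd hc₀ fun n hn => h n _ _ hn (hj n).1 (hj n).2
  · obtain ⟨c₀, hc₀, n₀, h⟩ := exists_worstRisk_IF_ge hW hS hd hα hβ hc
    exact rateLE_of_le_risk hαβ hd hc₀ fun n hn => h n _ _ hn (hj n).1 (hj n).2

/-- The minimax risk is at least of the parametric order. -/
lemma rateLE_powRate_minimaxRisk (hW : W.IsCDV S) (hS : 0 < S) (hd : 0 < d) (hα : 0 < θ.α)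
    (hβ : 0 < θ.β) (hc : ∃ c ∈ Set.Ioo θ.C₁ θ.C₂, ∃ M' < θ.M,
      W.HolderBall θ.α M' (fun _ : Fin d → ℝ => c) ∧
      W.HolderBall θ.β M' (fun _ : Fin d → ℝ => c)) :
    RateLE (powRate (-1)) (minimaxRisk W θ d) := by
  obtain ⟨c₀, hc₀, h⟩ := exists_minimaxRisk_ge hW hS hd hα hβ hc
  refine rateLE_of_ofReal_le hc₀ ?_
  filter_upwards [eventually_gt_atTop 0] with n hn
  rw [Real.rpow_neg_one, ← div_eq_mul_inv]
  exact h n hn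

/-- Sequences of equal levels whose resolutions have a given order. -/
lemma exists_admissible (W : CDVData) (d : ℕ) {γ : ℝ} (hγ : 0 < γ) :
    ∃ j : ℕ → ℕ, Admissible W j j ∧ RateEq (kMin d j j) (powRate (γ * d)) ∧
      RateEq (kMax d j j) (powRate (γ * d)) := by
  obtain ⟨j, C, hC, hJ, hj⟩ := exists_levels W.J₀ d hγ
  have h1 : RateEq (fun n => ENNReal.ofReal (2 ^ (j n * d))) (powRate (γ * d)) := by
    refine ⟨rateLE_of_le_ofReal (C := C) ?_, rateLE_of_ofReal_le (c := 1 / C) (by positivity) ?_⟩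
    · filter_upwards [eventually_gt_atTop 0] with n hn
      exact ENNReal.ofReal_le_ofReal (hj n hn).2
    · filter_upwards [eventually_gt_atTop 0] with n hn
      refine ENNReal.ofReal_le_ofReal ?_
      rw [one_div, inv_mul_le_iff₀ (by linarith)]
      exact (hj n hn).1
  have e1 : kMin d j j = fun n => ENNReal.ofReal (2 ^ (j n * d)) := by
    ext n; rw [kMin_eq, min_self]
  have e2 : kMax d j j = fun n => ENNReal.ofReal (2 ^ (j n * d)) := by
    ext n; rw [kMax_eq, max_self]
  exact ⟨j, fun n => ⟨hJ n, hJ n⟩, e1 ▸ h1, e2 ▸ h1⟩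

end

theorem mainTheorem11 (d : ℕ) (hd : 0 < d) (S : ℕ) (W : CDVData) (hW : W.IsCDV S)
    (θ : ModelParams) (hα : 0 < θ.α) (hβ : 0 < θ.β) (hM : 0 < θ.M)
    (hαS : θ.α < S) (hβS : θ.β < S)
    (hc : ∃ c ∈ Set.Ioo θ.C₁ θ.C₂, ∃ M' < θ.M,
      W.HolderBall θ.α M' (fun _ : Fin d → ℝ => c) ∧
      W.HolderBall θ.β M' (fun _ : Fin d → ℝ => c)) :
    ((d : ℝ) / 2 ≤ (θ.α + θ.β) / 2 →
      (∀ j₁ j₂ : ℕ → ℕ, Admissible W j₁ j₂ →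
        RateLE (powRate (d / (2 * θ.α + 2 * θ.β))) (kMin d j₁ j₂) →
        RateLE (kMin d j₁ j₂) (powRate (1 / 2)) →
        MinimaxRateOptimal (d := d) W θ (psiINT W) j₁ j₂ ∧
          RateEq (tunedRisk (d := d) W θ (psiINT W) j₁ j₂) (powRate (-1))) ∧
      (∀ j₁ j₂ : ℕ → ℕ, Admissible W j₁ j₂ →
        RateLE (powRate (d / (2 * θ.α + 2 * θ.β))) (kMin d j₁ j₂) →
        RateLE (kMax d j₁ j₂) (powRate (1 / 2)) →
        MinimaxRateOptimal (d := d) W θ (psiMC W) j₁ j₂ ∧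
          RateEq (tunedRisk (d := d) W θ (psiMC W) j₁ j₂) (powRate (-1))) ∧
      (∀ j₁ j₂ : ℕ → ℕ, Admissible W j₁ j₂ →
        RateLE (powRate (d / (2 * θ.α + 2 * θ.β))) (kMax d j₁ j₂) →
        RateLE (kMax d j₁ j₂) (powRate (1 / 2)) →
        MinimaxRateOptimal (d := d) W θ (psiIF W) j₁ j₂ ∧
          RateEq (tunedRisk (d := d) W θ (psiIF W) j₁ j₂) (powRate (-1)))) ∧
    ((θ.α + θ.β) / 2 < (d : ℝ) / 2 →
      (∀ E ∈ ({psiINT W, psiMC W, psiIF W} : Set (EstimatorFamily d)),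
        (∀ j₁ j₂ : ℕ → ℕ, Admissible W j₁ j₂ → ¬ MinimaxRateOptimal W θ E j₁ j₂) ∧
        IsBestRate W θ E (powRate (-((2 * θ.α + 2 * θ.β) / (θ.α + θ.β + d))))) ∧
      (∀ j₁ j₂ : ℕ → ℕ, Admissible W j₁ j₂ →
        RateEq (kMin d j₁ j₂) (powRate (d / (θ.α + θ.β + d))) →
        RateEq (tunedRisk (d := d) W θ (psiINT W) j₁ j₂)
          (powRate (-((2 * θ.α + 2 * θ.β) / (θ.α + θ.β + d))))) ∧
      (∀ j₁ j₂ : ℕ → ℕ, Admissible W j₁ j₂ →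
        RateEq (kMin d j₁ j₂) (powRate (d / (θ.α + θ.β + d))) →
        RateEq (kMax d j₁ j₂) (powRate (d / (θ.α + θ.β + d))) →
        RateEq (tunedRisk (d := d) W θ (psiMC W) j₁ j₂)
          (powRate (-((2 * θ.α + 2 * θ.β) / (θ.α + θ.β + d))))) ∧
      (∀ j₁ j₂ : ℕ → ℕ, Admissible W j₁ j₂ →
        RateEq (kMax d j₁ j₂) (powRate (d / (θ.α + θ.β + d))) →
        RateEq (tunedRisk (d := d) W θ (psiIF W) j₁ j₂)
          (powRate (-((2 * θ.α + 2 * θ.β) / (θ.α + θ.β + d)))))) := by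
  have hS : 0 < S := by
    have : (0 : ℝ) < S := hα.trans hαS
    exact_mod_cast this
  have hαβ : 0 < θ.α + θ.β := add_pos hα hβ
  have hd' : (0 : ℝ) < d := by exact_mod_cast hd
  have e2 : 2 * θ.α + 2 * θ.β = 2 * (θ.α + θ.β) := by ring
  have hlow := rateLE_powRate_minimaxRisk hW hS hd hα hβ hc
  rw [e2]
  constructor
  · intro h
    have hparam : ∀ E ∈ ({psiINT W, psiMC W, psiIF W} : Set (EstimatorFamily d)), ∀ j₁ j₂ : ℕ → ℕ,
        Admissible W j₁ j₂ → RateLE (tunedRisk W θ E j₁ j₂) (powRate (-1)) →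
        MinimaxRateOptimal W θ E j₁ j₂ ∧ RateEq (tunedRisk W θ E j₁ j₂) (powRate (-1)) :=
      fun E hE j₁ j₂ hj hr =>
        ⟨hr.trans hlow, hr, hlow.trans (rateLE_minimaxRisk_tunedRisk hW hE hj)⟩
    -- The resolution `n ^ (d / (2 * (α + β)))` has a squared approximation error of order `1 / n`.
    have e : (1 : ℝ) ≤ 2 * (θ.α + θ.β) * (d / (2 * (θ.α + θ.β))) / d := by
      rw [mul_div_cancel₀ _ (by positivity), div_self hd'.ne']
    refine ⟨fun j₁ j₂ hj h₁ h₂ => hparam _ (by simp) j₁ j₂ hj ?_,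
      fun j₁ j₂ hj h₁ h₂ => hparam _ (by simp) j₁ j₂ hj ?_,
      fun j₁ j₂ hj h₁ h₂ => hparam _ (by simp) j₁ j₂ hj ?_⟩
    · exact rateLE_tunedRisk_INT hW hS hd hαβ hM.le hj h₁ h₂ (by norm_num) le_rfl (by norm_num) e
    · exact rateLE_tunedRisk_MC hW hS hd hαβ hM.le hj h₁ h₂ (by norm_num) le_rfl (by norm_num) e
    · exact rateLE_tunedRisk_IF hW hS hd hαβ hM.le hj h₁ h₂ (by norm_num) le_rfl (by norm_num) e
  · intro h
    have hsd : θ.α + θ.β < d := by linarith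
    have hsd0 : 0 < θ.α + θ.β + d := by positivity
    have hbest : ∀ E ∈ ({psiINT W, psiMC W, psiIF W} : Set (EstimatorFamily d)), ∀ j₁ j₂ : ℕ → ℕ,
        Admissible W j₁ j₂ →
        RateLE (powRate (-(2 * (θ.α + θ.β) / (θ.α + θ.β + d)))) (tunedRisk W θ E j₁ j₂) :=
      fun E hE j₁ j₂ hj => rateLE_powRate_tunedRisk hW hS hd hα hβ hc hE hj
    -- At the resolution `n ^ (d / (α + β + d))` the approximation error and the bias of the
    -- diagonal terms are of the same order.
    have r1 : d / (θ.α + θ.β + d) ≤ 1 := by rw [div_le_one hsd0]; linarith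
    have r2 : 2 * (θ.α + θ.β) / (θ.α + θ.β + d) ≤ 1 := by rw [div_le_one hsd0]; linarith
    have r3 : 2 * (θ.α + θ.β) / (θ.α + θ.β + d) ≤ 2 - 2 * (d / (θ.α + θ.β + d)) := by
      refine le_of_eq ?_; field_simp; ring
    have r4 : 2 * (θ.α + θ.β) / (θ.α + θ.β + d) ≤
        2 * (θ.α + θ.β) * (d / (θ.α + θ.β + d)) / d := by
      refine le_of_eq ?_; field_simp
    have hINT : ∀ j₁ j₂ : ℕ → ℕ, Admissible W j₁ j₂ →
        RateEq (kMin d j₁ j₂) (powRate (d / (θ.α + θ.β + d))) →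
        RateEq (tunedRisk (d := d) W θ (psiINT W) j₁ j₂)
          (powRate (-(2 * (θ.α + θ.β) / (θ.α + θ.β + d)))) := fun j₁ j₂ hj hk =>
      ⟨rateLE_tunedRisk_INT hW hS hd hαβ hM.le hj hk.2 hk.1 r1 r2 r3 r4,
        hbest _ (by simp) j₁ j₂ hj⟩
    have hMC : ∀ j₁ j₂ : ℕ → ℕ, Admissible W j₁ j₂ →
        RateEq (kMin d j₁ j₂) (powRate (d / (θ.α + θ.β + d))) →
        RateEq (kMax d j₁ j₂) (powRate (d / (θ.α + θ.β + d))) →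
        RateEq (tunedRisk (d := d) W θ (psiMC W) j₁ j₂)
          (powRate (-(2 * (θ.α + θ.β) / (θ.α + θ.β + d)))) := fun j₁ j₂ hj hk hk' =>
      ⟨rateLE_tunedRisk_MC hW hS hd hαβ hM.le hj hk.2 hk'.1 r1 r2 r3 r4,
        hbest _ (by simp) j₁ j₂ hj⟩
    have hIF : ∀ j₁ j₂ : ℕ → ℕ, Admissible W j₁ j₂ →
        RateEq (kMax d j₁ j₂) (powRate (d / (θ.α + θ.β + d))) →
        RateEq (tunedRisk (d := d) W θ (psiIF W) j₁ j₂)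
          (powRate (-(2 * (θ.α + θ.β) / (θ.α + θ.β + d)))) := fun j₁ j₂ hj hk =>
      ⟨rateLE_tunedRisk_IF hW hS hd hαβ hM.le hj hk.2 hk.1 r1 r2 r3 r4,
        hbest _ (by simp) j₁ j₂ hj⟩
    obtain ⟨ρ, hρ, hfast⟩ := exists_rateLE_minimaxRisk hW hS hd hαβ hM.le hsd
    obtain ⟨j, hj, hmin, hmax⟩ := exists_admissible W d (γ := 1 / (θ.α + θ.β + d)) (by positivity)
    rw [one_div_mul_eq_div] at hmin hmax
    refine ⟨fun E hE => ⟨fun j₁ j₂ hj hopt => ?_, hbest E hE, j, j, hj, ?_⟩, hINT, hMC, hIF⟩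
    · exact not_rateLE_powRate (neg_lt_neg hρ) (((hbest E hE j₁ j₂ hj).trans hopt).trans hfast)
    · rcases hE with rfl | rfl | rfl
      · exact hINT j j hj hmin
      · exact hMC j j hj hmin hmax
      · exact hIF j j hj hmax

end
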